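/- **Setting.** Let $R$ be a domain of characteristic $0$, $G$ a simple, simply connected complex algebraic group with maximal torus $T$, character lattice $T^*$ (the weight lattice), roots $\Phi$, simple roots $\alpha_1,\dots,\alpha_n$, highest root $\theta$, Weyl group $W$ and coroot lattice $Q^\vee$. Let $W_a=Q^\vee\rtimes W$ be the affine Weyl group, with translations $t_\lambda$ ($\lambda\in Q^\vee$) and $s_0=t_{\theta^\vee}s_\theta$. Let $S$ be one of the following. (i) For a commutative one-dimensional formal group law $F$ over $R$, the formal group algebra $S=R[[x_\mu\mid\mu\in T^*]]/\mathcal J_F$. Here $R[[x_\mu]]$ is the completion of $R[x_\mu\mid \mu\in T^*]$ at its augmentation ideal, and $\mathcal J_F$ is the closure of the ideal generated by $x_0$ and all $x_{\mu+\nu}-F(x_\mu,x_\nu)$. (ii) For $\mathfrak c\in R$ and the connective formal group law $F(x,y)=x+y-\mathfrak cxy$, the polynomial version $S=R[x_\mu\mid\mu\in T^*]/(x_0,\ x_{\mu+\nu}-F(x_\mu,x_\nu))$. The group $W$ acts on $S$ by $w(x_\mu)=x_{w(\mu)}$, and $W_a$ acts through $W_a\to W$. Put $\mathcal Q=S[\frac1{x_\alpha}\mid\alpha\in\Phi]$.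 Let $\mathcal Q_{W_a}=\mathcal Q\rtimes R[W_a]$, with left $\mathcal Q$-basis $\eta_w$ and product $c\eta_w\,c'\eta_{w'}=c\,w(c')\,\eta_{ww'}$, and let $\mathcal Q_{Q^\vee}=\mathcal Q\rtimes R[Q^\vee]$, with basis $\eta_{t_\lambda}$. Let $\mathrm{pr}:\mathcal Q_{W_a}\to\mathcal Q_{Q^\vee}$ be the left $\mathcal Q$-linear map with $\mathrm{pr}(\eta_{t_\lambda w})=\eta_{t_\lambda}$ for $w\in W$. Let $\mathbf D_{W_a}\subset\mathcal Q_{W_a}$ be the subring generated by $S$, by $X_i=\frac1{x_{\alpha_i}}(1-\eta_{s_i})$ for $1\le i\le n$, and by $X_0=\frac1{x_{-\theta}}(1-\eta_{s_0})$. Put $\mathbf D_{W_a/W}=\mathrm{pr}(\mathbf D_{W_a})$, a left $S$-module. Let $\mathcal Q_{Q^\vee}^*=\mathrm{Hom}_{\mathcal Q}(\mathcal Q_{Q^\vee},\mathcal Q)$, and let $\mathbf D^*_{W_a/W}=\mathrm{Hom}_S(\mathbf D_{W_a/W},S)\subset\mathcal Q_{Q^\vee}^*$ be the set of those $f$ whose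 restriction to $\mathbf D_{W_a/W}$ is an $S$-linear map to $S$. Assume that $x_\alpha$ and $x_\beta$ are coprime in $S$ (that is, $x_\alpha\mid x_\beta s$ implies $x_\alpha\mid s$ for $s\in S$) for any two roots $\beta\ne\pm\alpha$ that are both divisible by $2$ in $T^*$. (Such pairs of roots exist only in type $C_n$, $n\ge2$, where they are long roots.) **Statement.** An element $f\in\mathcal Q_{Q^\vee}^*$ belongs to $\mathbf D^*_{W_a/W}$ if and only if $f(\eta_{t_\lambda})\in S$ for all $\lambda\in Q^\vee$ and $$f\big((1-\eta_{t_{\alpha^\vee}})^d\,\eta_{t_\lambda}\big)\in x_\alpha^d\,S\qquad\text{for all }\alpha\in\Phi,\ \lambda\in Q^\vee,\ d\ge1 .$$ -/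

import Mathlib

noncomputable section

namespace SmallTorus

open MvPolynomial

/-! ### Formal group algebras -/

section FormalGroupAlgebra

variable (R M : Type*) [CommRing R]

/-- The augmentation ideal `ker (R[x_M] → R, x_μ ↦ 0)` of the polynomial ring `R[x_M]`. -/
abbrev augIdeal : Ideal (MvPolynomial M R) :=
  RingHom.ker (MvPolynomial.constantCoeff : MvPolynomial M R →+* R)

/-- `R[[x_M]]`, the completion of `R[x_M]` at its augmentation ideal. -/
abbrev PowerSeriesAlgebra : Type _ := AdicCompletion (augIdeal R M) (MvPolynomial M R)

variable {R M}

lemma X_mem_augIdeal (μ : M) : (X μ : MvPolynomial M R) ∈ augIdeal R M := by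
  simp [RingHom.mem_ker]

/-- The truncation of `F(x_μ, x_ν)` to exponents less than `k`. -/
def truncatedSum (F : FormalGroup R) (μ ν : M) (k : ℕ) : MvPolynomial M R :=
  ∑ i ∈ Finset.range k, ∑ j ∈ Finset.range k,
    C (F.toPowerSeries.coeff (Finsupp.single 0 i + Finsupp.single 1 j)) * X μ ^ i * X ν ^ j

lemma truncatedSum_sub_mem (F : FormalGroup R) (μ ν : M) (k : ℕ) :
    truncatedSum F μ ν (k + 1) - truncatedSum F μ ν k ∈ augIdeal R M ^ k := by
  have hμ : ∀ j, (C (F.toPowerSeries.coeff (Finsupp.single 0 k + Finsupp.single 1 j))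
      * X μ ^ k * X ν ^ j : MvPolynomial M R) ∈ augIdeal R M ^ k := fun j =>
    Ideal.mul_mem_right _ _ (Ideal.mul_mem_left _ _ (Ideal.pow_mem_pow (X_mem_augIdeal μ) k))
  have hν : ∀ i, (C (F.toPowerSeries.coeff (Finsupp.single 0 i + Finsupp.single 1 k))
      * X μ ^ i * X ν ^ k : MvPolynomial M R) ∈ augIdeal R M ^ k := fun i =>
    Ideal.mul_mem_left _ _ (Ideal.pow_mem_pow (X_mem_augIdeal ν) k)
  have h : truncatedSum F μ ν (k + 1) - truncatedSum F μ ν k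
      = (∑ i ∈ Finset.range k,
          C (F.toPowerSeries.coeff (Finsupp.single 0 i + Finsupp.single 1 k))
            * X μ ^ i * X ν ^ k)
        + ∑ j ∈ Finset.range (k + 1),
          C (F.toPowerSeries.coeff (Finsupp.single 0 k + Finsupp.single 1 j))
            * X μ ^ k * X ν ^ j := by
    unfold truncatedSum
    rw [Finset.sum_range_succ]
    simp only [Finset.sum_range_succ _ k, Finset.sum_add_distrib]
    ring
  rw [h]
  exact Ideal.add_mem _ (Ideal.sum_mem _ fun i _ => hν i) (Ideal.sum_mem _ fun j _ => hμ j)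

/-- The element `F(x_μ, x_ν)` of `R[[x_M]]`. -/
def formalSum (F : FormalGroup R) (μ ν : M) : PowerSeriesAlgebra R M :=
  AdicCompletion.mk (augIdeal R M) (MvPolynomial M R)
    (AdicCompletion.AdicCauchySequence.mk (augIdeal R M) (MvPolynomial M R)
      (truncatedSum F μ ν) fun k => by
        rw [SModEq.comm, SModEq.sub_mem, smul_eq_mul, Ideal.mul_top]
        exact truncatedSum_sub_mem F μ ν k)

lemma evalₐ_formalSum (F : FormalGroup R) (μ ν : M) (k : ℕ) :
    AdicCompletion.evalₐ (augIdeal R M) k (formalSum F μ ν)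
      = Ideal.Quotient.mk _ (truncatedSum F μ ν k) := by
  simp [formalSum]

/-- The variable `x_μ` in `R[[x_M]]`. -/
def var (R : Type*) [CommRing R] {M : Type*} (μ : M) : PowerSeriesAlgebra R M :=
  AdicCompletion.of (augIdeal R M) (MvPolynomial M R) (X μ)

lemma evalₐ_var (μ : M) (k : ℕ) :
    AdicCompletion.evalₐ (augIdeal R M) k (var R μ) = Ideal.Quotient.mk _ (X μ) := by
  simp [var]

lemma rename_mem_pow (e : M → M) (k : ℕ) :
    augIdeal R M ^ k ≤ (augIdeal R M ^ k).comap (rename e : _ →ₐ[R] MvPolynomial M R).toRingHom := by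
  have h : augIdeal R M ≤ (augIdeal R M).comap (rename e : _ →ₐ[R] MvPolynomial M R).toRingHom := by
    intro p hp
    rw [RingHom.mem_ker] at hp
    rw [Ideal.mem_comap, RingHom.mem_ker]
    simpa using hp
  exact (Ideal.pow_right_mono h k).trans (Ideal.le_comap_pow _ _)

lemma rename_compatible (e : M → M) {m n : ℕ} (hle : m ≤ n) :
    (Ideal.Quotient.factorPow (augIdeal R M) hle).comp
      ((Ideal.quotientMap (augIdeal R M ^ n)
        (rename e : _ →ₐ[R] MvPolynomial M R).toRingHom (rename_mem_pow e n)).comp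
          (AdicCompletion.evalₐ (augIdeal R M) n).toRingHom) =
      (Ideal.quotientMap (augIdeal R M ^ m)
        (rename e : _ →ₐ[R] MvPolynomial M R).toRingHom (rename_mem_pow e m)).comp
          (AdicCompletion.evalₐ (augIdeal R M) m).toRingHom := by
  ext z
  obtain ⟨f, rfl⟩ := AdicCompletion.mk_surjective (augIdeal R M) (MvPolynomial M R) z
  have hf : Ideal.Quotient.mk (augIdeal R M ^ m) (f n) =
      Ideal.Quotient.mk (augIdeal R M ^ m) (f m) := AdicCompletion.Ideal.mk_eq_mk _ hle f
  rw [Ideal.Quotient.eq] at hf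
  have h := rename_mem_pow e m hf
  rw [Ideal.mem_comap, map_sub, ← Ideal.Quotient.eq] at h
  simpa using h

/-- The continuous endomorphism of `R[[x_M]]` with `x_μ ↦ x_(e μ)`. -/
def completedRename (R : Type*) [CommRing R] {M : Type*} (e : M → M) :
    PowerSeriesAlgebra R M →+* PowerSeriesAlgebra R M :=
  AdicCompletion.liftRingHom (augIdeal R M)
    (fun k => (Ideal.quotientMap (augIdeal R M ^ k)
      (rename e : _ →ₐ[R] MvPolynomial M R).toRingHom (rename_mem_pow e k)).comp
        (AdicCompletion.evalₐ (augIdeal R M) k).toRingHom)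
    (fun hle => rename_compatible e hle)

lemma evalₐ_completedRename (e : M → M) (k : ℕ) (z : PowerSeriesAlgebra R M) :
    AdicCompletion.evalₐ (augIdeal R M) k (completedRename R e z)
      = Ideal.quotientMap (augIdeal R M ^ k) (rename e : _ →ₐ[R] MvPolynomial M R).toRingHom
          (rename_mem_pow e k) (AdicCompletion.evalₐ (augIdeal R M) k z) := by
  exact AdicCompletion.evalₐ_liftRingHom (augIdeal R M) _ (fun hle => rename_compatible e hle) k z

lemma completedRename_id (z : PowerSeriesAlgebra R M) :
    completedRename R (fun μ : M => μ) z = z := by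
  refine AdicCompletion.ext_evalₐ fun k => ?_
  rw [evalₐ_completedRename]
  obtain ⟨p, hp⟩ := Ideal.Quotient.mk_surjective (AdicCompletion.evalₐ (augIdeal R M) k z)
  rw [← hp, Ideal.quotientMap_mk]
  congr 1
  exact rename_id_apply p

lemma completedRename_comp (e f : M → M) (z : PowerSeriesAlgebra R M) :
    completedRename R (fun μ => e (f μ)) z = completedRename R e (completedRename R f z) := by
  refine AdicCompletion.ext_evalₐ fun k => ?_
  simp only [evalₐ_completedRename]
  obtain ⟨p, hp⟩ := Ideal.Quotient.mk_surjective (AdicCompletion.evalₐ (augIdeal R M) k z)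
  simp only [← hp, Ideal.quotientMap_mk]
  congr 1
  exact (rename_rename f e p).symm

lemma completedRename_var (e : M → M) (μ : M) : completedRename R e (var R μ) = var R (e μ) := by
  refine AdicCompletion.ext_evalₐ fun k => ?_
  rw [evalₐ_completedRename, evalₐ_var, evalₐ_var, Ideal.quotientMap_mk]
  congr 1
  exact rename_X e μ

lemma completedRename_formalSum (F : FormalGroup R) (e : M → M) (μ ν : M) :
    completedRename R e (formalSum F μ ν) = formalSum F (e μ) (e ν) := by
  refine AdicCompletion.ext_evalₐ fun k => ?_
  rw [evalₐ_completedRename, evalₐ_formalSum, evalₐ_formalSum, Ideal.quotientMap_mk]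
  congr 1
  simp [truncatedSum]

variable [AddCommGroup M]

/-- The ideal of `R[[x_M]]` generated by `x_0` and all `x_(μ+ν) - F(x_μ, x_ν)`. -/
def relationIdeal (F : FormalGroup R) (M : Type*) [AddCommGroup M] :
    Ideal (PowerSeriesAlgebra R M) :=
  Ideal.span ({var R 0} ∪
    Set.range fun p : M × M => var R (p.1 + p.2) - formalSum F p.1 p.2)

/-- The closure of an ideal of `R[[x_M]]` in the adic topology: the elements that agree with an
element of the ideal modulo every power of the augmentation ideal. -/
def closureIdeal (J : Ideal (PowerSeriesAlgebra R M)) : Ideal (PowerSeriesAlgebra R M) :=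
  ⨅ k : ℕ, (J.map (AdicCompletion.evalₐ (augIdeal R M) k)).comap
    (AdicCompletion.evalₐ (augIdeal R M) k)

lemma relationIdeal_le (F : FormalGroup R) (e : M →+ M) :
    relationIdeal F M ≤ (relationIdeal F M).comap (completedRename R e) := by
  rw [relationIdeal, Ideal.span_le]
  rintro z (rfl | ⟨p, rfl⟩)
  · rw [SetLike.mem_coe, Ideal.mem_comap, completedRename_var, map_zero]
    exact Ideal.subset_span (Or.inl rfl)
  · rw [SetLike.mem_coe, Ideal.mem_comap, map_sub, completedRename_var,
      completedRename_formalSum, map_add]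
    exact Ideal.subset_span (Or.inr ⟨(e p.1, e p.2), rfl⟩)

lemma closureIdeal_le (F : FormalGroup R) (e : M →+ M) :
    closureIdeal (relationIdeal F M) ≤
      (closureIdeal (relationIdeal F M)).comap (completedRename R e) := by
  intro z hz
  simp only [closureIdeal, Ideal.mem_iInf, Ideal.mem_comap] at hz ⊢
  intro k
  rw [evalₐ_completedRename, ← Ideal.mem_comap]
  refine (?_ : Ideal.map _ _ ≤ _) (hz k)
  rw [Ideal.map_le_iff_le_comap]
  intro y hy
  rw [Ideal.mem_comap, Ideal.mem_comap, ← evalₐ_completedRename]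
  exact Ideal.mem_map_of_mem _ (relationIdeal_le F e hy)

/-- The formal group algebra `R[[x_μ | μ ∈ M]] / 𝒥_F` of the lattice `M`. -/
abbrev FormalGroupAlgebra (F : FormalGroup R) (M : Type*) [AddCommGroup M] : Type _ :=
  PowerSeriesAlgebra R M ⧸ closureIdeal (relationIdeal F M)

/-- The relations `x_0 = 0` and `x_(μ+ν) = x_μ + x_ν - c x_μ x_ν` in `R[x_M]`. -/
def connectiveIdeal (c : R) (M : Type*) [AddCommGroup M] : Ideal (MvPolynomial M R) :=
  Ideal.span ({X 0} ∪
    Set.range fun p : M × M => X (p.1 + p.2) - (X p.1 + X p.2 - C c * X p.1 * X p.2))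

lemma connectiveIdeal_le (c : R) (e : M →+ M) :
    connectiveIdeal c M ≤
      (connectiveIdeal c M).comap (rename e : _ →ₐ[R] MvPolynomial M R).toRingHom := by
  rw [connectiveIdeal, Ideal.span_le]
  rintro z (rfl | ⟨p, rfl⟩)
  · exact Ideal.subset_span (Or.inl (by simp))
  · exact Ideal.subset_span (Or.inr ⟨(e p.1, e p.2), by simp⟩)

/-- The polynomial version of the formal group algebra for the connective formal group law
`x + y - c x y`. -/
abbrev ConnectiveAlgebra (c : R) (M : Type*) [AddCommGroup M] : Type _ :=
  MvPolynomial M R ⧸ connectiveIdeal c M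

end FormalGroupAlgebra

/-! ### The Weyl group action -/

section WeylGroup

variable {ι M N : Type*} [AddCommGroup M] [AddCommGroup N]

/-- A ring `S` with elements `x_μ` indexed by the character lattice `M` and an action of the Weyl
group with `w(x_μ) = x_(w μ)`. The two instances used below are the formal group algebra and its
polynomial version for a connective formal group law. -/
class CharacterRing (P : RootPairing ι ℤ M N) (S : Type*) [CommRing S] extends
    MulSemiringAction P.weylGroup S where
  x : M → S
  smul_x : ∀ (w : P.weylGroup) (μ : M), w • x μ = x (w • μ)

/-- The action of `w` on the lattice `M`. -/
abbrev weightHom (P : RootPairing ι ℤ M N) (w : P.weylGroup) : M →+ M :=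
  DistribSMul.toAddMonoidHom M w

instance formalGroupAlgebraCharacterRing {R : Type*} [CommRing R] (P : RootPairing ι ℤ M N)
    (F : FormalGroup R) : CharacterRing P (FormalGroupAlgebra F M) where
  smul w := Ideal.quotientMap _ (completedRename R (weightHom P w))
    (closureIdeal_le F (weightHom P w))
  one_smul z := by
    obtain ⟨z, rfl⟩ := Ideal.Quotient.mk_surjective z
    refine (Ideal.quotientMap_mk (H := closureIdeal_le F (weightHom P 1))).trans ?_
    congr 1
    have h : (weightHom P 1 : M → M) = fun μ => μ := funext fun μ => one_smul _ μ
    rw [h]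
    exact completedRename_id z
  mul_smul v w z := by
    obtain ⟨z, rfl⟩ := Ideal.Quotient.mk_surjective z
    refine (Ideal.quotientMap_mk (H := closureIdeal_le F (weightHom P (v * w)))).trans ?_
    refine Eq.trans ?_ (Ideal.quotientMap_mk (H := closureIdeal_le F (weightHom P v))).symm
    congr 1
    have h : (weightHom P (v * w) : M → M) = fun μ => weightHom P v (weightHom P w μ) :=
      funext fun μ => mul_smul v w μ
    rw [← completedRename_comp, h]
  smul_zero w := map_zero (Ideal.quotientMap _ _ (closureIdeal_le F (weightHom P w)))
  smul_add w := map_add (Ideal.quotientMap _ _ (closureIdeal_le F (weightHom P w)))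
  smul_one w := map_one (Ideal.quotientMap _ _ (closureIdeal_le F (weightHom P w)))
  smul_mul w := map_mul (Ideal.quotientMap _ _ (closureIdeal_le F (weightHom P w)))
  x μ := Ideal.Quotient.mk _ (var R μ)
  smul_x w μ := by
    refine (Ideal.quotientMap_mk (H := closureIdeal_le F (weightHom P w))).trans ?_
    rw [completedRename_var]
    rfl

instance connectiveAlgebraCharacterRing {R : Type*} [CommRing R] (P : RootPairing ι ℤ M N)
    (c : R) : CharacterRing P (ConnectiveAlgebra c M) where
  smul w := Ideal.quotientMap _ _ (connectiveIdeal_le c (weightHom P w))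
  one_smul z := by
    obtain ⟨z, rfl⟩ := Ideal.Quotient.mk_surjective z
    refine (Ideal.quotientMap_mk (H := connectiveIdeal_le c (weightHom P 1))).trans ?_
    congr 1
    have h : (weightHom P 1 : M → M) = id := funext fun μ => one_smul _ μ
    change rename (weightHom P 1) z = z
    rw [h]
    exact rename_id_apply z
  mul_smul v w z := by
    obtain ⟨z, rfl⟩ := Ideal.Quotient.mk_surjective z
    refine (Ideal.quotientMap_mk (H := connectiveIdeal_le c (weightHom P (v * w)))).trans ?_
    refine Eq.trans ?_ (Ideal.quotientMap_mk (H := connectiveIdeal_le c (weightHom P v))).symm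
    congr 1
    refine Eq.trans ?_ (rename_rename (weightHom P w) (weightHom P v) z).symm
    have h : (weightHom P (v * w) : M → M) = weightHom P v ∘ weightHom P w :=
      funext fun μ => mul_smul v w μ
    change rename (weightHom P (v * w)) z = _
    rw [h]
  smul_zero w := map_zero (Ideal.quotientMap _ _ (connectiveIdeal_le c (weightHom P w)))
  smul_add w := map_add (Ideal.quotientMap _ _ (connectiveIdeal_le c (weightHom P w)))
  smul_one w := map_one (Ideal.quotientMap _ _ (connectiveIdeal_le c (weightHom P w)))
  smul_mul w := map_mul (Ideal.quotientMap _ _ (connectiveIdeal_le c (weightHom P w)))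
  x μ := Ideal.Quotient.mk _ (X μ)
  smul_x w μ := by
    refine (Ideal.quotientMap_mk (H := connectiveIdeal_le c (weightHom P w))).trans ?_
    congr 1
    exact rename_X _ μ

variable (P : RootPairing ι ℤ M N)

/-- The action of the Weyl group on the cocharacter lattice, contragredient to the one on `M`:
`⟨w μ, w λ⟩ = ⟨μ, λ⟩`. -/
def coweightAction : P.weylGroup →* MulAut (Multiplicative N) where
  toFun w := AddEquiv.toMultiplicative
    (RootPairing.Equiv.coweightEquiv P P (w⁻¹ : P.weylGroup).1).toAddEquiv
  map_one' := by
    ext l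
    simp
  map_mul' v w := by
    ext l
    simp

/-- The affine Weyl group `Q^∨ ⋊ W`; here `N` is the coroot lattice `Q^∨`, as the root datum is
simply connected. -/
abbrev AffineWeylGroup : Type _ := Multiplicative N ⋊[coweightAction P] P.weylGroup

/-- The translation `t_λ`. -/
def translation (l : N) : AffineWeylGroup P := SemidirectProduct.inl (Multiplicative.ofAdd l)

/-- The reflection `s_i` in the root `α_i` as an element of the affine Weyl group. -/
def refl (i : ι) : AffineWeylGroup P :=
  SemidirectProduct.inr (RootPairing.weylGroup.ofIdx P i)

/-- The affine reflection in `-θ + δ`, that is, `s_0 = t_(θ^∨) s_θ`. -/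
def affineRefl (θ : ι) : AffineWeylGroup P := translation P (P.coroot θ) * refl P θ

end WeylGroup

/-! ### Localization, twisted group algebra, affine Demazure algebra -/

section Demazure

variable {ι M N : Type*} [AddCommGroup M] [AddCommGroup N]
variable (P : RootPairing ι ℤ M N) (S : Type*) [CommRing S] [CharacterRing P S]

/-- The element `x_α` of `S` for the root `α` with index `i`. -/
def xRoot (i : ι) : S := CharacterRing.x P (P.root i)

/-- The multiplicative set generated by the `x_α`. -/
def rootDenominators : Submonoid S := Submonoid.closure (Set.range (xRoot P S))

/-- `𝒬 = S[1/x_α | α ∈ Φ]`. -/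
abbrev LocalizedRing : Type _ := Localization (rootDenominators P S)

lemma rootDenominators_le (w : P.weylGroup) :
    rootDenominators P S ≤
      (rootDenominators P S).comap (MulSemiringAction.toRingHom P.weylGroup S w) := by
  rw [rootDenominators, Submonoid.closure_le]
  rintro - ⟨i, rfl⟩
  refine Submonoid.subset_closure ⟨P.weylGroupToPerm w i, ?_⟩
  change xRoot P S _ = w • xRoot P S i
  rw [xRoot, xRoot, CharacterRing.smul_x, RootPairing.weylGroup_apply_root]

/-- The action of `W` on `𝒬` extending the one on `S`. -/
instance localizedRingAction : MulSemiringAction P.weylGroup (LocalizedRing P S) where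
  smul w := IsLocalization.map (LocalizedRing P S)
    (MulSemiringAction.toRingHom P.weylGroup S w) (rootDenominators_le P S w)
  one_smul q := by
    obtain ⟨s, t, rfl⟩ := IsLocalization.exists_mk'_eq (rootDenominators P S) q
    refine (IsLocalization.map_mk' (rootDenominators_le P S 1) s t).trans ?_
    congr 1
    · exact one_smul _ s
    · exact Subtype.ext (one_smul _ (t : S))
  mul_smul v w q := by
    obtain ⟨s, t, rfl⟩ := IsLocalization.exists_mk'_eq (rootDenominators P S) q
    refine (IsLocalization.map_mk' (rootDenominators_le P S (v * w)) s t).trans ?_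
    refine Eq.trans ?_ (congrArg (IsLocalization.map (LocalizedRing P S) _
      (rootDenominators_le P S v)) (IsLocalization.map_mk' (rootDenominators_le P S w) s t)).symm
    refine Eq.trans ?_ (IsLocalization.map_mk' (rootDenominators_le P S v) _ _).symm
    congr 1
    · exact mul_smul v w s
    · exact Subtype.ext (mul_smul v w (t : S))
  smul_zero w := map_zero (IsLocalization.map _ _ (rootDenominators_le P S w))
  smul_add w := map_add (IsLocalization.map _ _ (rootDenominators_le P S w))
  smul_one w := map_one (IsLocalization.map _ _ (rootDenominators_le P S w))
  smul_mul w := map_mul (IsLocalization.map _ _ (rootDenominators_le P S w))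

/-- The small-torus action of the affine Weyl group on `𝒬`: translations act trivially. -/
instance affineLocalizedRingAction : MulSemiringAction (AffineWeylGroup P) (LocalizedRing P S) :=
  MulSemiringAction.compHom (LocalizedRing P S)
    (SemidirectProduct.rightHom : AffineWeylGroup P →* P.weylGroup)

/-- The twisted group algebra `𝒬_(W_a) = 𝒬 ⋊ R[W_a]`: it is left `𝒬`-free on the `η_w`, with
product `c η_w c' η_w' = c w(c') η_(w w')`. -/
abbrev TwistedAlgebra : Type _ := SkewMonoidAlgebra (LocalizedRing P S) (AffineWeylGroup P)

/-- The basis element `η_w`. -/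
def η (w : AffineWeylGroup P) : TwistedAlgebra P S := SkewMonoidAlgebra.single w 1

/-- The inclusion of `𝒬` as the multiples of the unit. -/
def scalar (q : LocalizedRing P S) : TwistedAlgebra P S := SkewMonoidAlgebra.single 1 q

lemma xRoot_mem (i : ι) : xRoot P S i ∈ rootDenominators P S :=
  Submonoid.subset_closure ⟨i, rfl⟩

/-- `1 / x_α` in `𝒬`. -/
def invRoot (i : ι) : LocalizedRing P S :=
  Localization.mk 1 ⟨xRoot P S i, xRoot_mem P S i⟩

/-- The Demazure element `X_α = (1 / x_α) (1 - η_(s_α))`. -/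
def demazureElement (i : ι) : TwistedAlgebra P S :=
  scalar P S (invRoot P S i) * (1 - η P S (refl P i))

/-- The Demazure element `X_(α_0) = (1 / x_(-θ)) (1 - η_(s_0))`. -/
def affineDemazureElement (θ : ι) : TwistedAlgebra P S :=
  scalar P S (invRoot P S (P.reflectionPerm θ θ)) * (1 - η P S (affineRefl P θ))

/-- The small-torus formal affine Demazure algebra `D_(W_a)`, generated by `S` and the `X_i` for
the simple affine roots; `b` is the base and `θ` the highest root. -/
def demazureAlgebra (b : P.Base) (θ : ι) : Subring (TwistedAlgebra P S) :=
  Subring.closure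
    ((Set.range fun s : S => scalar P S (algebraMap S (LocalizedRing P S) s)) ∪
      demazureElement P S '' b.support ∪ {affineDemazureElement P S θ})

/-- `D_(W_a)` as a left `S`-submodule of `𝒬_(W_a)`. -/
def demazureModule (b : P.Base) (θ : ι) : Submodule S (TwistedAlgebra P S) where
  carrier := demazureAlgebra P S b θ
  add_mem' := add_mem
  zero_mem' := zero_mem _
  smul_mem' s z hz := by
    have h : s • z = scalar P S (algebraMap S (LocalizedRing P S) s) * z := by
      ext g
      simp [scalar, Algebra.smul_def]
    rw [h]
    exact mul_mem (Subring.subset_closure (Or.inl (Or.inl ⟨s, rfl⟩))) hz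

/-- `𝒬_(Q^∨) = 𝒬 ⋊ R[Q^∨]`; as translations act trivially on `𝒬`, this is the group algebra. -/
abbrev LatticeAlgebra : Type _ := AddMonoidAlgebra (LocalizedRing P S) N

/-- The basis element `η_(t_λ)` of `𝒬_(Q^∨)`. -/
def ηt (l : N) : LatticeAlgebra P S := AddMonoidAlgebra.single l 1

/-- The left `𝒬`-linear projection `𝒬_(W_a) → 𝒬_(Q^∨)`, `η_(t_λ w) ↦ η_(t_λ)` for `w ∈ W`. -/
def pr : TwistedAlgebra P S →ₗ[LocalizedRing P S] LatticeAlgebra P S :=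
  (Finsupp.linearCombination (LocalizedRing P S)
    fun g : AffineWeylGroup P => ηt P S (Multiplicative.toAdd g.left)) ∘ₗ
  (SkewMonoidAlgebra.coeffLinearEquiv (S := LocalizedRing P S)).toLinearMap

/-- The relative module `D_(W_a/W) = pr(D_(W_a))`. -/
def relativeModule (b : P.Base) (θ : ι) : Submodule S (LatticeAlgebra P S) :=
  (demazureModule P S b θ).map ((pr P S).restrictScalars S)

/-- The dual `D_(W_a/W)^* = Hom_S(D_(W_a/W), S)` inside `𝒬_(Q^∨)^* = Hom_𝒬(𝒬_(Q^∨), 𝒬)`: the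
functionals whose restriction to the relative module is an `S`-linear map to `S`. -/
def relativeDual (b : P.Base) (θ : ι) : Set (Module.Dual (LocalizedRing P S) (LatticeAlgebra P S)) :=
  {f | ∃ g : relativeModule P S b θ →ₗ[S] S, ∀ z : relativeModule P S b θ,
    f z = algebraMap S (LocalizedRing P S) (g z)}

variable {P S} in
/-- The small-torus Grassmannian condition. -/
def IsGrassmannianGKM (f : Module.Dual (LocalizedRing P S) (LatticeAlgebra P S)) : Prop :=
  (∀ l : N, ∃ s : S, f (ηt P S l) = algebraMap S (LocalizedRing P S) s) ∧
  ∀ (i : ι) (l : N) (d : ℕ), 1 ≤ d → ∃ s : S,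
    f ((1 - ηt P S (P.coroot i)) ^ d * ηt P S l) =
      algebraMap S (LocalizedRing P S) (xRoot P S i ^ d * s)

/-- For any two non-proportional roots `α`, `β` that are both divisible by `2` in the character
lattice, `x_α` and `x_β` are coprime in `S`. -/
def DivisibleRootsCoprime : Prop :=
  ∀ i j : ι, (∃ μ, P.root i = 2 • μ) → (∃ μ, P.root j = 2 • μ) →
    P.root j ≠ P.root i → P.root j ≠ -P.root i →
    ∀ s : S, xRoot P S i ∣ xRoot P S j * s → xRoot P S i ∣ s

end Demazure

end SmallTorus

end

noncomputable section

/-! Write Z_α = (1/x_α)(1 - η_{t_{α^∨}}) (`translationQuotient`). After division by x_α^d, the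
divisibility conditions together with integrality say that f takes values in S on every product
Z_α^d η_{t_λ}. The theorem thus compares D_{W_a/W} with these products.

If f lies in the dual, it suffices that the products belong to D_{W_a/W}. This follows once D_{W_a}
contains the lift (1/x_α)(1 - η_{t_{α^∨}}) of every Z_α (`translationElement_mem`). Translations act
trivially on 𝒬, so the reflections s_α and t_{α^∨} s_α have Demazure elements with the same
coefficient 1/x_α; their difference times η_{s_α} is the lift. The generator X_0 provides it for the
highest root θ, and conjugation by W for the orbit of θ. Any other root α has ⟨α, β^∨⟩ = 1 for some
β in that orbit, and conjugating X_α by t_{β^∨} produces the missing affine Demazure element.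

Conversely, attach to each root α the ring `rootRing`, in which x_β is inverted for β ≠ ±α and Z_α
is adjoined. It is stable under v ↦ (1/x_α)(v - s_α v), by a twisted Leibniz rule and a check on
generators (`demazure_mem`). Denominators from other roots are already inverted there, so the
intersection of these rings over all α is stable under every simple affine Demazure operator and
contains D_{W_a/W} (`relativeModule_mem`). On the ring of α, a functional satisfying the conditions
has values whose denominators are products of x_β with β ≠ ±α. The x_β are nonzerodivisors modulo
x_α, so a value with this property for every α lies in S (`exists_eq_of_forall_away`).

What remains is the arithmetic of S collected in `IsRegularCharacterRing`. A basis of the weight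
lattice identifies the formal group algebra with a power series ring (`IsChart.hom`) and embeds the
connective algebra in one. If α is part of a basis, x_α becomes a variable, which is prime; it does
not divide x_β, because the linear part of x_β is β itself and has another nonzero coordinate in
characteristic 0. In the simply connected case a root that is not part of a basis is divisible by 2,
and the case of two such roots is the coprimality hypothesis. -/

namespace SmallTorus

/-! ### The Weyl group on coweights and reflections. -/

section CoweightAction

variable {ι M N : Type*} [AddCommGroup M] [AddCommGroup N] (P : RootPairing ι ℤ M N)

/-- The action of `w` on the cocharacter lattice as an additive homomorphism. -/
def coweightMap (w : P.weylGroup) : N →+ N :=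
  (RootPairing.Equiv.coweightEquiv P P (w⁻¹ : P.weylGroup).1).toAddEquiv.toAddMonoidHom

lemma coweightAction_ofAdd (w : P.weylGroup) (l : N) :
    coweightAction P w (Multiplicative.ofAdd l) = Multiplicative.ofAdd (coweightMap P w l) := rfl

lemma coweightMap_one (l : N) : coweightMap P 1 l = l := by
  apply Multiplicative.ofAdd.injective
  rw [← coweightAction_ofAdd, map_one]; rfl

lemma toLinearMap_smul (w : P.weylGroup) (μ : M) (l : N) :
    P.toLinearMap (w • μ) l = P.toLinearMap μ (coweightMap P w⁻¹ l) := by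
  have h := LinearMap.congr_fun (RootPairing.Hom.weight_coweight_transpose_apply P P l w.1.toHom) μ
  have e : coweightMap P w⁻¹ l = w.1.toHom.coweightMap l := by
    rw [coweightMap, inv_inv]; rfl
  rw [e]
  exact h

lemma coweightMap_coroot (w : P.weylGroup) (i : ι) :
    coweightMap P w (P.coroot i) = P.coroot (P.weylGroupToPerm w i) :=
  RootPairing.Hom.coroot_coweightMap_apply P P i (w⁻¹ : P.weylGroup).1.toHom

lemma ofIdx_inv (i : ι) :
    (RootPairing.weylGroup.ofIdx P i)⁻¹ = RootPairing.weylGroup.ofIdx P i :=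
  Subtype.ext (RootPairing.Equiv.reflection_inv P i)

lemma ofIdx_mul_self (i : ι) :
    RootPairing.weylGroup.ofIdx P i * RootPairing.weylGroup.ofIdx P i = 1 := by
  rw [mul_eq_one_iff_inv_eq, ofIdx_inv]

lemma coweightMap_ofIdx (i : ι) (l : N) :
    coweightMap P (RootPairing.weylGroup.ofIdx P i) l
      = l - P.toLinearMap (P.root i) l • P.coroot i := by
  rw [← ofIdx_inv, coweightMap, inv_inv]
  exact P.coreflection_apply i l

lemma ofIdx_smul_eq (i : ι) (μ : M) :
    RootPairing.weylGroup.ofIdx P i • μ = μ - P.toLinearMap μ (P.coroot i) • P.root i :=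
  P.reflection_apply i μ

lemma weylGroupToPerm_ofIdx (i j : ι) :
    P.weylGroupToPerm (RootPairing.weylGroup.ofIdx P i) j = P.reflectionPerm i j := rfl

lemma root_reflectionPerm_self (i : ι) : P.root (P.reflectionPerm i i) = -P.root i := by
  rw [← P.reflectionPerm_root, P.root_coroot_two]
  module

lemma coroot_reflectionPerm_self (i : ι) : P.coroot (P.reflectionPerm i i) = -P.coroot i := by
  rw [← P.reflectionPerm_coroot, P.root_coroot_two]
  module

lemma conj_ofIdx (w : P.weylGroup) (i : ι) :
    w * RootPairing.weylGroup.ofIdx P i * w⁻¹ =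
      RootPairing.weylGroup.ofIdx P (P.weylGroupToPerm w i) := by
  apply Subtype.ext
  apply RootPairing.Equiv.weightHom_injective P
  ext μ
  change (w * RootPairing.weylGroup.ofIdx P i * w⁻¹) • μ =
    RootPairing.weylGroup.ofIdx P (P.weylGroupToPerm w i) • μ
  rw [mul_smul, mul_smul, ofIdx_smul_eq, ofIdx_smul_eq, smul_sub, smul_inv_smul,
    ← RootPairing.weylGroup_apply_root, smul_comm w, toLinearMap_smul, inv_inv,
    coweightMap_coroot]

lemma ofIdx_reflectionPerm_self (i : ι) :
    RootPairing.weylGroup.ofIdx P (P.reflectionPerm i i) = RootPairing.weylGroup.ofIdx P i := by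
  rw [← weylGroupToPerm_ofIdx, ← conj_ofIdx, ofIdx_inv, ofIdx_mul_self, one_mul]

end CoweightAction

/-! ### The twisted Weyl action on the lattice algebra. -/

section LatticeAlgebra

variable {ι M N : Type*} [AddCommGroup M] [AddCommGroup N]
variable (P : RootPairing ι ℤ M N) (S : Type*) [CommRing S] [CharacterRing P S]

/-- The action of `w` on the localized ring as a ring homomorphism. -/
abbrev weylHom (w : P.weylGroup) : LocalizedRing P S →+* LocalizedRing P S :=
  MulSemiringAction.toRingHom P.weylGroup (LocalizedRing P S) w

/-- The ring endomorphism `q η_{t_l} ↦ w(q) η_{t_{w l}}` of the lattice algebra. -/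
def latticeHom (w : P.weylGroup) : LatticeAlgebra P S →+* LatticeAlgebra P S :=
  (AddMonoidAlgebra.mapDomainRingHom (LocalizedRing P S) (coweightMap P w)).comp
    (AddMonoidAlgebra.mapRingHom N (weylHom P S w))

lemma latticeHom_single (w : P.weylGroup) (l : N) (q : LocalizedRing P S) :
    latticeHom P S w (AddMonoidAlgebra.single l q) =
      AddMonoidAlgebra.single (coweightMap P w l) (w • q) := by
  simp [latticeHom]

lemma latticeHom_ηt (w : P.weylGroup) (l : N) :
    latticeHom P S w (ηt P S l) = ηt P S (coweightMap P w l) := by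
  rw [ηt, latticeHom_single, smul_one, ηt]

lemma latticeHom_smul (w : P.weylGroup) (q : LocalizedRing P S) (v : LatticeAlgebra P S) :
    latticeHom P S w (q • v) = (w • q) • latticeHom P S w v := by
  simp only [Algebra.smul_def, map_mul]
  congr 1
  simp only [AddMonoidAlgebra.coe_algebraMap, Function.comp_apply, Algebra.algebraMap_self,
    RingHom.id_apply, latticeHom_single, map_zero]

lemma ηt_add (l l' : N) : ηt P S (l + l') = ηt P S l * ηt P S l' := by
  simp [ηt, AddMonoidAlgebra.single_mul_single]

lemma ηt_zero : ηt P S (0 : N) = 1 := rfl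

lemma pr_single (g : AffineWeylGroup P) (q : LocalizedRing P S) :
    pr P S (SkewMonoidAlgebra.single g q) =
      AddMonoidAlgebra.single (Multiplicative.toAdd g.left) q := by
  refine (Finsupp.linearCombination_single (LocalizedRing P S) q g).trans ?_
  simp [ηt]

lemma pr_one : pr P S 1 = 1 := by
  rw [SkewMonoidAlgebra.one_def, pr_single]; rfl

lemma scalar_mul (q : LocalizedRing P S) (z : TwistedAlgebra P S) :
    scalar P S q * z = q • z := by
  ext g
  simp [scalar]

/-- The kernel of `pr` is stable under left multiplication, so left multiplication by η_{t_λ w}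
descends to the lattice algebra: it becomes the twist by w followed by multiplication by η_{t_λ}.
Through this formula Demazure elements act as operators on the lattice algebra. -/
lemma pr_η_mul (g : AffineWeylGroup P) (z : TwistedAlgebra P S) :
    pr P S (η P S g * z) =
      ηt P S (Multiplicative.toAdd g.left) * latticeHom P S g.right (pr P S z) := by
  induction z using SkewMonoidAlgebra.induction_on with
  | zero => simp
  | single h q =>
    rw [η, SkewMonoidAlgebra.single_mul_single, pr_single, pr_single, latticeHom_single, ηt,
      AddMonoidAlgebra.single_mul_single]
    rfl
  | add x y hx hy => simp only [mul_add, map_add, hx, hy]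

end LatticeAlgebra

variable {ι M N : Type*} [AddCommGroup M] [AddCommGroup N]
variable (P : RootPairing ι ℤ M N) (S : Type*) [CommRing S] [CharacterRing P S]

/-- The divisibility properties of the elements `x_α` that hold in the formal group algebra of a
simply connected root datum. -/
structure IsRegularCharacterRing : Prop where
  ne_zero : ∀ i, xRoot P S i ≠ 0
  coprime : ∀ i j, P.root j ≠ P.root i → P.root j ≠ -P.root i →
    ∀ s : S, xRoot P S i ∣ xRoot P S j * s → xRoot P S i ∣ s
  dvd_sub : ∀ (i : ι) (s : S), xRoot P S i ∣ s - RootPairing.weylGroup.ofIdx P i • s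
  mul_dvd_add : ∀ i, xRoot P S i * xRoot P S (P.reflectionPerm i i) ∣
    xRoot P S i + xRoot P S (P.reflectionPerm i i)

/-! ### Inverses of the root elements. -/

section Localization

lemma xRoot_mul_invRoot (i : ι) :
    algebraMap S (LocalizedRing P S) (xRoot P S i) * invRoot P S i = 1 := by
  rw [invRoot, ← Localization.mk_one_eq_algebraMap, Localization.mk_mul, one_mul, mul_one]
  exact Localization.mk_self (⟨xRoot P S i, xRoot_mem P S i⟩ : rootDenominators P S)

variable {P S}

lemma eq_invRoot {i : ι} {q : LocalizedRing P S}
    (h : algebraMap S (LocalizedRing P S) (xRoot P S i) * q = 1) : q = invRoot P S i := by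
  have h' := xRoot_mul_invRoot P S i
  calc q = q * (algebraMap S (LocalizedRing P S) (xRoot P S i) * invRoot P S i) := by
        rw [h', mul_one]
    _ = (algebraMap S (LocalizedRing P S) (xRoot P S i) * q) * invRoot P S i := by ring
    _ = invRoot P S i := by rw [h, one_mul]

lemma invRoot_mul_algebraMap (i : ι) (s : S) :
    invRoot P S i * algebraMap S (LocalizedRing P S) (xRoot P S i * s) = algebraMap _ _ s := by
  rw [map_mul, ← mul_assoc, mul_comm (invRoot P S i), xRoot_mul_invRoot, one_mul]

variable (P S)

lemma smul_algebraMap (w : P.weylGroup) (s : S) :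
    w • algebraMap S (LocalizedRing P S) s = algebraMap S (LocalizedRing P S) (w • s) :=
  IsLocalization.map_eq (rootDenominators_le P S w) s

lemma smul_xRoot (w : P.weylGroup) (i : ι) :
    w • xRoot P S i = xRoot P S (P.weylGroupToPerm w i) := by
  rw [xRoot, xRoot, CharacterRing.smul_x, RootPairing.weylGroup_apply_root]

lemma smul_invRoot (w : P.weylGroup) (i : ι) :
    w • invRoot P S i = invRoot P S (P.weylGroupToPerm w i) := by
  apply eq_invRoot
  rw [← smul_xRoot, ← smul_algebraMap, ← smul_mul', xRoot_mul_invRoot, smul_one]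

lemma latticeHom_algebraMap (w : P.weylGroup) (q : LocalizedRing P S) :
    latticeHom P S w (algebraMap _ _ q) = algebraMap _ _ (w • q) := by
  rw [Algebra.algebraMap_eq_smul_one, Algebra.algebraMap_eq_smul_one, latticeHom_smul, map_one]

end Localization

/-! ### The ring attached to a root and its stability under the Demazure operator. -/

section RootRing

/-- The element `(1 / x_α) (1 - η_(t_(α^∨)))` of the lattice algebra. -/
def translationQuotient (i : ι) : LatticeAlgebra P S :=
  invRoot P S i • (1 - ηt P S (P.coroot i))

/-- Generators of `rootRing`. -/
def rootRingGenerators (i : ι) : Set (LatticeAlgebra P S) :=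
  Set.range (fun s : S => algebraMap (LocalizedRing P S) (LatticeAlgebra P S) (algebraMap S _ s)) ∪
    (fun j => algebraMap (LocalizedRing P S) (LatticeAlgebra P S) (invRoot P S j)) ''
      {j | P.root j ≠ P.root i ∧ P.root j ≠ -P.root i} ∪
    Set.range (ηt P S) ∪ {translationQuotient P S i}

/-- The subring of the lattice algebra generated by `S`, the translations, the inverses of all
`x_β` with `β ≠ ±α`, and `(1 / x_α) (1 - η_(t_(α^∨)))`. -/
def rootRing (i : ι) : Subring (LatticeAlgebra P S) := Subring.closure (rootRingGenerators P S i)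

lemma algebraMap_mem_rootRing (i : ι) (s : S) :
    algebraMap (LocalizedRing P S) (LatticeAlgebra P S) (algebraMap S _ s) ∈ rootRing P S i :=
  Subring.subset_closure (Or.inl (Or.inl (Or.inl ⟨s, rfl⟩)))

lemma invRoot_mem_rootRing {i j : ι} (h : P.root j ≠ P.root i) (h' : P.root j ≠ -P.root i) :
    algebraMap (LocalizedRing P S) (LatticeAlgebra P S) (invRoot P S j) ∈ rootRing P S i :=
  Subring.subset_closure (Or.inl (Or.inl (Or.inr ⟨j, ⟨h, h'⟩, rfl⟩)))

lemma ηt_mem_rootRing (i : ι) (l : N) : ηt P S l ∈ rootRing P S i :=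
  Subring.subset_closure (Or.inl (Or.inr ⟨l, rfl⟩))

lemma translationQuotient_mem_rootRing (i : ι) : translationQuotient P S i ∈ rootRing P S i :=
  Subring.subset_closure (Or.inr rfl)

variable {P S} in
lemma rootRing_le {i : ι} {A : Subring (LatticeAlgebra P S)}
    (h₁ : ∀ s : S, algebraMap (LocalizedRing P S) (LatticeAlgebra P S) (algebraMap S _ s) ∈ A)
    (h₂ : ∀ j, P.root j ≠ P.root i → P.root j ≠ -P.root i →
      algebraMap (LocalizedRing P S) (LatticeAlgebra P S) (invRoot P S j) ∈ A)
    (h₃ : ∀ l, ηt P S l ∈ A) (h₄ : translationQuotient P S i ∈ A) : rootRing P S i ≤ A := by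
  rw [rootRing, Subring.closure_le]
  rintro z (((⟨s, rfl⟩ | ⟨j, hj, rfl⟩) | ⟨l, rfl⟩) | rfl)
  · exact h₁ s
  · exact h₂ j hj.1 hj.2
  · exact h₃ l
  · exact h₄

lemma latticeHom_translationQuotient (w : P.weylGroup) (i : ι) :
    latticeHom P S w (translationQuotient P S i)
      = translationQuotient P S (P.weylGroupToPerm w i) := by
  rw [translationQuotient, latticeHom_smul, map_sub, map_one, latticeHom_ηt, coweightMap_coroot,
    smul_invRoot, translationQuotient]

lemma root_weylGroupToPerm_ne {i j : ι} (w : P.weylGroup)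
    (h : P.root j ≠ P.root i) (h' : P.root j ≠ -P.root i) :
    P.root (P.weylGroupToPerm w j) ≠ P.root (P.weylGroupToPerm w i) ∧
      P.root (P.weylGroupToPerm w j) ≠ -P.root (P.weylGroupToPerm w i) := by
  simp only [← RootPairing.weylGroup_apply_root, ← smul_neg]
  exact ⟨fun e => h (smul_left_cancel w e), fun e => h' (smul_left_cancel w e)⟩

lemma latticeHom_mem_rootRing (w : P.weylGroup) (i : ι) {v : LatticeAlgebra P S}
    (hv : v ∈ rootRing P S i) : latticeHom P S w v ∈ rootRing P S (P.weylGroupToPerm w i) := by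
  refine (rootRing_le (A := (rootRing P S (P.weylGroupToPerm w i)).comap (latticeHom P S w))
    ?_ ?_ ?_ ?_ : rootRing P S i ≤ _) hv
  · intro s
    rw [Subring.mem_comap, latticeHom_algebraMap, smul_algebraMap]
    exact algebraMap_mem_rootRing P S _ _
  · intro j h h'
    rw [Subring.mem_comap, latticeHom_algebraMap, smul_invRoot]
    have := root_weylGroupToPerm_ne P w h h'
    exact invRoot_mem_rootRing P S this.1 this.2
  · intro l
    rw [Subring.mem_comap, latticeHom_ηt]
    exact ηt_mem_rootRing P S _ _
  · rw [Subring.mem_comap, latticeHom_translationQuotient]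
    exact translationQuotient_mem_rootRing P S _

variable {P S} in
lemma smul_mem_rootRing {i : ι} {q : LocalizedRing P S} {v : LatticeAlgebra P S}
    (hq : algebraMap _ (LatticeAlgebra P S) q ∈ rootRing P S i) (hv : v ∈ rootRing P S i) :
    q • v ∈ rootRing P S i := by
  rw [Algebra.smul_def]
  exact mul_mem hq hv

/-- The coweights `l` with `(1 / x_α) (1 - η_(t_l)) ∈ rootRing`. -/
def quotientCoweights (i : ι) : AddSubgroup N where
  carrier := {l | invRoot P S i • (1 - ηt P S l) ∈ rootRing P S i}
  zero_mem' := by simp [ηt_zero, zero_mem]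
  add_mem' {l l'} h h' := by
    -- The cocycle identity 1 - t t' = (1 - t) + t (1 - t').
    have e : invRoot P S i • (1 - ηt P S (l + l')) =
        invRoot P S i • (1 - ηt P S l) + ηt P S l * (invRoot P S i • (1 - ηt P S l')) := by
      rw [ηt_add, mul_smul_comm, ← smul_add]
      congr 1
      ring
    rw [Set.mem_ofPred_eq, e]
    exact add_mem h (mul_mem (ηt_mem_rootRing P S i l) h')
  neg_mem' {l} h := by
    have e : invRoot P S i • (1 - ηt P S (-l)) =
        -(ηt P S (-l) * (invRoot P S i • (1 - ηt P S l))) := by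
      rw [mul_smul_comm, ← smul_neg]
      congr 1
      have : ηt P S (-l) * ηt P S l = 1 := by rw [← ηt_add, neg_add_cancel, ηt_zero]
      linear_combination -this
    rw [Set.mem_ofPred_eq, e]
    exact neg_mem (mul_mem (ηt_mem_rootRing P S i _) h)

lemma invRoot_smul_mem_rootRing (i : ι) (k : ℤ) :
    invRoot P S i • (1 - ηt P S (k • P.coroot i)) ∈ rootRing P S i :=
  (quotientCoweights P S i).zsmul_mem (translationQuotient_mem_rootRing P S i) k

variable {P S} (H : IsRegularCharacterRing P S)
include H

/-- From x_α + x_{-α} = x_α x_{-α} c one gets x_α = x_{-α}(x_α c - 1). Replacing 1/x_{-α} by 1/x_α,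
or the reverse, therefore costs only a factor in S. -/
lemma IsRegularCharacterRing.exists_xRoot_mul_invRoot_neg (i : ι) :
    ∃ c : S, algebraMap S _ (xRoot P S i) * invRoot P S (P.reflectionPerm i i)
      = algebraMap S (LocalizedRing P S) c := by
  obtain ⟨c, hc⟩ := H.mul_dvd_add i
  refine ⟨xRoot P S i * c - 1, ?_⟩
  have h : xRoot P S i = xRoot P S (P.reflectionPerm i i) * (xRoot P S i * c - 1) := by
    linear_combination hc
  rw [mul_comm]
  conv_lhs => rw [h]
  rw [invRoot_mul_algebraMap]

lemma IsRegularCharacterRing.exists_invRoot_add (i : ι) :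
    ∃ c : S, invRoot P S i + invRoot P S (P.reflectionPerm i i)
      = algebraMap S (LocalizedRing P S) c := by
  obtain ⟨c, hc⟩ := H.mul_dvd_add i
  refine ⟨c, ?_⟩
  have h₁ := xRoot_mul_invRoot P S i
  have h₂ := xRoot_mul_invRoot P S (P.reflectionPerm i i)
  have h₃ := congrArg (algebraMap S (LocalizedRing P S)) hc
  simp only [map_add, map_mul] at h₃
  set a := invRoot P S i
  set a' := invRoot P S (P.reflectionPerm i i)
  set x := algebraMap S (LocalizedRing P S) (xRoot P S i)
  set x' := algebraMap S (LocalizedRing P S) (xRoot P S (P.reflectionPerm i i))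
  linear_combination (a * a') * h₃ + (a' * x' * algebraMap _ _ c - a') * h₁ +
    (algebraMap _ _ c - a) * h₂

lemma IsRegularCharacterRing.translationQuotient_neg_mem (i : ι) :
    translationQuotient P S (P.reflectionPerm i i) ∈ rootRing P S i := by
  obtain ⟨c, hc⟩ := H.exists_xRoot_mul_invRoot_neg i
  have e : translationQuotient P S (P.reflectionPerm i i) =
      algebraMap S (LocalizedRing P S) c •
        (invRoot P S i • (1 - ηt P S ((-1 : ℤ) • P.coroot i))) := by
    rw [← hc, smul_smul, translationQuotient, coroot_reflectionPerm_self, neg_one_smul]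
    congr 1
    rw [mul_comm, ← mul_assoc, mul_comm (invRoot P S i), xRoot_mul_invRoot, one_mul]
  rw [e]
  exact smul_mem_rootRing (algebraMap_mem_rootRing P S i c) (invRoot_smul_mem_rootRing P S i (-1))

/-- The ring depends on α only up to sign, since the inverted elements do and Z_{-α} is an
S-multiple of an element already present. As s_α exchanges α and -α, it preserves the ring. -/
lemma IsRegularCharacterRing.rootRing_neg_le (i : ι) :
    rootRing P S (P.reflectionPerm i i) ≤ rootRing P S i := by
  refine rootRing_le (algebraMap_mem_rootRing P S i) ?_ (ηt_mem_rootRing P S i)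
    (H.translationQuotient_neg_mem i)
  intro j h h'
  rw [root_reflectionPerm_self] at h h'
  exact invRoot_mem_rootRing P S (by simpa using h') h

lemma IsRegularCharacterRing.latticeHom_mem (i : ι) {v : LatticeAlgebra P S}
    (hv : v ∈ rootRing P S i) :
    latticeHom P S (RootPairing.weylGroup.ofIdx P i) v ∈ rootRing P S i :=
  H.rootRing_neg_le i (latticeHom_mem_rootRing P S (RootPairing.weylGroup.ofIdx P i) i hv)

/-- The operator Δ(v) = (1/x_α)(v - s_α v) satisfies Δ(vw) = Δ(v) w + s_α(v) Δ(w), and s_α preserves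
the ring, so only the four kinds of generators need checking. -/
lemma IsRegularCharacterRing.demazure_mem (i : ι) {v : LatticeAlgebra P S}
    (hv : v ∈ rootRing P S i) :
    invRoot P S i • (v - latticeHom P S (RootPairing.weylGroup.ofIdx P i) v) ∈ rootRing P S i := by
  induction hv using Subring.closure_induction with
  | zero => simp [zero_mem]
  | one => simp [zero_mem]
  | add v w _ _ hv hw =>
    rw [map_add, add_sub_add_comm, smul_add]
    exact add_mem hv hw
  | neg v _ hv =>
    rw [map_neg, ← neg_sub_neg, neg_neg, neg_neg, ← neg_sub, smul_neg]
    exact neg_mem hv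
  | mul v w hv' hw' hv hw =>
    have e : invRoot P S i • (v * w - latticeHom P S (RootPairing.weylGroup.ofIdx P i) (v * w)) =
        (invRoot P S i • (v - latticeHom P S (RootPairing.weylGroup.ofIdx P i) v)) * w +
        latticeHom P S (RootPairing.weylGroup.ofIdx P i) v *
          (invRoot P S i • (w - latticeHom P S (RootPairing.weylGroup.ofIdx P i) w)) := by
      rw [map_mul, smul_mul_assoc, mul_smul_comm, ← smul_add]
      congr 1
      ring
    rw [e]
    exact add_mem (mul_mem hv hw') (mul_mem (H.latticeHom_mem i hv') hw)
  | mem v hv =>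
    obtain (((⟨s, rfl⟩ | ⟨j, hj, rfl⟩) | ⟨l, rfl⟩) | rfl) := hv
    · obtain ⟨c, hc⟩ := H.dvd_sub i s
      dsimp only
      rw [latticeHom_algebraMap, smul_algebraMap, ← map_sub, ← map_sub, hc, Algebra.smul_def,
        ← map_mul, invRoot_mul_algebraMap]
      exact algebraMap_mem_rootRing P S i c
    -- With x_β - x_{s_α β} = c x_α, the operator sends 1/x_β to -c/(x_β x_{s_α β}), and s_α β is
    -- again different from ±α.
    · obtain ⟨c, hc⟩ := H.dvd_sub i (xRoot P S j)
      have hne := root_weylGroupToPerm_ne P (RootPairing.weylGroup.ofIdx P i) hj.1 hj.2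
      rw [smul_xRoot] at hc
      dsimp only
      rw [latticeHom_algebraMap, smul_invRoot]
      set k := P.weylGroupToPerm (RootPairing.weylGroup.ofIdx P i) j
      rw [weylGroupToPerm_ofIdx, root_reflectionPerm_self, neg_neg] at hne
      have e : invRoot P S i * (invRoot P S j - invRoot P S k) =
          -(algebraMap S _ c * invRoot P S j * invRoot P S k) := by
        have h₁ := xRoot_mul_invRoot P S i
        have h₂ := xRoot_mul_invRoot P S j
        have h₃ := xRoot_mul_invRoot P S k
        have h₄ := congrArg (algebraMap S (LocalizedRing P S)) hc
        simp only [map_sub, map_mul] at h₄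
        linear_combination (-invRoot P S i * invRoot P S j) * h₃ +
          (invRoot P S i * invRoot P S k) * h₂ -
          (invRoot P S i * invRoot P S j * invRoot P S k) * h₄
          - (algebraMap S _ c * invRoot P S j * invRoot P S k) * h₁
      rw [← map_sub, Algebra.smul_def, ← map_mul, e, map_neg, map_mul, map_mul]
      exact neg_mem (mul_mem (mul_mem (algebraMap_mem_rootRing P S i c)
        (invRoot_mem_rootRing P S hj.1 hj.2)) (invRoot_mem_rootRing P S hne.2 hne.1))
    · rw [latticeHom_ηt, coweightMap_ofIdx]
      set m : ℤ := P.toLinearMap (P.root i) l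
      have e : invRoot P S i • (ηt P S l - ηt P S (l - m • P.coroot i)) =
          ηt P S l * (invRoot P S i • (1 - ηt P S ((-m) • P.coroot i))) := by
        rw [sub_eq_add_neg l, ← neg_smul, ηt_add, mul_smul_comm]
        congr 1
        ring
      rw [e]
      exact mul_mem (ηt_mem_rootRing P S i l) (invRoot_smul_mem_rootRing P S i (-m))
    · obtain ⟨c, hc⟩ := H.exists_invRoot_add i
      rw [latticeHom_translationQuotient, weylGroupToPerm_ofIdx]
      -- Here 1/x_α + 1/x_{-α} - Z_{-α} = 1/x_α + η_{t_{-α^∨}}/x_{-α}. Multiplying it by 1 -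
      -- η_{t_{α^∨}} gives Z_α - Z_{-α}, so Z_α - Z_{-α} is divisible by x_α inside the ring.
      have e : invRoot P S i •
          (translationQuotient P S i - translationQuotient P S (P.reflectionPerm i i)) =
          translationQuotient P S i * (algebraMap _ _ (algebraMap S (LocalizedRing P S) c) -
            translationQuotient P S (P.reflectionPerm i i)) := by
        have h : ηt P S (P.coroot i) * ηt P S (-P.coroot i) = 1 := by
          rw [← ηt_add, add_neg_cancel, ηt_zero]
        rw [← hc, translationQuotient, translationQuotient, coroot_reflectionPerm_self, map_add]
        simp only [Algebra.smul_def]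
        linear_combination
          (algebraMap _ (LatticeAlgebra P S) (invRoot P S i) *
          algebraMap _ (LatticeAlgebra P S) (invRoot P S (P.reflectionPerm i i))) * h
      rw [e]
      exact mul_mem (translationQuotient_mem_rootRing P S i)
        (sub_mem (algebraMap_mem_rootRing P S i c) (H.translationQuotient_neg_mem i))

end RootRing

variable {ι M N : Type*} [AddCommGroup M] [AddCommGroup N]
variable {P : RootPairing ι ℤ M N} {S : Type*} [CommRing S] [CharacterRing P S]

/-! ### The relative module lies in all the root rings. -/

section DemazureStable

variable (P) in
lemma eq_reflectionPerm_self {i k : ι} (h : P.root k = -P.root i) : k = P.reflectionPerm i i :=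
  P.root.injective (by rw [h, root_reflectionPerm_self])

/-- Dividing by x_β matters only in the ring of β itself: the ring of -β is contained in it and
conversely, and in every other ring x_β is invertible. -/
lemma IsRegularCharacterRing.mem_of_mem_self (H : IsRegularCharacterRing P S) {k : ι}
    {v : LatticeAlgebra P S} (hk : invRoot P S k • v ∈ rootRing P S k)
    (hv : ∀ i, v ∈ rootRing P S i) (i : ι) : invRoot P S k • v ∈ rootRing P S i := by
  by_cases h : P.root k = P.root i
  · rwa [← P.root.injective h]
  by_cases h' : P.root k = -P.root i
  · rw [eq_reflectionPerm_self P h'] at hk ⊢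
    exact H.rootRing_neg_le i hk
  · exact smul_mem_rootRing (invRoot_mem_rootRing P S h h') (hv i)

lemma latticeHom_mem_rootRing_of_forall (w : P.weylGroup) {v : LatticeAlgebra P S}
    (hv : ∀ i, v ∈ rootRing P S i) (i : ι) : latticeHom P S w v ∈ rootRing P S i := by
  have h := latticeHom_mem_rootRing P S w _ (hv (P.weylGroupToPerm w⁻¹ i))
  rwa [← Equiv.Perm.mul_apply, ← map_mul, mul_inv_cancel, map_one] at h

lemma IsRegularCharacterRing.demazure_mem_of_forall (H : IsRegularCharacterRing P S) (k : ι)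
    {v : LatticeAlgebra P S} (hv : ∀ i, v ∈ rootRing P S i) (i : ι) :
    invRoot P S k • (v - latticeHom P S (RootPairing.weylGroup.ofIdx P k) v) ∈ rootRing P S i :=
  H.mem_of_mem_self (H.demazure_mem k (hv k))
    (fun i => sub_mem (hv i) (latticeHom_mem_rootRing_of_forall _ hv i)) i

/-- Stated for the root whose inverse occurs. For X_0 this root is -θ, whence the sign: t_{-(-θ)^∨}
= t_{θ^∨}. The affine operator differs from the linear one by Z-type terms. -/
lemma IsRegularCharacterRing.affineDemazure_mem_of_forall (H : IsRegularCharacterRing P S) (k : ι)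
    {v : LatticeAlgebra P S} (hv : ∀ i, v ∈ rootRing P S i) (i : ι) :
    invRoot P S k • (v - ηt P S (-P.coroot k) *
      latticeHom P S (RootPairing.weylGroup.ofIdx P k) v) ∈ rootRing P S i := by
  set w := latticeHom P S (RootPairing.weylGroup.ofIdx P k) v with hw
  have e : invRoot P S k • (v - ηt P S (-P.coroot k) * w) = invRoot P S k • (v - w) +
      (invRoot P S k • (1 - ηt P S ((-1 : ℤ) • P.coroot k))) * w := by
    rw [smul_mul_assoc, ← smul_add, neg_one_smul]
    congr 1
    ring
  rw [e]
  refine add_mem (H.demazure_mem_of_forall k hv i) (mul_mem ?_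
    (latticeHom_mem_rootRing_of_forall _ hv i))
  exact H.mem_of_mem_self (invRoot_smul_mem_rootRing P S k (-1))
    (fun i => sub_mem (one_mem _) (ηt_mem_rootRing P S i _)) i

lemma pr_scalar_mul (q : LocalizedRing P S) (z : TwistedAlgebra P S) :
    pr P S (scalar P S q * z) = q • pr P S z := by
  rw [scalar_mul, map_smul]

lemma pr_demazureElement_mul (k : ι) (z : TwistedAlgebra P S) :
    pr P S (demazureElement P S k * z) = invRoot P S k •
      (pr P S z - latticeHom P S (RootPairing.weylGroup.ofIdx P k) (pr P S z)) := by
  rw [demazureElement, mul_assoc, pr_scalar_mul, sub_mul, one_mul, map_sub, pr_η_mul]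
  congr 2
  exact one_mul _

lemma affineRefl_left (θ : ι) :
    Multiplicative.toAdd (affineRefl P θ).left = P.coroot θ := by
  simp [affineRefl, translation, refl]

lemma affineRefl_right (θ : ι) :
    (affineRefl P θ).right = RootPairing.weylGroup.ofIdx P θ := by
  simp [affineRefl, translation, refl]

lemma pr_affineDemazureElement_mul (θ : ι) (z : TwistedAlgebra P S) :
    pr P S (affineDemazureElement P S θ * z) = invRoot P S (P.reflectionPerm θ θ) •
      (pr P S z - ηt P S (P.coroot θ) *
        latticeHom P S (RootPairing.weylGroup.ofIdx P θ) (pr P S z)) := by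
  rw [affineDemazureElement, mul_assoc, pr_scalar_mul, sub_mul, one_mul, map_sub, pr_η_mul,
    affineRefl_left, affineRefl_right]

/-- Keeping v arbitrary makes the products in the induction immediate, since left multiplications
compose. -/
lemma IsRegularCharacterRing.pr_mul_mem (H : IsRegularCharacterRing P S) (b : P.Base) (θ : ι)
    {z : TwistedAlgebra P S} (hz : z ∈ demazureAlgebra P S b θ) :
    ∀ v : TwistedAlgebra P S, (∀ i, pr P S v ∈ rootRing P S i) →
      ∀ i, pr P S (z * v) ∈ rootRing P S i := by
  induction hz using Subring.closure_induction with
  | zero => intro v _ i; rw [zero_mul, map_zero]; exact zero_mem _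
  | one => intro v hv i; rw [one_mul]; exact hv i
  | add x y _ _ hx hy =>
    intro v hv i
    rw [add_mul, map_add]
    exact add_mem (hx v hv i) (hy v hv i)
  | neg x _ hx =>
    intro v hv i
    have e : -x * v = -(x * v) := neg_mul x v
    rw [e, map_neg]
    exact neg_mem (hx v hv i)
  | mul x y _ _ hx hy =>
    intro v hv i
    rw [mul_assoc]
    exact hx _ (hy v hv) i
  | mem x hx =>
    intro v hv i
    obtain ((⟨s, rfl⟩ | ⟨k, -, rfl⟩) | rfl) := hx
    · dsimp only
      rw [pr_scalar_mul]
      exact smul_mem_rootRing (algebraMap_mem_rootRing P S i s) (hv i)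
    · rw [pr_demazureElement_mul]
      exact H.demazure_mem_of_forall k hv i
    · rw [pr_affineDemazureElement_mul]
      have h := H.affineDemazure_mem_of_forall (P.reflectionPerm θ θ) hv i
      rwa [coroot_reflectionPerm_self, neg_neg, ofIdx_reflectionPerm_self] at h

lemma IsRegularCharacterRing.relativeModule_mem (H : IsRegularCharacterRing P S) {b : P.Base}
    {θ : ι} {v : LatticeAlgebra P S} (hv : v ∈ relativeModule P S b θ) (i : ι) :
    v ∈ rootRing P S i := by
  obtain ⟨z, hz, rfl⟩ := hv
  have h := H.pr_mul_mem b θ hz 1 (fun i => by rw [pr_one]; exact one_mem _) i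
  rwa [mul_one] at h

end DemazureStable

/-! ### From the divisibility conditions to integrality. -/

section Denominators

variable (P S) in
/-- The denominators away from the root `α`: products of `x_β` with `β ≠ ±α`. -/
def awayDenominators (i : ι) : Submonoid S :=
  Submonoid.closure (xRoot P S '' {j | P.root j ≠ P.root i ∧ P.root j ≠ -P.root i})

variable (P S) in
/-- The `S`-algebra generated by the translations and `(1 / x_α) (1 - η_(t_(α^∨)))`. -/
def translationAlgebra (i : ι) : Subalgebra S (LatticeAlgebra P S) :=
  Algebra.adjoin S (insert (translationQuotient P S i) (Set.range (ηt P S)))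

lemma ηt_mem_translationAlgebra (i : ι) (l : N) : ηt P S l ∈ translationAlgebra P S i :=
  Algebra.subset_adjoin (Or.inr ⟨l, rfl⟩)

lemma exists_smul_mem_translationAlgebra (i : ι) {v : LatticeAlgebra P S}
    (hv : v ∈ rootRing P S i) : ∃ u ∈ awayDenominators P S i, u • v ∈ translationAlgebra P S i := by
  induction hv using Subring.closure_induction with
  | zero => exact ⟨1, one_mem _, by rw [smul_zero]; exact zero_mem _⟩
  | one => exact ⟨1, one_mem _, by rw [one_smul]; exact one_mem _⟩
  | add x y _ _ hx hy =>
    obtain ⟨u, hu, hux⟩ := hx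
    obtain ⟨u', hu', huy⟩ := hy
    refine ⟨u * u', mul_mem hu hu', ?_⟩
    rw [smul_add, mul_smul u u' y, mul_comm, mul_smul]
    exact add_mem (Subalgebra.smul_mem _ hux u') (Subalgebra.smul_mem _ huy u)
  | neg x _ hx =>
    obtain ⟨u, hu, hux⟩ := hx
    exact ⟨u, hu, by rw [smul_neg]; exact neg_mem hux⟩
  | mul x y _ _ hx hy =>
    obtain ⟨u, hu, hux⟩ := hx
    obtain ⟨u', hu', huy⟩ := hy
    refine ⟨u * u', mul_mem hu hu', ?_⟩
    rw [← smul_mul_smul_comm]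
    exact mul_mem hux huy
  | mem x hx =>
    obtain (((⟨s, rfl⟩ | ⟨j, hj, rfl⟩) | ⟨l, rfl⟩) | rfl) := hx
    · refine ⟨1, one_mem _, ?_⟩
      dsimp only
      rw [one_smul, ← IsScalarTower.algebraMap_apply]
      exact Subalgebra.algebraMap_mem _ s
    · refine ⟨xRoot P S j, Submonoid.subset_closure ⟨j, hj, rfl⟩, ?_⟩
      dsimp only
      rw [Algebra.smul_def, IsScalarTower.algebraMap_apply S (LocalizedRing P S), ← map_mul,
        xRoot_mul_invRoot, map_one]
      exact one_mem _
    · exact ⟨1, one_mem _, by rw [one_smul]; exact ηt_mem_translationAlgebra i l⟩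
    · exact ⟨1, one_mem _, by rw [one_smul]; exact Algebra.subset_adjoin (Or.inl rfl)⟩

lemma translationQuotient_pow (i : ι) (d : ℕ) :
    algebraMap S (LocalizedRing P S) (xRoot P S i) ^ d • translationQuotient P S i ^ d =
      (1 - ηt P S (P.coroot i)) ^ d := by
  rw [← smul_pow, translationQuotient, smul_smul, xRoot_mul_invRoot, one_smul]

/-- The lattice algebra is commutative, so the powers of Z_α and the translations can be collected.
-/
lemma exists_of_mem_closure (i : ι) {v : LatticeAlgebra P S}
    (hv : v ∈ Submonoid.closure (insert (translationQuotient P S i) (Set.range (ηt P S)))) :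
    ∃ (d : ℕ) (l : N), v = translationQuotient P S i ^ d * ηt P S l := by
  induction hv using Submonoid.closure_induction with
  | mem x hx =>
    obtain (rfl | ⟨l, rfl⟩) := hx
    · exact ⟨1, 0, by rw [ηt_zero, pow_one, mul_one]⟩
    · exact ⟨0, l, by rw [pow_zero, one_mul]⟩
  | one => exact ⟨0, 0, by rw [ηt_zero, pow_zero, mul_one]⟩
  | mul x y _ _ hx hy =>
    obtain ⟨d, l, rfl⟩ := hx
    obtain ⟨d', l', rfl⟩ := hy
    exact ⟨d + d', l + l', by rw [ηt_add]; ring⟩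

/-- The algebra is spanned over S by the products Z_α^d η_{t_λ}, and on these the conditions give
integrality after division by x_α^d. The case d = 0 is the integrality on translations. -/
lemma IsGrassmannianGKM.exists_eq_algebraMap
    {f : Module.Dual (LocalizedRing P S) (LatticeAlgebra P S)} (hf : IsGrassmannianGKM f) (i : ι)
    {v : LatticeAlgebra P S} (hv : v ∈ translationAlgebra P S i) :
    ∃ s : S, f v = algebraMap S (LocalizedRing P S) s := by
  have hv' : v ∈ Submodule.span S (Submonoid.closure
      (insert (translationQuotient P S i) (Set.range (ηt P S))) : Set (LatticeAlgebra P S)) := by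
    rw [← Algebra.adjoin_eq_span]
    exact hv
  induction hv' using Submodule.span_induction with
  | mem x hx =>
    obtain ⟨d, l, rfl⟩ := exists_of_mem_closure i hx
    rcases Nat.eq_zero_or_pos d with rfl | hd
    · rw [pow_zero, one_mul]
      exact hf.1 l
    obtain ⟨s, hs⟩ := hf.2 i l d hd
    refine ⟨s, ?_⟩
    have h := congrArg (invRoot P S i ^ d • ·) hs
    have h1 : invRoot P S i ^ d * algebraMap S (LocalizedRing P S) (xRoot P S i) ^ d = 1 := by
      rw [← mul_pow, mul_comm, xRoot_mul_invRoot, one_pow]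
    rw [← translationQuotient_pow, ← map_smul, smul_mul_assoc, smul_smul, h1, one_smul] at h
    rw [h, map_mul, map_pow, smul_eq_mul, ← mul_assoc, h1, one_mul]
  | zero => exact ⟨0, by simp⟩
  | add x y hx hy ihx ihy =>
    have key : ∀ z ∈ Submodule.span S (Submonoid.closure
        (insert (translationQuotient P S i) (Set.range (ηt P S))) : Set (LatticeAlgebra P S)),
        z ∈ translationAlgebra P S i := fun z hz => by
      rw [← Algebra.adjoin_eq_span] at hz
      exact hz
    obtain ⟨s, hs⟩ := ihx (key x hx)
    obtain ⟨t, ht⟩ := ihy (key y hy)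
    exact ⟨s + t, by rw [map_add, map_add, hs, ht]⟩
  | smul a x hx ihx =>
    have key : x ∈ translationAlgebra P S i := by
      rw [← Algebra.adjoin_eq_span] at hx
      exact hx
    obtain ⟨s, hs⟩ := ihx key
    exact ⟨a * s, by rw [← algebraMap_smul (LocalizedRing P S) a x, map_smul, hs, smul_eq_mul,
      map_mul]⟩

lemma IsRegularCharacterRing.dvd_of_dvd_mul (H : IsRegularCharacterRing P S) (i : ι) {u : S}
    (hu : u ∈ awayDenominators P S i) :
    ∀ s : S, xRoot P S i ∣ u * s → xRoot P S i ∣ s := by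
  induction hu using Submonoid.closure_induction with
  | mem x hx =>
    obtain ⟨j, hj, rfl⟩ := hx
    exact H.coprime i j hj.1 hj.2
  | one => intro s hs; rwa [one_mul] at hs
  | mul x y _ _ hx hy => intro s hs; exact hy s (hx _ (by rwa [mul_assoc] at hs))

lemma IsRegularCharacterRing.algebraMap_injective [IsDomain S] (H : IsRegularCharacterRing P S) :
    Function.Injective (algebraMap S (LocalizedRing P S)) := by
  refine IsLocalization.injective _ (M := rootDenominators P S) ?_
  rw [rootDenominators, Submonoid.closure_le]
  rintro _ ⟨i, rfl⟩
  exact mem_nonZeroDivisors_of_ne_zero (H.ne_zero i)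

/-- The denominator u is removed one factor at a time. For a factor x_α, the second assumption
supplies a denominator v prime to x_α, which forces x_α to divide the numerator. -/
lemma IsRegularCharacterRing.exists_eq_of_forall_away [IsDomain S]
    (H : IsRegularCharacterRing P S) (u : S) (hu : u ∈ rootDenominators P S) :
    ∀ q : LocalizedRing P S, (∃ s, algebraMap S _ u * q = algebraMap S _ s) →
      (∀ i, ∃ v ∈ awayDenominators P S i, ∃ s, algebraMap S _ v * q = algebraMap S _ s) →
      ∃ s, q = algebraMap S _ s := by
  induction hu using Submonoid.closure_induction with
  | one =>
    rintro q ⟨s, hs⟩ -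
    exact ⟨s, by rwa [map_one, one_mul] at hs⟩
  | mul x y _ _ hx hy =>
    rintro q ⟨s, hs⟩ hq
    -- For u = xy, the factor x is removed from the element yq, so that yq ∈ S; then y is removed
    -- from q.
    refine hy q (hx _ ⟨s, by rw [← hs, map_mul, mul_assoc]⟩ fun i => ?_) hq
    obtain ⟨v, hv, t, ht⟩ := hq i
    exact ⟨v, hv, y * t, by rw [mul_left_comm, ht, map_mul]⟩
  | mem x hx =>
    obtain ⟨i, rfl⟩ := hx
    rintro q ⟨s, hs⟩ hq
    obtain ⟨v, hv, t, ht⟩ := hq i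
    have h : xRoot P S i * t = v * s := H.algebraMap_injective (by
      rw [map_mul, map_mul, ← ht, ← hs]; ring)
    obtain ⟨r, rfl⟩ := H.dvd_of_dvd_mul i hv s ⟨t, h.symm⟩
    refine ⟨r, ?_⟩
    have := congrArg (invRoot P S i * ·) hs
    rwa [invRoot_mul_algebraMap, ← mul_assoc, mul_comm (invRoot P S i), xRoot_mul_invRoot,
      one_mul] at this

theorem IsRegularCharacterRing.mem_relativeDual_of_isGrassmannianGKM [IsDomain S]
    (H : IsRegularCharacterRing P S) (b : P.Base) (θ : ι)
    {f : Module.Dual (LocalizedRing P S) (LatticeAlgebra P S)} (hf : IsGrassmannianGKM f) :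
    f ∈ relativeDual P S b θ := by
  have key : ∀ z : relativeModule P S b θ, ∃ s : S, f z = algebraMap S (LocalizedRing P S) s := by
    rintro ⟨z, hz⟩
    obtain ⟨⟨s, u⟩, hs⟩ := IsLocalization.surj (rootDenominators P S) (f z)
    -- The localization gives one denominator that is a product of root elements. The root ring of
    -- each α gives another one that avoids x_{±α}.
    refine H.exists_eq_of_forall_away u u.2 _ ⟨s, by rw [mul_comm]; exact hs⟩ fun i => ?_
    obtain ⟨v, hv, hvz⟩ := exists_smul_mem_translationAlgebra i (H.relativeModule_mem hz i)
    obtain ⟨t, ht⟩ := hf.exists_eq_algebraMap i hvz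
    rw [← algebraMap_smul (LocalizedRing P S) v z, map_smul, smul_eq_mul] at ht
    exact ⟨v, hv, t, ht⟩
  choose g hg using key
  refine ⟨{ toFun := g, map_add' := fun x y => ?_, map_smul' := fun a x => ?_ }, hg⟩
  · apply H.algebraMap_injective
    rw [map_add, ← hg, ← hg, ← hg, Submodule.coe_add, map_add]
  · apply H.algebraMap_injective
    rw [RingHom.id_apply, smul_eq_mul, map_mul, ← hg, ← hg, Submodule.coe_smul,
      ← algebraMap_smul (LocalizedRing P S) a x.1, map_smul, smul_eq_mul]

end Denominators

variable {ι M N : Type*} [AddCommGroup M] [AddCommGroup N] {P : RootPairing ι ℤ M N}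

/-! ### Pairings with the highest coroot. -/

section HighestRoot

lemma root_pairing_self_ne_zero (i : ι) : P.root i ≠ 0 := fun h => by
  have := P.root_coroot_two i
  rw [h, map_zero, LinearMap.zero_apply] at this
  omega

/-- The `ℕ`-span of the simple roots is salient. -/
lemma eq_zero_of_mem_closure_of_neg_mem (b : P.Base) {x : M}
    (hx : x ∈ AddSubmonoid.closure (P.root '' b.support))
    (hx' : -x ∈ AddSubmonoid.closure (P.root '' b.support)) : x = 0 := by
  have key : ∀ y ∈ AddSubmonoid.closure (P.root '' b.support),
      ∃ c : ι → ℤ, (∀ i, 0 ≤ c i) ∧ y = ∑ i ∈ b.support, c i • P.root i := by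
    classical
    intro y hy
    induction hy using AddSubmonoid.closure_induction with
    | mem y hy =>
      obtain ⟨i, hi, rfl⟩ := hy
      refine ⟨Pi.single i 1, fun j => ?_, ?_⟩
      · by_cases h : j = i <;> simp [h]
      · rw [Finset.sum_eq_single i]
        · simp
        · intro j _ h; simp [h]
        · intro h; exact absurd hi h
    | zero => exact ⟨0, fun _ => le_rfl, by simp⟩
    | add y z _ _ hy hz =>
      obtain ⟨c, hc, rfl⟩ := hy
      obtain ⟨d, hd, rfl⟩ := hz
      exact ⟨c + d, fun i => add_nonneg (hc i) (hd i),
        by simp [add_smul, Finset.sum_add_distrib]⟩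
  obtain ⟨c, hc, rfl⟩ := key x hx
  obtain ⟨d, hd, hd'⟩ := key _ hx'
  -- Linear independence forces c + d = 0 on the base; both are nonnegative, so both vanish.
  have h := linearIndepOn_finset_iff.mp b.linearIndepOn_root (c + d) (by
    simp [add_smul, Finset.sum_add_distrib, ← hd'])
  refine Finset.sum_eq_zero fun i hi => ?_
  have := h i hi
  rw [Pi.add_apply] at this
  rw [show c i = 0 by linarith [hc i, hd i], zero_smul]

variable (b : P.Base) {θ : ι}
  (hθ : ∀ i, P.root θ - P.root i ∈ AddSubmonoid.closure (P.root '' b.support))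

include hθ

/-- With k = ⟨α, θ^∨⟩, the element kθ - α = -s_θ α is a root, hence at most θ. Together with α ≤ θ
this gives kθ ≤ 2θ, so k = 2, and then 2θ - α ≤ θ gives θ ≤ α. -/
lemma toLinearMap_highestRoot_le {i : ι} (h : 2 ≤ P.toLinearMap (P.root i) (P.coroot θ)) :
    P.root i = P.root θ := by
  set k := P.toLinearMap (P.root i) (P.coroot θ) with hk
  have h₁ : P.root θ + P.root i - k • P.root θ ∈ AddSubmonoid.closure (P.root '' b.support) := by
    have := hθ (P.reflectionPerm (P.reflectionPerm θ i) (P.reflectionPerm θ i))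
    rw [root_reflectionPerm_self, ← P.reflectionPerm_root, sub_neg_eq_add, ← hk] at this
    convert this using 1
    abel
  have h₂ : (2 : ℤ) • P.root θ - k • P.root θ ∈ AddSubmonoid.closure (P.root '' b.support) := by
    convert add_mem h₁ (hθ i) using 1
    module
  have h₃ : (2 : ℕ) • P.root θ ∈ AddSubmonoid.closure (P.root '' b.support) := by
    have := hθ (P.reflectionPerm θ θ)
    rw [root_reflectionPerm_self] at this
    convert this using 1
    module
  -- If k = n + 2, both 2nθ and -2nθ are nonnegative combinations of simple roots, so 2nθ = 0;
  -- pairing with θ^∨ yields n = 0.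
  have hk2 : k = 2 := by
    obtain ⟨n, hn⟩ := Int.eq_ofNat_of_zero_le (sub_nonneg.mpr h)
    have h₄ := nsmul_mem h₂ 2
    have h₅ := nsmul_mem h₃ n
    have h₆ : n • (2 : ℕ) • P.root θ = 0 := by
      refine eq_zero_of_mem_closure_of_neg_mem b h₅ ?_
      convert h₄ using 1
      rw [show k = n + 2 by omega]
      module
    have h₇ := congrArg (fun μ => P.toLinearMap μ (P.coroot θ)) h₆
    simp only [map_nsmul, LinearMap.smul_apply, P.root_coroot_two, map_zero,
      LinearMap.zero_apply, nsmul_eq_mul] at h₇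
    omega
  refine (sub_eq_zero.mp (eq_zero_of_mem_closure_of_neg_mem b (hθ i) ?_)).symm
  rw [hk2] at h₁
  convert h₁ using 1
  module

lemma toLinearMap_highestRoot (i : ι) :
    P.toLinearMap (P.root i) (P.coroot θ) = 0 ∨ P.toLinearMap (P.root i) (P.coroot θ) = 1 ∨
      P.toLinearMap (P.root i) (P.coroot θ) = -1 ∨ P.root i = P.root θ ∨
        P.root i = -P.root θ := by
  by_cases h : 2 ≤ P.toLinearMap (P.root i) (P.coroot θ)
  · exact Or.inr (Or.inr (Or.inr (Or.inl (toLinearMap_highestRoot_le b hθ h))))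
  by_cases h' : 2 ≤ P.toLinearMap (P.root (P.reflectionPerm i i)) (P.coroot θ)
  · have := toLinearMap_highestRoot_le b hθ h'
    rw [root_reflectionPerm_self] at this
    exact Or.inr (Or.inr (Or.inr (Or.inr (by rw [← this, neg_neg]))))
  · rw [root_reflectionPerm_self, map_neg, LinearMap.neg_apply] at h'
    omega

end HighestRoot

/-- The coroots not orthogonal to the whole orbit of α form a nonempty set to which irreducibility
applies. It contains α^∨ by the choice w = 1. -/
lemma exists_toLinearMap_ne_zero
    (hirr : ∀ s : Set ι, s.Nonempty → (∀ i ∈ s, ∀ j ∉ s, P.pairing i j = 0) → s = Set.univ)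
    (i j : ι) : ∃ w : P.weylGroup,
      P.toLinearMap (P.root (P.weylGroupToPerm w i)) (P.coroot j) ≠ 0 := by
  have h := hirr {j | ∃ w : P.weylGroup,
      P.toLinearMap (P.root (P.weylGroupToPerm w i)) (P.coroot j) ≠ 0} ⟨i, 1, ?_⟩ ?_
  · exact Set.eq_univ_iff_forall.mp h j
  · rw [map_one, Equiv.Perm.one_apply, P.root_coroot_two]
    norm_num
  -- Compare w and s_j w: ⟨s_j wα, k^∨⟩ = ⟨wα, k^∨⟩ - ⟨wα, j^∨⟩⟨α_j, k^∨⟩. Both pairings with k^∨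
  -- vanish and ⟨wα, j^∨⟩ does not, so ⟨α_j, k^∨⟩ = 0.
  · rintro j ⟨w, hw⟩ k hk
    simp only [Set.mem_ofPred_eq, not_exists, not_not] at hk
    have h₁ := hk w
    have h₂ := hk (RootPairing.weylGroup.ofIdx P j * w)
    rw [← RootPairing.weylGroup_apply_root, mul_smul, RootPairing.weylGroup_apply_root,
      ofIdx_smul_eq, map_sub, LinearMap.sub_apply, h₁, map_smul, LinearMap.smul_apply, zero_sub,
      neg_eq_zero, smul_eq_mul] at h₂
    exact (mul_eq_zero.mp h₂).resolve_left hw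

/-! ### The affine Demazure algebra contains the lifts of all translation quotients. -/

section DemazureAlgebra

variable {S : Type*} [CommRing S] [CharacterRing P S]

lemma η_mul_η (g h : AffineWeylGroup P) : η P S g * η P S h = η P S (g * h) := by
  rw [η, η, SkewMonoidAlgebra.single_mul_single, smul_one, mul_one]; rfl

lemma η_one : η P S 1 = 1 := rfl

lemma η_mul_scalar (g : AffineWeylGroup P) (q : LocalizedRing P S) :
    η P S g * scalar P S q = scalar P S (g.right • q) * η P S g := by
  simp only [η, scalar, SkewMonoidAlgebra.single_mul_single]
  rw [mul_one, one_mul, one_mul, smul_one, mul_one]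
  rfl

lemma scalar_mul_scalar (p q : LocalizedRing P S) :
    scalar P S p * scalar P S q = scalar P S (p * q) := by
  rw [scalar_mul, scalar, SkewMonoidAlgebra.smul_single]; rfl

lemma scalar_one : scalar P S 1 = 1 := rfl

lemma conj_scalar_mul (g h : AffineWeylGroup P) (q : LocalizedRing P S) :
    η P S g * (scalar P S q * (1 - η P S h)) * η P S g⁻¹ =
      scalar P S (g.right • q) * (1 - η P S (g * h * g⁻¹)) := by
  rw [← mul_assoc, η_mul_scalar, mul_assoc, mul_assoc, ← mul_assoc (η P S g), mul_sub, mul_one,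
    sub_mul, η_mul_η, η_mul_η, η_mul_η, mul_inv_cancel, η_one]

lemma translation_add (l l' : N) :
    translation P (l + l') = translation P l * translation P l' :=
  map_mul SemidirectProduct.inl (Multiplicative.ofAdd l) (Multiplicative.ofAdd l')

lemma translation_inv (l : N) : (translation P l)⁻¹ = translation P (-l) :=
  (map_inv SemidirectProduct.inl (Multiplicative.ofAdd l)).symm

lemma inr_mul_translation (w : P.weylGroup) (l : N) :
    (SemidirectProduct.inr w : AffineWeylGroup P) * translation P l *
      (SemidirectProduct.inr w : AffineWeylGroup P)⁻¹ = translation P (coweightMap P w l) := by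
  rw [translation, translation, ← coweightAction_ofAdd, SemidirectProduct.inl_aut, map_inv]

lemma inr_mul_refl (w : P.weylGroup) (i : ι) :
    (SemidirectProduct.inr w : AffineWeylGroup P) * refl P i *
      (SemidirectProduct.inr w : AffineWeylGroup P)⁻¹ = refl P (P.weylGroupToPerm w i) := by
  rw [refl, refl, ← conj_ofIdx, map_mul, map_mul, map_inv]

lemma refl_inv (i : ι) : (refl P i)⁻¹ = refl P i := by
  rw [refl, ← map_inv, ofIdx_inv]

lemma refl_mul_self (i : ι) : refl P i * refl P i = 1 := by
  rw [mul_eq_one_iff_inv_eq, refl_inv]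

/-- Follows from s_α t_{-λ} s_α = t_{-λ + ⟨α, λ⟩ α^∨}. When ⟨α, λ⟩ = 1, conjugation by t_λ turns s_α
into t_{α^∨} s_α. -/
lemma translation_mul_refl (i : ι) (l : N) :
    translation P l * refl P i * (translation P l)⁻¹ =
      translation P (P.toLinearMap (P.root i) l • P.coroot i) * refl P i := by
  have h := inr_mul_translation (RootPairing.weylGroup.ofIdx P i) (-l)
  rw [translation_inv, mul_assoc]
  have h' : refl P i * translation P (-l) =
      translation P (coweightMap P (RootPairing.weylGroup.ofIdx P i) (-l)) * refl P i := by
    rw [← h, refl, inv_mul_cancel_right]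
  rw [h', ← mul_assoc, ← translation_add, coweightMap_ofIdx]
  congr 2
  rw [map_neg, neg_smul]
  abel

/-- The lift of `translationQuotient` to the twisted group algebra. -/
def translationElement (P : RootPairing ι ℤ M N) (S : Type*) [CommRing S] [CharacterRing P S]
    (q : LocalizedRing P S) (l : N) : TwistedAlgebra P S :=
  scalar P S q * (1 - η P S (translation P l))

/-- The difference q(1 - ts) - q(1 - s) equals q(1 - t)s, and s is an involution. -/
lemma translationElement_of_mem {A : Subring (TwistedAlgebra P S)} {i : ι} {l : N}
    {q : LocalizedRing P S} (h₁ : scalar P S q * (1 - η P S (refl P i)) ∈ A)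
    (h₂ : scalar P S q * (1 - η P S (translation P l * refl P i)) ∈ A)
    (h₃ : η P S (refl P i) ∈ A) : translationElement P S q l ∈ A := by
  have e : translationElement P S q l =
      (scalar P S q * (1 - η P S (translation P l * refl P i)) -
        scalar P S q * (1 - η P S (refl P i))) * η P S (refl P i) := by
    rw [translationElement, ← mul_sub, mul_assoc, sub_sub_sub_cancel_left, sub_mul, η_mul_η,
      η_mul_η, mul_assoc, refl_mul_self, mul_one, η_one]
  rw [e]
  exact mul_mem (sub_mem h₂ h₁) h₃

variable {b : P.Base} {θ : ι}

lemma scalar_mem_demazureAlgebra (s : S) :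
    scalar P S (algebraMap S _ s) ∈ demazureAlgebra P S b θ :=
  Subring.subset_closure (Or.inl (Or.inl ⟨s, rfl⟩))

lemma η_refl_mem_of_demazureElement_mem {A : Subring (TwistedAlgebra P S)} {i : ι}
    (hA : ∀ s : S, scalar P S (algebraMap S _ s) ∈ A)
    (h : demazureElement P S i ∈ A) : η P S (refl P i) ∈ A := by
  have e : η P S (refl P i) =
      1 - scalar P S (algebraMap S _ (xRoot P S i)) * demazureElement P S i := by
    rw [demazureElement, ← mul_assoc, scalar_mul_scalar, xRoot_mul_invRoot, scalar_one, one_mul,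
      sub_sub_cancel]
  rw [e]
  exact sub_mem (one_mem _) (mul_mem (hA _) h)

lemma conj_demazureElement (w : P.weylGroup) (i : ι) :
    η P S (SemidirectProduct.inr w) * demazureElement P S i *
      η P S (SemidirectProduct.inr w)⁻¹ = demazureElement P S (P.weylGroupToPerm w i) := by
  rw [demazureElement, conj_scalar_mul, inr_mul_refl, SemidirectProduct.right_inr, smul_invRoot,
    demazureElement]

variable [Finite ι] [P.IsReduced] (H : IsRegularCharacterRing P S)
include H

/-- Every root is reached from a simple one by simple reflections, under which Demazure elements are
conjugate. Each η_s for s simple lies in the algebra because η_s = 1 - x_α X_α. -/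
lemma IsRegularCharacterRing.demazureElement_mem (i : ι) :
    demazureElement P S i ∈ demazureAlgebra P S b θ := by
  have h₁ : ∀ j ∈ b.support, demazureElement P S j ∈ demazureAlgebra P S b θ := fun j hj =>
    Subring.subset_closure (Or.inl (Or.inr ⟨j, hj, rfl⟩))
  refine b.induction_reflect i (p := fun i => demazureElement P S i ∈ demazureAlgebra P S b θ)
    (fun i hi => ?_) h₁ (fun i j hi hj => ?_)
  · obtain ⟨c, hc⟩ := H.exists_xRoot_mul_invRoot_neg i
    have e : demazureElement P S (P.reflectionPerm i i) =
        scalar P S (algebraMap S _ c) * demazureElement P S i := by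
      rw [demazureElement, demazureElement, ← mul_assoc, scalar_mul_scalar, ← hc, mul_right_comm,
        xRoot_mul_invRoot, one_mul, refl, refl, ofIdx_reflectionPerm_self]
    rw [e]
    exact mul_mem (scalar_mem_demazureAlgebra c) hi
  · have hη := η_refl_mem_of_demazureElement_mem scalar_mem_demazureAlgebra (h₁ j hj)
    rw [← weylGroupToPerm_ofIdx, ← conj_demazureElement]
    refine mul_mem (mul_mem hη hi) ?_
    change η P S (refl P j)⁻¹ ∈ _
    rwa [refl_inv]

lemma IsRegularCharacterRing.η_inr_mem (w : P.weylGroup) :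
    η P S (SemidirectProduct.inr w) ∈ demazureAlgebra P S b θ := by
  obtain ⟨w, hw⟩ := w
  induction hw using RootPairing.weylGroup.induction with
  | mem i =>
    exact η_refl_mem_of_demazureElement_mem scalar_mem_demazureAlgebra (H.demazureElement_mem i)
  | one => exact one_mem _
  | mul x y hx hy hx' hy' =>
    have := mul_mem hx' hy'
    rwa [η_mul_η, ← map_mul] at this

lemma IsRegularCharacterRing.translationElement_conj_mem (w : P.weylGroup) {i : ι}
    (h : translationElement P S (invRoot P S i) (P.coroot i) ∈ demazureAlgebra P S b θ) :
    translationElement P S (invRoot P S (P.weylGroupToPerm w i))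
      (P.coroot (P.weylGroupToPerm w i)) ∈ demazureAlgebra P S b θ := by
  have := mul_mem (mul_mem (H.η_inr_mem w) h) (H.η_inr_mem w⁻¹)
  rwa [map_inv, translationElement, conj_scalar_mul, inr_mul_translation,
    SemidirectProduct.right_inr, smul_invRoot, coweightMap_coroot] at this

omit [P.IsReduced] [Finite ι] H in
lemma η_translation_mem {i : ι}
    (h : translationElement P S (invRoot P S i) (P.coroot i) ∈ demazureAlgebra P S b θ) :
    η P S (translation P (P.coroot i)) ∈ demazureAlgebra P S b θ := by
  have e : η P S (translation P (P.coroot i)) = 1 - scalar P S (algebraMap S _ (xRoot P S i)) *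
      translationElement P S (invRoot P S i) (P.coroot i) := by
    rw [translationElement, ← mul_assoc, scalar_mul_scalar, xRoot_mul_invRoot, scalar_one,
      one_mul, sub_sub_cancel]
  rw [e]
  exact sub_mem (one_mem _) (mul_mem (scalar_mem_demazureAlgebra _) h)

/-- Subtracting X_{-θ} from X_0 yields the element with coefficient 1/x_{-θ}; the factor x_{-θ}/x_θ
∈ S then changes it to 1/x_θ. -/
lemma IsRegularCharacterRing.translationElement_highestRoot_mem :
    translationElement P S (invRoot P S θ) (P.coroot θ) ∈ demazureAlgebra P S b θ := by
  obtain ⟨c, hc⟩ := H.exists_xRoot_mul_invRoot_neg (P.reflectionPerm θ θ)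
  have hneg : P.reflectionPerm (P.reflectionPerm θ θ) (P.reflectionPerm θ θ) = θ :=
    P.root.injective (by rw [root_reflectionPerm_self, root_reflectionPerm_self, neg_neg])
  rw [hneg] at hc
  have h : translationElement P S (invRoot P S (P.reflectionPerm θ θ)) (P.coroot θ) ∈
      demazureAlgebra P S b θ := by
    refine translationElement_of_mem (i := θ) ?_
      (Subring.subset_closure (Or.inr rfl)) (H.η_inr_mem _)
    have := H.demazureElement_mem (b := b) (θ := θ) (P.reflectionPerm θ θ)
    rwa [demazureElement, refl, ofIdx_reflectionPerm_self] at this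
  have e : translationElement P S (invRoot P S θ) (P.coroot θ) = scalar P S (algebraMap S _ c) *
      translationElement P S (invRoot P S (P.reflectionPerm θ θ)) (P.coroot θ) := by
    rw [translationElement, translationElement, ← mul_assoc, scalar_mul_scalar, ← hc,
      mul_right_comm, xRoot_mul_invRoot, one_mul]
  rw [e]
  exact mul_mem (scalar_mem_demazureAlgebra c) h

variable
  (hirr : ∀ s : Set ι, s.Nonempty → (∀ i ∈ s, ∀ j ∉ s, P.pairing i j = 0) → s = Set.univ)
  (hθ : ∀ i, P.root θ - P.root i ∈ AddSubmonoid.closure (P.root '' b.support))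
include hirr hθ

lemma IsRegularCharacterRing.translationElement_mem (i : ι) :
    translationElement P S (invRoot P S i) (P.coroot i) ∈ demazureAlgebra P S b θ := by
  have hs : ∀ w : P.weylGroup, translationElement P S (invRoot P S (P.weylGroupToPerm w θ))
      (P.coroot (P.weylGroupToPerm w θ)) ∈ demazureAlgebra P S b θ := fun w =>
    H.translationElement_conj_mem w H.translationElement_highestRoot_mem
  -- Some conjugate wα pairs nontrivially with θ^∨. Either wα = ±θ and α is in the orbit of θ, or
  -- the pairing is ±1 and α pairs to 1 with the coroot of w⁻¹θ or of its negative.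
  obtain ⟨w, hw⟩ := exists_toLinearMap_ne_zero hirr i θ
  have hinv : ∀ j, P.weylGroupToPerm w i = j → P.weylGroupToPerm w⁻¹ j = i := by
    rintro j rfl
    rw [← Equiv.Perm.mul_apply, ← map_mul, inv_mul_cancel, map_one, Equiv.Perm.one_apply]
  have unit : ∀ j, P.toLinearMap (P.root i) (P.coroot j) = 1 →
      translationElement P S (invRoot P S j) (P.coroot j) ∈ demazureAlgebra P S b θ →
      translationElement P S (invRoot P S i) (P.coroot i) ∈ demazureAlgebra P S b θ := by
    intro j hj hZ
    have ht := η_translation_mem hZ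
    have ht' := η_translation_mem
      (H.translationElement_conj_mem (RootPairing.weylGroup.ofIdx P j) hZ)
    rw [weylGroupToPerm_ofIdx, coroot_reflectionPerm_self, ← translation_inv] at ht'
    refine translationElement_of_mem (i := i) (H.demazureElement_mem i) ?_ (H.η_inr_mem _)
    have := mul_mem (mul_mem ht (H.demazureElement_mem i)) ht'
    rw [demazureElement, conj_scalar_mul, translation_mul_refl, hj, one_smul] at this
    -- Conjugation by a translation leaves the coefficient 1/x_α unchanged.
    have e : (translation P (P.coroot j)).right • invRoot P S i = invRoot P S i :=
      one_smul P.weylGroup (invRoot P S i)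
    rwa [e] at this
  have hval : P.toLinearMap (P.root i) (P.coroot (P.weylGroupToPerm w⁻¹ θ)) =
      P.toLinearMap (P.root (P.weylGroupToPerm w i)) (P.coroot θ) := by
    rw [← coweightMap_coroot, ← toLinearMap_smul, RootPairing.weylGroup_apply_root]
  rcases toLinearMap_highestRoot b hθ (P.weylGroupToPerm w i) with h | h | h | h | h
  · exact absurd h hw
  · exact unit _ (hval.trans h) (hs w⁻¹)
  · refine unit (P.weylGroupToPerm (w⁻¹ * RootPairing.weylGroup.ofIdx P θ) θ) ?_ (hs _)
    rw [map_mul, Equiv.Perm.mul_apply, weylGroupToPerm_ofIdx, ← coweightMap_coroot,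
      coroot_reflectionPerm_self, map_neg, map_neg, coweightMap_coroot, hval, h, neg_neg]
  · rw [← hinv θ (P.root.injective h)]
    exact hs _
  · have := hs (w⁻¹ * RootPairing.weylGroup.ofIdx P θ)
    rwa [map_mul, Equiv.Perm.mul_apply, weylGroupToPerm_ofIdx,
      hinv _ (eq_reflectionPerm_self P h)] at this

omit [P.IsReduced] [Finite ι] H hirr hθ in
lemma pr_translationElement_mul (q : LocalizedRing P S) (l : N) (z : TwistedAlgebra P S) :
    pr P S (translationElement P S q l * z) = q • (1 - ηt P S l) * pr P S z := by
  have h : latticeHom P S (translation P l).right (pr P S z) = pr P S z := by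
    change latticeHom P S 1 (pr P S z) = pr P S z
    induction pr P S z using AddMonoidAlgebra.induction_on with
    | of m => exact (latticeHom_ηt P S 1 m).trans (by rw [coweightMap_one]; rfl)
    | add x y hx hy => rw [map_add, hx, hy]
    | smul r x hx => rw [latticeHom_smul, hx, one_smul]
  rw [translationElement, mul_assoc, pr_scalar_mul, sub_mul, one_mul, map_sub, pr_η_mul, h,
    smul_mul_assoc, sub_mul, one_mul]
  rfl

/-- As the coroots span the lattice, all translations lie in the Demazure algebra. Hence Z_α^d
η_{t_λ} lies in the relative module, where f is integral; multiplying by x_α^d gives the condition.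
-/
theorem IsRegularCharacterRing.isGrassmannianGKM_of_mem_relativeDual (hsc : P.corootSpan ℤ = ⊤)
    {f : Module.Dual (LocalizedRing P S) (LatticeAlgebra P S)} (hf : f ∈ relativeDual P S b θ) :
    IsGrassmannianGKM f := by
  obtain ⟨g, hg⟩ := hf
  have hη : ∀ l : N, η P S (translation P l) ∈ demazureAlgebra P S b θ := by
    intro l
    have hl : l ∈ P.corootSpan ℤ := hsc ▸ Submodule.mem_top
    have hl' : l ∈ AddSubgroup.closure (Set.range P.coroot) := by
      rw [RootPairing.corootSpan, ← Submodule.mem_toAddSubgroup,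
        Submodule.span_int_eq_addSubgroupClosure] at hl
      exact hl
    -- The algebra is not known to be closed under inverses, so l and -l are carried together
    -- through the induction.
    suffices η P S (translation P l) ∈ demazureAlgebra P S b θ ∧
        η P S (translation P (-l)) ∈ demazureAlgebra P S b θ from this.1
    induction hl' using AddSubgroup.closure_induction with
    | mem x hx =>
      obtain ⟨i, rfl⟩ := hx
      have := η_translation_mem (H.translationElement_mem hirr hθ (P.reflectionPerm i i))
      rw [coroot_reflectionPerm_self] at this
      exact ⟨η_translation_mem (H.translationElement_mem hirr hθ i), this⟩
    | zero =>
      rw [neg_zero]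
      exact ⟨one_mem _, one_mem _⟩
    | add x y _ _ hx hy =>
      rw [neg_add, translation_add, translation_add, ← η_mul_η, ← η_mul_η]
      exact ⟨mul_mem (hx (hsc ▸ Submodule.mem_top)).1 (hy (hsc ▸ Submodule.mem_top)).1,
        mul_mem (hx (hsc ▸ Submodule.mem_top)).2 (hy (hsc ▸ Submodule.mem_top)).2⟩
    | neg x _ hx =>
      rw [neg_neg]
      exact (hx (hsc ▸ Submodule.mem_top)).symm
  have hmem : ∀ (i : ι) (l : N) (d : ℕ),
      translationQuotient P S i ^ d * ηt P S l ∈ relativeModule P S b θ := by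
    intro i l d
    refine ⟨translationElement P S (invRoot P S i) (P.coroot i) ^ d * η P S (translation P l),
      mul_mem (S := Subring (TwistedAlgebra P S))
        (pow_mem (H.translationElement_mem hirr hθ i) d) (hη l), ?_⟩
    change pr P S _ = _
    induction d with
    | zero => rw [pow_zero, one_mul, pow_zero, one_mul]; exact pr_single P S _ _
    | succ d ih =>
      rw [pow_succ', mul_assoc, pr_translationElement_mul, ih, ← translationQuotient, pow_succ',
        mul_assoc]
  refine ⟨fun l => ?_, fun i l d _ => ?_⟩
  · obtain ⟨i⟩ : Nonempty ι := ⟨θ⟩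
    have h := hmem i l 0
    rw [pow_zero, one_mul] at h
    exact ⟨g ⟨_, h⟩, hg ⟨_, h⟩⟩
  · refine ⟨g ⟨_, hmem i l d⟩, ?_⟩
    rw [map_mul (algebraMap S _), ← hg ⟨_, hmem i l d⟩, ← translationQuotient_pow, smul_mul_assoc,
      map_smul,
      map_pow, smul_eq_mul]

theorem IsRegularCharacterRing.mem_relativeDual_iff [IsDomain S] (hsc : P.corootSpan ℤ = ⊤)
    (f : Module.Dual (LocalizedRing P S) (LatticeAlgebra P S)) :
    f ∈ relativeDual P S b θ ↔ IsGrassmannianGKM f :=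
  ⟨H.isGrassmannianGKM_of_mem_relativeDual hirr hθ hsc,
    H.mem_relativeDual_of_isGrassmannianGKM b θ⟩

end DemazureAlgebra

/-! ### The order filtration on power series. -/

section OrderIdeal

open MvPowerSeries

variable {σ R : Type*} [CommRing R]

/-- The ideal of power series of order at least `n`. -/
def orderIdeal (σ R : Type*) [CommRing R] (n : ℕ) : Ideal (MvPowerSeries σ R) where
  carrier := {f | (n : ℕ∞) ≤ f.order}
  zero_mem' := by simp
  add_mem' {f g} hf hg := (le_min hf hg).trans min_order_le_add
  smul_mem' c f hf := by
    rw [smul_eq_mul]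
    exact (le_add_left hf).trans le_order_mul

lemma mem_orderIdeal {n : ℕ} {f : MvPowerSeries σ R} :
    f ∈ orderIdeal σ R n ↔ ∀ d : σ →₀ ℕ, d.degree < n → coeff d f = 0 :=
  ⟨fun h _ hd => coeff_of_lt_order (lt_of_lt_of_le (by exact_mod_cast hd) h),
    fun h => nat_le_order h⟩

lemma orderIdeal_anti {m n : ℕ} (h : m ≤ n) : orderIdeal σ R n ≤ orderIdeal σ R m :=
  fun f hf => by
  change (n : ℕ∞) ≤ f.order at hf
  exact le_trans (Nat.cast_le.mpr h : (m : ℕ∞) ≤ n) hf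

lemma mul_mem_orderIdeal {m n : ℕ} {f g : MvPowerSeries σ R} (hf : f ∈ orderIdeal σ R m)
    (hg : g ∈ orderIdeal σ R n) : f * g ∈ orderIdeal σ R (m + n) := by
  change ((m + n : ℕ) : ℕ∞) ≤ _
  rw [Nat.cast_add]
  exact (add_le_add hf hg).trans le_order_mul

lemma mem_orderIdeal_zero (f : MvPowerSeries σ R) : f ∈ orderIdeal σ R 0 :=
  mem_orderIdeal.mpr fun _ h => absurd h (Nat.not_lt_zero _)

lemma mem_orderIdeal_one {f : MvPowerSeries σ R} :
    f ∈ orderIdeal σ R 1 ↔ constantCoeff f = 0 := by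
  rw [mem_orderIdeal]
  constructor
  · intro h
    exact h 0 (by simp)
  · intro h d hd
    rw [Nat.lt_one_iff, Finsupp.degree_eq_zero_iff] at hd
    rw [hd]
    exact h

lemma eq_zero_of_forall_mem_orderIdeal {f : MvPowerSeries σ R} (h : ∀ n, f ∈ orderIdeal σ R n) :
    f = 0 := by
  ext d
  exact mem_orderIdeal.mp (h (d.degree + 1)) d (Nat.lt_succ_self _)

lemma eq_of_forall_sub_mem_orderIdeal {f g : MvPowerSeries σ R}
    (h : ∀ n, f - g ∈ orderIdeal σ R n) : f = g :=
  sub_eq_zero.mp (eq_zero_of_forall_mem_orderIdeal h)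

/-- Completeness of the power series ring. -/
lemma exists_limit (a : ℕ → MvPowerSeries σ R)
    (ha : ∀ n, a (n + 1) - a n ∈ orderIdeal σ R n) :
    ∃ f, ∀ n, f - a n ∈ orderIdeal σ R n := by
  have hle : ∀ m n, m ≤ n → a n - a m ∈ orderIdeal σ R m := by
    intro m n h
    induction n, h using Nat.le_induction with
    | base => rw [sub_self]; exact zero_mem _
    | succ n hn ih =>
      rw [← sub_add_sub_cancel]
      exact add_mem (orderIdeal_anti hn (ha n)) ih
  -- The coefficient at d no longer changes from index |d| + 1 on.
  let f : MvPowerSeries σ R := fun d => coeff d (a (d.degree + 1))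
  have hf : ∀ d, coeff d f = coeff d (a (d.degree + 1)) := fun _ => rfl
  refine ⟨f, fun n => mem_orderIdeal.mpr fun d hd => ?_⟩
  have h := mem_orderIdeal.mp (hle (d.degree + 1) n hd) d (Nat.lt_succ_self _)
  rw [map_sub, sub_eq_zero] at h ⊢
  rw [hf, h]

lemma mem_orderIdeal_ideal_pow {A : Type*} [CommRing A] {I : Ideal A}
    (φ : A →+* MvPowerSeries σ R) (h : ∀ a ∈ I, φ a ∈ orderIdeal σ R 1) (n : ℕ) :
    ∀ a ∈ I ^ n, φ a ∈ orderIdeal σ R n := by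
  induction n with
  | zero => intro a _; exact mem_orderIdeal_zero _
  | succ n ih =>
    suffices I ^ (n + 1) ≤ (orderIdeal σ R (n + 1)).comap φ from fun a ha => this ha
    rw [pow_succ, Ideal.mul_le]
    intro a ha b hb
    rw [Ideal.mem_comap, map_mul]
    exact mul_mem_orderIdeal (ih a ha) (h b hb)

end OrderIdeal

/-! ### Truncated evaluation of a power series in two variables. -/

section TruncEval

variable {R : Type*} [CommRing R]

/-- The value at `(a, b)` of the truncation of `g` to exponents less than `k`. -/
def truncEval {B : Type*} [CommRing B] [Algebra R B] (g : MvPowerSeries (Fin 2) R) (k : ℕ)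
    (a b : B) : B :=
  ∑ i ∈ Finset.range k, ∑ j ∈ Finset.range k,
    algebraMap R B (g.coeff (Finsupp.single 0 i + Finsupp.single 1 j)) * a ^ i * b ^ j

lemma truncatedSum_eq_truncEval {M : Type*} (F : FormalGroup R) (μ ν : M) (k : ℕ) :
    truncatedSum F μ ν k = truncEval F.toPowerSeries k (MvPolynomial.X μ) (MvPolynomial.X ν) := rfl

lemma map_truncEval {B B' : Type*} [CommRing B] [Algebra R B] [CommRing B'] [Algebra R B']
    (φ : B →ₐ[R] B') (g : MvPowerSeries (Fin 2) R) (k : ℕ) (a b : B) :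
    φ (truncEval g k a b) = truncEval g k (φ a) (φ b) := by
  simp [truncEval]

/-- The truncation is a polynomial, so it is compatible with passage to B/I. -/
lemma truncEval_sub_mem {B : Type*} [CommRing B] [Algebra R B] (g : MvPowerSeries (Fin 2) R)
    (k : ℕ) {I : Ideal B} {a a' b b' : B} (ha : a - a' ∈ I) (hb : b - b' ∈ I) :
    truncEval g k a b - truncEval g k a' b' ∈ I := by
  rw [← Ideal.Quotient.eq] at *
  rw [← Ideal.Quotient.mkₐ_eq_mk R] at *
  rw [map_truncEval, map_truncEval, ha, hb]

lemma truncEval_mem {B : Type*} [CommRing B] [Algebra R B] (g : MvPowerSeries (Fin 2) R)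
    (k : ℕ) {A : Subalgebra R B} {a b : B} (ha : a ∈ A) (hb : b ∈ A) : truncEval g k a b ∈ A :=
  sum_mem fun _ _ => sum_mem fun _ _ =>
    mul_mem (mul_mem (algebraMap_mem _ _) (pow_mem ha _)) (pow_mem hb _)

open MvPowerSeries

lemma sub_truncEval_X_mem (g : MvPowerSeries (Fin 2) R) (k : ℕ) :
    g - truncEval g k (X 0) (X 1) ∈ orderIdeal (Fin 2) R k := by
  classical
  rw [mem_orderIdeal]
  intro d hd
  have hd' : d 0 + d 1 < k := by
    rwa [Finsupp.degree_eq_sum, Fin.sum_univ_two] at hd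
  have hsum : ∀ e : Fin 2 →₀ ℕ, e = Finsupp.single 0 (e 0) + Finsupp.single 1 (e 1) := by
    intro e
    ext t
    fin_cases t <;> simp
  have hterm : ∀ i j : ℕ, coeff d (algebraMap R (MvPowerSeries (Fin 2) R)
      (g.coeff (Finsupp.single 0 i + Finsupp.single 1 j)) * X 0 ^ i * X 1 ^ j) =
      if i = d 0 ∧ j = d 1 then coeff d g else 0 := by
    intro i j
    rw [← c_eq_algebraMap, mul_assoc, coeff_C_mul, X_pow_eq, X_pow_eq, monomial_mul_monomial,
      coeff_monomial, mul_one]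
    by_cases h : i = d 0 ∧ j = d 1
    · obtain ⟨rfl, rfl⟩ := h
      rw [← hsum, if_pos rfl, mul_one, if_pos ⟨rfl, rfl⟩]
    · rw [if_neg h, if_neg, mul_zero]
      rintro h'
      apply h
      rw [h']
      simp
  rw [map_sub, truncEval, map_sum, sub_eq_zero]
  simp only [map_sum, hterm]
  rw [Finset.sum_eq_single (d 0), Finset.sum_eq_single (d 1)]
  · simp
  · intro j _ hj; rw [if_neg]; exact fun h => hj h.2
  · intro h; exact absurd (Finset.mem_range.mpr (by omega)) h
  · intro i _ hi; exact Finset.sum_eq_zero fun j _ => by rw [if_neg]; exact fun h => hi h.1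
  · intro h; exact absurd (Finset.mem_range.mpr (by omega)) h

variable {σ : Type*}

lemma hasSubst_pair {a b : MvPowerSeries σ R} (ha : a ∈ orderIdeal σ R 1)
    (hb : b ∈ orderIdeal σ R 1) : HasSubst ![a, b] :=
  hasSubst_of_constantCoeff_zero fun s => by
    fin_cases s
    · exact mem_orderIdeal_one.mp ha
    · exact mem_orderIdeal_one.mp hb

/-- The part of g that is cut off has order at least k, and substituting series of order at least 1
does not lower the order. -/
lemma subst_sub_truncEval_mem (g : MvPowerSeries (Fin 2) R) (k : ℕ) {a b : MvPowerSeries σ R}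
    (ha : a ∈ orderIdeal σ R 1) (hb : b ∈ orderIdeal σ R 1) :
    g.subst ![a, b] - truncEval g k a b ∈ orderIdeal σ R k := by
  have h := hasSubst_pair ha hb
  have e : g.subst ![a, b] - truncEval g k a b = (g - truncEval g k (X 0) (X 1)).subst ![a, b] := by
    rw [← coe_substAlgHom h, map_sub, map_truncEval, substAlgHom_X, substAlgHom_X]
    rfl
  rw [e]
  have h₁ : (1 : ℕ∞) ≤ ⨅ i, (![a, b] i).order := le_iInf fun i => by
    fin_cases i
    · exact ha
    · exact hb
  have h₂ : (k : ℕ∞) ≤ (g - truncEval g k (X 0) (X 1)).order := sub_truncEval_X_mem g k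
  calc (k : ℕ∞) = 1 * k := (one_mul _).symm
    _ ≤ _ := mul_le_mul' h₁ h₂
    _ ≤ _ := le_order_subst h _

lemma subst_sub_subst_mem (g : MvPowerSeries (Fin 2) R) (k : ℕ) {a a' b b' : MvPowerSeries σ R}
    (ha : a ∈ orderIdeal σ R 1) (hb : b ∈ orderIdeal σ R 1) (ha' : a' ∈ orderIdeal σ R 1)
    (hb' : b' ∈ orderIdeal σ R 1) (haa : a - a' ∈ orderIdeal σ R k)
    (hbb : b - b' ∈ orderIdeal σ R k) :
    g.subst ![a, b] - g.subst ![a', b'] ∈ orderIdeal σ R k := by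
  have h₁ := subst_sub_truncEval_mem g k ha hb
  have h₂ := subst_sub_truncEval_mem g k ha' hb'
  have h₃ := truncEval_sub_mem g k haa hbb
  have := add_mem (sub_mem h₁ h₂) h₃
  convert this using 1
  ring

end TruncEval

/-! ### The shape of a formal group law. -/

section FormalGroupLaw

open MvPowerSeries

variable {R σ : Type*} [CommRing R] (F : FormalGroup R)

lemma coeff_formalGroup_left (n : ℕ) :
    F.toPowerSeries.coeff (Finsupp.single 0 n) = if n = 1 then 1 else 0 := by
  have h := congrArg (PowerSeries.coeff n) F.Xzero_eq_X
  rw [PowerSeries.coeff_X] at h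
  rw [← h, PowerSeries.coeff, coeff_subst, finsum_eq_single _ (Finsupp.single 0 n)]
  · simp
  · intro d hd
    by_cases hd₁ : d 1 = 0
    · have hd₀ : d 0 ≠ n := by
        intro h0
        apply hd
        ext t
        fin_cases t
        · simpa using h0
        · simpa using hd₁
      simp [hd₁, PowerSeries.coeff_X_pow]
      grind
    · simp [hd₁]
  · exact HasSubst.X_zero

lemma coeff_formalGroup_right (n : ℕ) :
    F.toPowerSeries.coeff (Finsupp.single 1 n) = if n = 1 then 1 else 0 := by
  have h := congrArg (PowerSeries.coeff n) F.zeroX_eq_X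
  rw [PowerSeries.coeff_X] at h
  rw [← h, PowerSeries.coeff, coeff_subst, finsum_eq_single _ (Finsupp.single 1 n)]
  · simp
  · intro d hd
    by_cases hd₁ : d 0 = 0
    · have hd₀ : d 1 ≠ n := by
        intro h0
        apply hd
        ext t
        fin_cases t
        · simpa using hd₁
        · simpa using h0
      simp [hd₁, PowerSeries.coeff_X_pow]
      grind
    · simp [hd₁]
  · exact HasSubst.zero_X

/-- `F(X, Y) = X + Y + X Y G(X, Y)`. -/
lemma exists_eq_X_add_X_add : ∃ G : MvPowerSeries (Fin 2) R,
    F.toPowerSeries = X 0 + X 1 + X 0 * X 1 * G := by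
  classical
  -- The coefficients of G are those of F shifted by XY. The monomials not divisible by XY are
  -- determined by F(X, 0) = X and F(0, Y) = Y.
  let m : Fin 2 →₀ ℕ := Finsupp.single 0 1 + Finsupp.single 1 1
  let G : MvPowerSeries (Fin 2) R := fun d => coeff (d + m) F.toPowerSeries
  have hG : ∀ d, coeff d G = coeff (d + m) F.toPowerSeries := fun _ => rfl
  refine ⟨G, ?_⟩
  ext d
  have e : (X 0 * X 1 : MvPowerSeries (Fin 2) R) = monomial m 1 := by
    rw [X_def, X_def, monomial_mul_monomial, one_mul]
  rw [map_add, map_add, e, coeff_monomial_mul, coeff_X, coeff_X]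
  have hd : d = Finsupp.single 0 (d 0) + Finsupp.single 1 (d 1) := by
    ext t
    fin_cases t <;> simp
  by_cases hm : m ≤ d
  · have h₀ : 1 ≤ d 0 := by simpa [m] using hm 0
    have h₁ : 1 ≤ d 1 := by simpa [m] using hm 1
    rw [if_neg, if_neg, if_pos hm, hG, tsub_add_cancel_of_le hm]
    · simp
    · intro h; rw [h] at h₀; simp at h₀
    · intro h; rw [h] at h₁; simp at h₁
  · rw [if_neg hm, add_zero]
    by_cases h₀ : d 0 = 0
    · rw [h₀, Finsupp.single_zero, zero_add] at hd
      rw [hd, coeff_formalGroup_right]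
      simp [Finsupp.single_eq_single_iff]
    · have h₁ : d 1 = 0 := by
        by_contra h₁
        apply hm
        intro t
        fin_cases t
        · simpa [m] using Nat.one_le_iff_ne_zero.mpr h₀
        · simpa [m] using Nat.one_le_iff_ne_zero.mpr h₁
      rw [h₁, Finsupp.single_zero, add_zero] at hd
      rw [hd, coeff_formalGroup_left]
      simp [Finsupp.single_eq_single_iff]

/-- `F(a, b) = a + b + a b G(a, b)`. -/
lemma exists_subst_eq_add_add : ∃ G : MvPowerSeries (Fin 2) R,
    ∀ {σ : Type*} {a b : MvPowerSeries σ R}, a ∈ orderIdeal σ R 1 → b ∈ orderIdeal σ R 1 →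
      F.toPowerSeries.subst ![a, b] = a + b + a * b * G.subst ![a, b] := by
  obtain ⟨G, hG⟩ := exists_eq_X_add_X_add F
  refine ⟨G, fun {σ a b} ha hb => ?_⟩
  have h := hasSubst_pair ha hb
  rw [hG]
  simp only [← coe_substAlgHom h, map_add, map_mul, substAlgHom_X]
  rfl

end FormalGroupLaw

/-! ### Points of the formal group and charts of the weight lattice. -/

section Points

open MvPowerSeries

variable {R σ : Type*} [CommRing R] (F : FormalGroup R)

lemma hasSubst_iff_mem_orderIdeal [IsDomain R] {f : MvPowerSeries σ R} :
    PowerSeries.HasSubst f ↔ f ∈ orderIdeal σ R 1 := by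
  rw [mem_orderIdeal_one, PowerSeries.HasSubst, isNilpotent_iff_eq_zero]

/-- Every point of a commutative formal group has an inverse. -/
lemma isAddUnit_point [IsDomain R] [F.IsComm] (p : F.Point σ) : IsAddUnit p := by
  obtain ⟨G, hG⟩ := exists_subst_eq_add_add F
  have hmem : ∀ x : F.Point σ, x.val ∈ orderIdeal σ R 1 := fun x =>
    hasSubst_iff_mem_orderIdeal.mp x.2
  have hadd : ∀ x y : F.Point σ, (x + y).val = x.val + y.val + x.val * y.val *
      G.subst ![x.val, y.val] := fun x y => hG (hmem x) (hmem y)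
  let opp : F.Point σ → F.Point σ := fun x =>
    ⟨-x.val, hasSubst_iff_mem_orderIdeal.mpr (neg_mem (hmem x))⟩
  have hopp : ∀ x, (opp x).val = -x.val := fun _ => rfl
  -- Successive approximation of the inverse. If r = p +_F q_n, the next remainder is F(r, -r) = -r²
  -- G(r, -r), whose order is at least twice that of r.
  let q : ℕ → F.Point σ := Nat.rec 0 fun _ x => x + opp (p + x)
  have hq : ∀ n, q (n + 1) = q n + opp (p + q n) := fun _ => rfl
  have hpq : ∀ n, (p + q n).val ∈ orderIdeal σ R (n + 1) := by
    intro n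
    induction n with
    | zero => exact hmem _
    | succ n ih =>
      rw [hq, ← add_assoc, hadd, hopp, add_neg_cancel, zero_add]
      refine Ideal.mul_mem_right _ _ (orderIdeal_anti ?_ (mul_mem_orderIdeal ih (neg_mem ih)))
      omega
  have hstep : ∀ n, (q (n + 1)).val - (q n).val ∈ orderIdeal σ R n := by
    intro n
    have h := orderIdeal_anti (Nat.le_succ n) (neg_mem (hpq n))
    rw [hq, hadd, hopp, add_assoc, add_sub_cancel_left]
    exact add_mem h (Ideal.mul_mem_right _ _ (Ideal.mul_mem_left _ _ h))
  obtain ⟨f, hf⟩ := exists_limit (fun n => (q n).val) hstep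
  have hf₁ : f ∈ orderIdeal σ R 1 := by
    have := add_mem (hf 1) (hmem (q 1))
    rwa [sub_add_cancel] at this
  let f' : F.Point σ := ⟨f, hasSubst_iff_mem_orderIdeal.mpr hf₁⟩
  have h : p + f' = 0 := by
    apply Subtype.ext
    apply eq_zero_of_forall_mem_orderIdeal
    intro n
    have h₁ : (p + f').val - (p + q n).val ∈ orderIdeal σ R n :=
      subst_sub_subst_mem F.toPowerSeries n (hmem p) hf₁ (hmem p) (hmem _)
        (by rw [sub_self]; exact zero_mem _) (hf n)
    have := add_mem h₁ (orderIdeal_anti (Nat.le_succ n) (hpq n))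
    rwa [sub_add_cancel] at this
  exact IsAddUnit.of_add_eq_zero f' h

/-- A homomorphism from a lattice to the points of the formal group `F` in a power series ring,
sending the elements of a given basis to the variables. -/
structure IsChart {M : Type*} [AddCommGroup M] (e : Module.Basis σ ℤ M)
    (y : M → MvPowerSeries σ R) : Prop where
  basis : ∀ j, y (e j) = X j
  mem : ∀ μ, y μ ∈ orderIdeal σ R 1
  zero : y 0 = 0
  add : ∀ μ ν, y (μ + ν) = F.toPowerSeries.subst ![y μ, y ν]

/-- The points that are additive units form an abelian group, so the freeness of M extends e_j ↦ X_j
to a homomorphism. -/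
lemma exists_isChart [IsDomain R] [F.IsComm] {M : Type*} [AddCommGroup M] (e : Module.Basis σ ℤ M) :
    ∃ y : M → MvPowerSeries σ R, IsChart F e y := by
  let v : σ → AddUnits (F.Point σ) := fun j =>
    (isAddUnit_point F (⟨X j, hasSubst_iff_mem_orderIdeal.mpr
      (mem_orderIdeal_one.mpr (constantCoeff_X j))⟩ : F.Point σ)).addUnit
  let Y : M →ₗ[ℤ] AddUnits (F.Point σ) := e.constr ℤ v
  refine ⟨fun μ => ((Y μ : AddUnits (F.Point σ)) : F.Point σ).val, ?_, ?_, ?_, ?_⟩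
  · intro j
    rw [show Y (e j) = v j from e.constr_basis ℤ v j]
    rfl
  · exact fun μ => hasSubst_iff_mem_orderIdeal.mp (Subtype.property _)
  · rw [map_zero]
    rfl
  · intro μ ν
    rw [map_add]
    rfl

variable {F} {M : Type*} [AddCommGroup M] {e : Module.Basis σ ℤ M} {y : M → MvPowerSeries σ R}

/-- In F(a, b) = a + b + abG the last term has order at least 2, so linear coefficients are additive
in μ; the two sides agree on the basis. -/
lemma IsChart.coeff_single (h : IsChart F e y) (μ : M) (j : σ) :
    coeff (Finsupp.single j 1) (y μ) = e.repr μ j := by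
  classical
  obtain ⟨G, hG⟩ := exists_subst_eq_add_add F
  let f : M →+ R :=
    { toFun := fun μ => coeff (Finsupp.single j 1) (y μ)
      map_zero' := by rw [h.zero, map_zero]
      map_add' := fun μ ν => by
        rw [h.add, hG (h.mem μ) (h.mem ν), map_add, map_add,
          mem_orderIdeal.mp (Ideal.mul_mem_right _ _ (mul_mem_orderIdeal (h.mem μ) (h.mem ν))),
          add_zero]
        simp }
  let g : M →+ R := (Int.castAddHom R).comp (e.coord j).toAddMonoidHom
  have hfg : f.toIntLinearMap = g.toIntLinearMap := e.ext fun i => by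
    change coeff (Finsupp.single j 1) (y (e i)) = ((e.repr (e i) j : ℤ) : R)
    rw [h.basis, coeff_X, e.repr_self, Finsupp.single_apply]
    simp [Finsupp.single_left_inj, eq_comm]
  exact congrArg (fun φ => φ μ) hfg

lemma IsChart.ne_zero [CharZero R] (h : IsChart F e y) {μ : M} (hμ : μ ≠ 0) : y μ ≠ 0 := by
  intro h0
  apply hμ
  apply e.repr.injective
  ext j
  have := h.coeff_single μ j
  rw [h0, map_zero] at this
  simpa using this.symm

end Points

/-! ### Continuous evaluation of the completed polynomial ring. -/

section Evaluation

variable {R σ M : Type*} [CommRing R] {y : M → MvPowerSeries σ R}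

lemma aeval_mem_orderIdeal (hy : ∀ μ, y μ ∈ orderIdeal σ R 1) (k : ℕ) :
    ∀ p ∈ augIdeal R M ^ k, MvPolynomial.aeval y p ∈ orderIdeal σ R k := by
  refine mem_orderIdeal_ideal_pow (MvPolynomial.aeval y : _ →ₐ[R] MvPowerSeries σ R).toRingHom
    (fun p hp => ?_) k
  have h : (MvPowerSeries.constantCoeff.comp
      (MvPolynomial.aeval y : _ →ₐ[R] MvPowerSeries σ R).toRingHom) =
      (MvPolynomial.constantCoeff : MvPolynomial M R →+* R) := by
    refine MvPolynomial.ringHom_ext (fun r => ?_) fun μ => ?_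
    · simp [← MvPowerSeries.c_eq_algebraMap]
    · simpa using mem_orderIdeal_one.mp (hy μ)
  rw [mem_orderIdeal_one]
  exact (RingHom.congr_fun h p).trans hp

lemma sub_mem_augIdeal_pow {z : PowerSeriesAlgebra R M} {m n : ℕ} (hmn : m ≤ n)
    {p q : MvPolynomial M R}
    (hp : AdicCompletion.evalₐ (augIdeal R M) n z = Ideal.Quotient.mk _ p)
    (hq : AdicCompletion.evalₐ (augIdeal R M) m z = Ideal.Quotient.mk _ q) :
    p - q ∈ augIdeal R M ^ m := by
  obtain ⟨f, rfl⟩ := AdicCompletion.mk_surjective (augIdeal R M) (MvPolynomial M R) z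
  rw [AdicCompletion.evalₐ_mk] at hp hq
  have hf : Ideal.Quotient.mk (augIdeal R M ^ m) (f n) =
      Ideal.Quotient.mk (augIdeal R M ^ m) (f m) := AdicCompletion.Ideal.mk_eq_mk _ hmn f
  rw [← Ideal.Quotient.eq, ← hq, ← hf, eq_comm, Ideal.Quotient.eq]
  exact Ideal.pow_le_pow_right hmn (Ideal.Quotient.eq.mp hp)

lemma exists_evalₐ_eq (z : PowerSeriesAlgebra R M) (k : ℕ) : ∃ p : MvPolynomial M R,
    AdicCompletion.evalₐ (augIdeal R M) k z = Ideal.Quotient.mk _ p :=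
  (Ideal.Quotient.mk_surjective _).imp fun _ h => h.symm

lemma exists_completedEval (hy : ∀ μ, y μ ∈ orderIdeal σ R 1) (z : PowerSeriesAlgebra R M) :
    ∃ f : MvPowerSeries σ R, ∀ (k : ℕ) (p : MvPolynomial M R),
      AdicCompletion.evalₐ (augIdeal R M) k z = Ideal.Quotient.mk _ p →
        f - MvPolynomial.aeval y p ∈ orderIdeal σ R k := by
  choose p hp using exists_evalₐ_eq z
  obtain ⟨f, hf⟩ := exists_limit (fun k => MvPolynomial.aeval y (p k)) fun k => by
    rw [← map_sub]
    exact aeval_mem_orderIdeal hy k _ (sub_mem_augIdeal_pow (Nat.le_succ k) (hp _) (hp k))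
  refine ⟨f, fun k q hq => ?_⟩
  have h := aeval_mem_orderIdeal hy k _ (sub_mem_augIdeal_pow le_rfl (hp k) hq)
  rw [map_sub] at h
  rw [← sub_add_sub_cancel]
  exact add_mem (hf k) h

/-- The continuous homomorphism from `R[[x_M]]` with `x_μ ↦ y μ`. -/
def completedEval (hy : ∀ μ, y μ ∈ orderIdeal σ R 1) :
    PowerSeriesAlgebra R M →+* MvPowerSeries σ R where
  toFun z := (exists_completedEval hy z).choose
  map_one' := eq_of_forall_sub_mem_orderIdeal fun k => by
    simpa using (exists_completedEval hy 1).choose_spec k 1 (by simp)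
  map_zero' := eq_of_forall_sub_mem_orderIdeal fun k => by
    simpa using (exists_completedEval hy 0).choose_spec k 0 (by simp)
  map_add' z w := eq_of_forall_sub_mem_orderIdeal fun k => by
    obtain ⟨p, hp⟩ := exists_evalₐ_eq z k
    obtain ⟨q, hq⟩ := exists_evalₐ_eq w k
    have h₁ := (exists_completedEval hy z).choose_spec k p hp
    have h₂ := (exists_completedEval hy w).choose_spec k q hq
    have h₃ := (exists_completedEval hy (z + w)).choose_spec k (p + q)
      (by rw [map_add, hp, hq, map_add])
    rw [map_add] at h₃
    convert sub_mem h₃ (add_mem h₁ h₂) using 1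
    ring
  map_mul' z w := eq_of_forall_sub_mem_orderIdeal fun k => by
    obtain ⟨p, hp⟩ := exists_evalₐ_eq z k
    obtain ⟨q, hq⟩ := exists_evalₐ_eq w k
    have h₁ := (exists_completedEval hy z).choose_spec k p hp
    have h₂ := (exists_completedEval hy w).choose_spec k q hq
    have h₃ := (exists_completedEval hy (z * w)).choose_spec k (p * q)
      (by rw [map_mul, hp, hq, map_mul])
    rw [map_mul] at h₃
    convert sub_mem h₃ (add_mem (Ideal.mul_mem_right (exists_completedEval hy w).choose _ h₁)
      (Ideal.mul_mem_left _ (MvPolynomial.aeval y p) h₂)) using 1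
    ring

lemma completedEval_sub_mem (hy : ∀ μ, y μ ∈ orderIdeal σ R 1) {z : PowerSeriesAlgebra R M}
    {k : ℕ} {p : MvPolynomial M R}
    (hp : AdicCompletion.evalₐ (augIdeal R M) k z = Ideal.Quotient.mk _ p) :
    completedEval hy z - MvPolynomial.aeval y p ∈ orderIdeal σ R k :=
  (exists_completedEval hy z).choose_spec k p hp

lemma completedEval_var (hy : ∀ μ, y μ ∈ orderIdeal σ R 1) (μ : M) :
    completedEval hy (var R μ) = y μ :=
  eq_of_forall_sub_mem_orderIdeal fun k => by
    simpa using completedEval_sub_mem hy (evalₐ_var μ k)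

lemma completedEval_formalSum (hy : ∀ μ, y μ ∈ orderIdeal σ R 1) (F : FormalGroup R) (μ ν : M) :
    completedEval hy (formalSum F μ ν) = F.toPowerSeries.subst ![y μ, y ν] :=
  eq_of_forall_sub_mem_orderIdeal fun k => by
    have h₁ := completedEval_sub_mem hy (evalₐ_formalSum F μ ν k)
    rw [truncatedSum_eq_truncEval, map_truncEval, MvPolynomial.aeval_X, MvPolynomial.aeval_X] at h₁
    have := sub_mem h₁ (subst_sub_truncEval_mem F.toPowerSeries k (hy μ) (hy ν))
    rwa [sub_sub_sub_cancel_right] at this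

end Evaluation

/-! ### The basis variables generate modulo each power of the augmentation ideal. -/

section Generators

/-- The polynomials that modulo the `k`-th power of the augmentation ideal lie in the ideal
generated by the relations of the formal group algebra. -/
def truncatedRelationIdeal {R : Type*} [CommRing R] (F : FormalGroup R) (M : Type*)
    [AddCommGroup M] (k : ℕ) : Ideal (MvPolynomial M R) :=
  ((relationIdeal F M).map (AdicCompletion.evalₐ (augIdeal R M) k)).comap (Ideal.Quotient.mk _)

variable {R M : Type*} [CommRing R] [AddCommGroup M] {F : FormalGroup R}

lemma pow_le_truncatedRelationIdeal (k : ℕ) :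
    augIdeal R M ^ k ≤ truncatedRelationIdeal F M k := fun p hp => by
  rw [truncatedRelationIdeal, Ideal.mem_comap, Ideal.Quotient.eq_zero_iff_mem.mpr hp]
  exact zero_mem _

lemma mem_truncatedRelationIdeal {k : ℕ} {p : MvPolynomial M R} :
    p ∈ truncatedRelationIdeal F M k ↔ ∃ z ∈ relationIdeal F M,
      AdicCompletion.evalₐ (augIdeal R M) k z = Ideal.Quotient.mk _ p := by
  rw [truncatedRelationIdeal, Ideal.mem_comap, Ideal.mem_map_iff_of_surjective _
    (AdicCompletion.surjective_evalₐ _ _)]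

lemma X_zero_mem_truncatedRelationIdeal (k : ℕ) :
    (MvPolynomial.X 0 : MvPolynomial M R) ∈ truncatedRelationIdeal F M k :=
  mem_truncatedRelationIdeal.mpr ⟨_, Ideal.subset_span (Or.inl rfl), evalₐ_var 0 k⟩

lemma X_add_sub_mem_truncatedRelationIdeal (μ ν : M) (k : ℕ) :
    (MvPolynomial.X (μ + ν) - truncatedSum F μ ν k : MvPolynomial M R) ∈
      truncatedRelationIdeal F M k :=
  mem_truncatedRelationIdeal.mpr ⟨_, Ideal.subset_span (Or.inr ⟨(μ, ν), rfl⟩), by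
    rw [map_sub, map_sub, evalₐ_formalSum, evalₐ_var]⟩

/-- If `F(a, b) = 0` for nilpotent `a`, `b`, then `b` belongs to every algebra containing `a`. -/
lemma mem_of_truncEval_eq_zero {B : Type*} [CommRing B] [Algebra R B] {A : Subalgebra R B}
    {k : ℕ} {a b : B} (ha : a ∈ A) (hak : a ^ k = 0) (hbk : b ^ k = 0)
    (h : truncEval F.toPowerSeries k a b = 0) : b ∈ A := by
  -- For k = 0 the ring is zero, for k = 1 the element b is zero. From k = 2 on the truncation
  -- retains the linear term of F(0, Y) = Y.
  obtain _ | _ | m := k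
  · rw [← one_mul b, ← pow_zero a, hak, zero_mul]; exact zero_mem _
  · rw [← pow_one b, hbk]; exact zero_mem _
  let c : ℕ → ℕ → R := fun i j =>
    F.toPowerSeries.coeff (Finsupp.single 0 i + Finsupp.single 1 j)
  let P : Polynomial B := ∑ i ∈ Finset.range (m + 1), ∑ j ∈ Finset.range (m + 2),
    Polynomial.C (algebraMap R B (c (i + 1) j) * a ^ i) * Polynomial.X ^ j
  have hP : ∀ x, P.eval x = ∑ i ∈ Finset.range (m + 1), ∑ j ∈ Finset.range (m + 2),
      algebraMap R B (c (i + 1) j) * a ^ i * x ^ j := fun x => by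
    simp [P, Polynomial.eval_finsetSum]
  have hPA : ∀ x ∈ A, P.eval x ∈ A := fun x hx => by
    rw [hP]
    exact sum_mem fun i _ => sum_mem fun j _ =>
      mul_mem (mul_mem (algebraMap_mem _ _) (pow_mem ha _)) (pow_mem hx _)
  -- Separating the terms without a writes F(a, b) as b + a P(b), where P has coefficients in A.
  have hb : b = -(a * P.eval b) := by
    have h₀ : ∑ j ∈ Finset.range (m + 2), algebraMap R B (c 0 j) * a ^ 0 * b ^ j = b := by
      rw [Finset.sum_eq_single 1]
      · simp [c, coeff_formalGroup_right]
      · intro j _ hj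
        simp [c, coeff_formalGroup_right, hj]
      · intro h; simp at h
    have h₁ : truncEval F.toPowerSeries (m + 2) a b = a * P.eval b + b := by
      rw [truncEval, Finset.sum_range_succ', hP, Finset.mul_sum]
      congr 1
      refine Finset.sum_congr rfl fun i _ => ?_
      rw [Finset.mul_sum]
      refine Finset.sum_congr rfl fun j _ => ?_
      simp only [c]
      ring
    rw [h] at h₁
    linear_combination -h₁
  -- The map β ↦ -aP(β) preserves A, fixes b, and gains a factor a at each application; it
  -- terminates because a is nilpotent.
  have hmain : ∀ j, ∃ β ∈ A, a ^ j ∣ b - β := by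
    intro j
    induction j with
    | zero => exact ⟨0, zero_mem _, by simp⟩
    | succ j ih =>
      obtain ⟨β, hβ, hd⟩ := ih
      refine ⟨-(a * P.eval β), neg_mem (mul_mem ha (hPA β hβ)), ?_⟩
      have h₁ : b - -(a * P.eval β) = -(a * (P.eval b - P.eval β)) := by
        linear_combination hb
      rw [h₁, dvd_neg, pow_succ']
      exact mul_dvd_mul_left a (hd.trans (Polynomial.sub_dvd_eval_sub _ _ _))
  obtain ⟨β, hβ, hd⟩ := hmain (m + 2)
  rw [hak, zero_dvd_iff, sub_eq_zero] at hd
  rwa [hd]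

lemma exists_sub_rename_mem {σ : Type*} (e : Module.Basis σ ℤ M) (k : ℕ) (p : MvPolynomial M R) :
    ∃ q : MvPolynomial σ R, p - MvPolynomial.rename e q ∈ truncatedRelationIdeal F M k := by
  let π := Ideal.Quotient.mkₐ R (truncatedRelationIdeal F M k)
  let A : Subalgebra R (MvPolynomial M R ⧸ truncatedRelationIdeal F M k) :=
    (π.comp (MvPolynomial.rename e)).range
  have hπ : ∀ q, π q = 0 ↔ q ∈ truncatedRelationIdeal F M k := fun q =>
    Ideal.Quotient.eq_zero_iff_mem
  have hpow : ∀ μ, π (MvPolynomial.X μ) ^ k = 0 := fun μ => by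
    rw [← map_pow, hπ]
    exact pow_le_truncatedRelationIdeal k (Ideal.pow_mem_pow (X_mem_augIdeal μ) k)
  have hadd : ∀ μ ν, π (MvPolynomial.X (μ + ν)) =
      truncEval F.toPowerSeries k (π (MvPolynomial.X μ)) (π (MvPolynomial.X ν)) := fun μ ν => by
    rw [← map_truncEval, ← truncatedSum_eq_truncEval, ← sub_eq_zero, ← map_sub, hπ]
    exact X_add_sub_mem_truncatedRelationIdeal μ ν k
  have hzero : π (MvPolynomial.X 0) = 0 := (hπ _).mpr (X_zero_mem_truncatedRelationIdeal k)
  -- The weights whose variable is expressible in the basis variables form a subgroup: sums are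
  -- given by the truncated law, and negatives by solving F(x_μ, x_{-μ}) = 0 with nilpotent entries.
  let L : AddSubgroup M :=
    { carrier := {μ | π (MvPolynomial.X μ) ∈ A}
      zero_mem' := by
        change π (MvPolynomial.X 0) ∈ A
        rw [hzero]
        exact zero_mem _
      add_mem' := fun {μ ν} hμ hν => by
        change π (MvPolynomial.X (μ + ν)) ∈ A
        rw [hadd]
        exact truncEval_mem _ _ hμ hν
      neg_mem' := fun {μ} hμ => by
        change π (MvPolynomial.X (-μ)) ∈ A
        refine mem_of_truncEval_eq_zero (F := F) (a := π (MvPolynomial.X μ)) hμ (hpow _)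
          (hpow _) ?_
        rw [← hadd, add_neg_cancel, hzero] }
  have hL : ∀ μ, π (MvPolynomial.X μ) ∈ A := by
    intro μ
    have h : μ ∈ Submodule.span ℤ (Set.range e) := by rw [e.span_eq]; trivial
    rw [← Submodule.mem_toAddSubgroup, Submodule.span_int_eq_addSubgroupClosure] at h
    refine (AddSubgroup.closure_le L).mpr ?_ h
    rintro _ ⟨j, rfl⟩
    exact ⟨MvPolynomial.X j, by simp⟩
  have hp : π p ∈ A := by
    induction p using MvPolynomial.induction_on with
    | C r => exact ⟨MvPolynomial.C r, by simp⟩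
    | add p q hp hq => rw [map_add]; exact add_mem hp hq
    | mul_X p μ hp => rw [map_mul]; exact mul_mem hp (hL μ)
  obtain ⟨q, hq⟩ := hp
  refine ⟨q, (hπ _).mp ?_⟩
  rw [map_sub, sub_eq_zero]
  exact hq.symm

end Generators

/-! ### The formal group algebra as a power series ring. -/

section ChartHom

lemma aeval_X_eq_coe {R σ : Type*} [CommRing R] (q : MvPolynomial σ R) :
    MvPolynomial.aeval (MvPowerSeries.X : σ → MvPowerSeries σ R) q = (q : MvPowerSeries σ R) := by
  induction q using MvPolynomial.induction_on with
  | C r => simp [← MvPowerSeries.c_eq_algebraMap]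
  | add p q hp hq => rw [map_add, hp, hq, MvPolynomial.coe_add]
  | mul_X p μ hp => rw [map_mul, hp, MvPolynomial.aeval_X, MvPolynomial.coe_mul,
      MvPolynomial.coe_X]

lemma rename_mem_augIdeal_pow {R σ M : Type*} [CommRing R] (e : σ → M) {k : ℕ}
    {q : MvPolynomial σ R} (hq : q ∈ MvPolynomial.idealOfVars σ R ^ k) :
    MvPolynomial.rename e q ∈ augIdeal R M ^ k := by
  have := Ideal.mem_map_of_mem (MvPolynomial.rename e : _ →ₐ[R] MvPolynomial M R).toRingHom hq
  rw [Ideal.map_pow] at this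
  refine Ideal.pow_right_mono ?_ k this
  rw [Ideal.map_le_iff_le_comap, MvPolynomial.idealOfVars, Ideal.span_le]
  rintro _ ⟨j, rfl⟩
  simp

variable {R σ M : Type*} [CommRing R] [AddCommGroup M] {F : FormalGroup R}
  {e : Module.Basis σ ℤ M} {y : M → MvPowerSeries σ R} (h : IsChart F e y)

include h in
lemma IsChart.completedEval_relation : ∀ z ∈ relationIdeal F M, completedEval h.mem z = 0 := by
  change relationIdeal F M ≤ RingHom.ker (completedEval h.mem)
  rw [relationIdeal, Ideal.span_le]
  rintro z (rfl | ⟨p, rfl⟩)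
  · rw [SetLike.mem_coe, RingHom.mem_ker, completedEval_var, h.zero]
  · rw [SetLike.mem_coe, RingHom.mem_ker, map_sub, completedEval_var, completedEval_formalSum,
      h.add, sub_self]

include h in
lemma IsChart.aeval_mem {k : ℕ} {p : MvPolynomial M R} (hp : p ∈ truncatedRelationIdeal F M k) :
    MvPolynomial.aeval y p ∈ orderIdeal σ R k := by
  obtain ⟨z, hz, hzp⟩ := mem_truncatedRelationIdeal.mp hp
  have := completedEval_sub_mem h.mem hzp
  rwa [h.completedEval_relation z hz, zero_sub, neg_mem_iff] at this

include h in
-- This gives injectivity of the chart: the closed relation ideal is the entire kernel of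
-- evaluation, not just a part of it.
lemma IsChart.completedEval_eq_zero_iff (z : PowerSeriesAlgebra R M) :
    completedEval h.mem z = 0 ↔ z ∈ closureIdeal (relationIdeal F M) := by
  have hz : z ∈ closureIdeal (relationIdeal F M) ↔ ∀ (k : ℕ) (p : MvPolynomial M R),
      AdicCompletion.evalₐ (augIdeal R M) k z = Ideal.Quotient.mk _ p →
        p ∈ truncatedRelationIdeal F M k := by
    simp only [closureIdeal, Ideal.mem_iInf, truncatedRelationIdeal, Ideal.mem_comap]
    refine forall_congr' fun k => ⟨fun hk p hp => hp ▸ hk, fun hk => ?_⟩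
    obtain ⟨p, hp⟩ := exists_evalₐ_eq z k
    rw [hp]
    exact hk p hp
  rw [hz]
  constructor
  · intro h0 k p hp
    have h₁ := completedEval_sub_mem h.mem hp
    rw [h0, zero_sub, neg_mem_iff] at h₁
    -- Modulo relations the approximation p becomes a polynomial q in the basis variables.
    -- Evaluation does not alter q, so the vanishing of z leaves q with terms of degree at least k
    -- only.
    obtain ⟨q, hq⟩ := exists_sub_rename_mem (F := F) e k p
    have h₂ := sub_mem h₁ (h.aeval_mem hq)
    rw [map_sub, sub_sub_cancel, MvPolynomial.aeval_rename] at h₂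
    have h₃ : (y ∘ e) = MvPowerSeries.X := funext h.basis
    have h₄ : q ∈ MvPolynomial.idealOfVars σ R ^ k := by
      rw [MvPolynomial.mem_pow_idealOfVars_iff']
      intro d hd
      have := mem_orderIdeal.mp h₂ d hd
      rwa [h₃, aeval_X_eq_coe, MvPolynomial.coeff_coe] at this
    have h₅ := rename_mem_augIdeal_pow e h₄
    have := add_mem hq (pow_le_truncatedRelationIdeal k h₅)
    rwa [sub_add_cancel] at this
  · intro hz'
    refine eq_zero_of_forall_mem_orderIdeal fun k => ?_
    obtain ⟨p, hp⟩ := exists_evalₐ_eq z k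
    have := add_mem (completedEval_sub_mem h.mem hp) (h.aeval_mem (hz' k p hp))
    rwa [sub_add_cancel] at this

/-- The formal group algebra of a lattice with a basis is a power series ring. -/
def IsChart.hom : FormalGroupAlgebra F M →+* MvPowerSeries σ R :=
  Ideal.Quotient.lift _ (completedEval h.mem) fun z hz => (h.completedEval_eq_zero_iff z).mpr hz

lemma IsChart.hom_mk (z : PowerSeriesAlgebra R M) :
    h.hom (Ideal.Quotient.mk _ z) = completedEval h.mem z := rfl

lemma IsChart.hom_var (μ : M) : h.hom (Ideal.Quotient.mk _ (var R μ)) = y μ :=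
  completedEval_var h.mem μ

lemma IsChart.hom_injective : Function.Injective h.hom := by
  rw [injective_iff_map_eq_zero]
  intro s hs
  obtain ⟨z, rfl⟩ := Ideal.Quotient.mk_surjective s
  exact Ideal.Quotient.eq_zero_iff_mem.mpr ((h.completedEval_eq_zero_iff z).mp hs)

/-- With finitely many variables the truncations of f by total degree are polynomials; they define a
Cauchy sequence whose limit maps to f. -/
lemma IsChart.hom_surjective [Finite σ] : Function.Surjective h.hom := by
  intro f
  let p : ℕ → MvPolynomial M R := fun k => MvPolynomial.rename e (f.truncTotal k)
  have hp : ∀ k, p (k + 1) - p k ∈ augIdeal R M ^ k := fun k => by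
    rw [← map_sub]
    exact rename_mem_augIdeal_pow e
      (MvPowerSeries.truncTotal_sub_truncTotal_mem_pow_idealOfVars (Nat.le_succ k) le_rfl f)
  let z : PowerSeriesAlgebra R M := AdicCompletion.mk (augIdeal R M) (MvPolynomial M R)
    (AdicCompletion.AdicCauchySequence.mk (augIdeal R M) (MvPolynomial M R) p fun k => by
      rw [SModEq.comm, SModEq.sub_mem, smul_eq_mul, Ideal.mul_top]
      exact hp k)
  have hz : ∀ k, AdicCompletion.evalₐ (augIdeal R M) k z = Ideal.Quotient.mk _ (p k) := fun k => by
    simp [z]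
  refine ⟨Ideal.Quotient.mk _ z, ?_⟩
  rw [h.hom_mk]
  refine eq_of_forall_sub_mem_orderIdeal fun k => ?_
  have h₁ := completedEval_sub_mem h.mem (hz k)
  rw [MvPolynomial.aeval_rename, show y ∘ e = MvPowerSeries.X from funext h.basis,
    aeval_X_eq_coe] at h₁
  have h₂ : f - (f.truncTotal k : MvPolynomial σ R) ∈ orderIdeal σ R k := by
    rw [mem_orderIdeal]
    intro d hd
    rw [map_sub, MvPolynomial.coeff_coe, MvPowerSeries.coeff_truncTotal _ hd, sub_self]
  have := sub_mem h₁ h₂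
  rwa [sub_sub_sub_cancel_right] at this

end ChartHom

/-! ### Roots in the weight lattice of a simply connected datum. -/

section Lattice

universe u

variable {ι N : Type*} {M : Type u} [AddCommGroup M] [AddCommGroup N] (P : RootPairing ι ℤ M N)

/-- The lattice N is spanned by finitely many coroots and is reflexive over ℤ, hence free of finite
rank; M is its dual. -/
lemma free_and_finite_weights [Finite ι] (hsc : P.corootSpan ℤ = ⊤) :
    Module.Free ℤ M ∧ Module.Finite ℤ M := by
  have hN : Module.IsReflexive ℤ N := Module.IsReflexive.of_isPerfPair P.toLinearMap.flip
  have hfin : Module.Finite ℤ N := ⟨by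
    rw [← hsc]
    exact Submodule.fg_span (Set.finite_range _)⟩
  have hfree : Module.Free ℤ N := inferInstance
  exact ⟨Module.Free.of_equiv P.toLinearMap.toPerfPair.symm,
    Module.Finite.equiv P.toLinearMap.toPerfPair.symm⟩

/-- Since f(α) = 1, the lattice splits as ℤα ⊕ ker f, and the kernel is free. -/
lemma exists_basis_of_eq_one {σ : Type*} (e₀ : Module.Basis σ ℤ M) [Finite σ] {α : M}
    (f : Module.Dual ℤ M) (hf : f α = 1) :
    ∃ (τ : Type u) (_ : Finite τ) (e : Module.Basis τ ℤ M) (j : τ), e j = α := by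
  have := Module.Free.of_basis e₀
  have := Module.Finite.of_basis e₀
  let φ : (ℤ × LinearMap.ker f) ≃ₗ[ℤ] M := LinearEquiv.ofBijective
    ((LinearMap.toSpanSingleton ℤ M α).coprod (LinearMap.ker f).subtype) (by
      constructor
      · rw [injective_iff_map_eq_zero]
        rintro ⟨t, x, hx⟩ h
        simp only [LinearMap.coprod_apply, LinearMap.toSpanSingleton_apply,
          Submodule.subtype_apply] at h
        have ht : t = 0 := by
          have := congrArg f h
          rw [map_add, map_smul, hf, LinearMap.mem_ker.mp hx] at this
          simpa using this
        subst ht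
        simpa using h
      · intro μ
        refine ⟨(f μ, ⟨μ - f μ • α, ?_⟩), ?_⟩
        · rw [LinearMap.mem_ker, map_sub, map_smul, hf]
          simp
        · simp)
  have hφ : ∀ x, φ x = x.1 • α + x.2 := fun _ => rfl
  refine ⟨Unit ⊕ Module.Free.ChooseBasisIndex ℤ (LinearMap.ker f), inferInstance,
    ((Module.Basis.singleton Unit ℤ).prod (Module.Free.chooseBasis ℤ (LinearMap.ker f))).map φ,
    Sum.inl (), ?_⟩
  rw [Module.Basis.map_apply, hφ]
  simp

/-- In the simply connected case, a root is divisible by two or part of a basis of the weight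
lattice. -/
lemma exists_basis_or_exists_eq_two_nsmul [Finite ι] (hsc : P.corootSpan ℤ = ⊤) (i : ι) :
    (∃ (τ : Type u) (_ : Finite τ) (e : Module.Basis τ ℤ M) (j : τ), e j = P.root i) ∨
      ∃ μ, P.root i = 2 • μ := by
  obtain ⟨_, _⟩ := free_and_finite_weights P hsc
  by_cases h : ∃ l : N, P.toLinearMap (P.root i) l = 1
  · obtain ⟨l, hl⟩ := h
    exact Or.inl (exists_basis_of_eq_one (Module.Free.chooseBasis ℤ M)
      (P.toLinearMap.flip l) hl)
  · right
    -- As ⟨α, α^∨⟩ = 2, an odd value of α could be shifted to 1 by a multiple of α^∨. So all values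
    -- are even, and half of α is a functional on N, which comes from a weight by perfectness.
    have heven : ∀ l : N, 2 ∣ P.toLinearMap (P.root i) l := by
      intro l
      by_contra hodd
      apply h
      refine ⟨l - (P.toLinearMap (P.root i) l / 2) • P.coroot i, ?_⟩
      rw [map_sub, map_smul, P.root_coroot_two, smul_eq_mul]
      omega
    let g : N →ₗ[ℤ] ℤ :=
      { toFun := fun l => P.toLinearMap (P.root i) l / 2
        map_add' := fun l m => by
          rw [map_add, Int.add_ediv_of_dvd_left (heven l)]
        map_smul' := fun t l => by
          rw [map_smul, smul_eq_mul, Int.mul_ediv_assoc _ (heven l)]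
          rfl }
    obtain ⟨μ, hμ⟩ := P.toLinearMap.toPerfPair.surjective g
    refine ⟨μ, P.toLinearMap.toPerfPair.injective ?_⟩
    rw [map_nsmul, hμ]
    ext l
    change P.toLinearMap (P.root i) l = (2 • g) l
    have : g l = P.toLinearMap (P.root i) l / 2 := rfl
    rw [LinearMap.smul_apply, this, nsmul_eq_mul]
    exact (Int.mul_ediv_cancel' (heven l)).symm

/-- A root that is not proportional to a basis element has another nonzero coordinate. -/
lemma exists_repr_ne_zero [P.IsReduced] {τ : Type*} (e : Module.Basis τ ℤ M) {i j : ι} {t : τ}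
    (ht : e t = P.root i) (h₁ : P.root j ≠ P.root i) (h₂ : P.root j ≠ -P.root i) :
    ∃ s ≠ t, e.repr (P.root j) s ≠ 0 := by
  by_contra! h
  have hj : P.root j = e.repr (P.root j) t • P.root i := by
    apply e.repr.injective
    ext s
    rw [map_smul, ← ht, e.repr_self, Finsupp.smul_apply]
    by_cases hs : s = t
    · rw [hs, Finsupp.single_eq_same, smul_eq_mul, mul_one]
    · rw [h s hs, Finsupp.single_eq_of_ne hs, smul_zero]
  have hdep : ¬LinearIndependent ℤ ![P.root j, P.root i] := by
    intro hli
    have := (LinearIndependent.pair_iff.mp hli 1 (-e.repr (P.root j) t)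
      (by rw [neg_smul, ← hj, one_smul, add_neg_cancel])).1
    exact one_ne_zero this
  rcases RootPairing.IsReduced.eq_or_eq_neg j i hdep with h | h
  · exact h₁ h
  · exact h₂ h

end Lattice

/-! ### A variable of a power series ring is prime. -/

section PrimeVariable

open MvPowerSeries

variable {R σ : Type*} [CommRing R]

/-- The value of a power series at `X j = 0`. -/
def setZero (j : σ) (f : MvPowerSeries σ R) : MvPowerSeries σ R :=
  fun d => if d j = 0 then coeff d f else 0

lemma coeff_setZero (j : σ) (f : MvPowerSeries σ R) (d : σ →₀ ℕ) :
    coeff d (setZero j f) = if d j = 0 then coeff d f else 0 := rfl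

lemma setZero_eq_zero_iff (j : σ) (f : MvPowerSeries σ R) : setZero j f = 0 ↔ X j ∣ f := by
  rw [X_dvd_iff]
  constructor
  · intro h d hd
    have := coeff_setZero j f d
    rwa [h, if_pos hd, map_zero, eq_comm] at this
  · intro h
    ext d
    rw [coeff_setZero, map_zero]
    split_ifs with hd
    · exact h d hd
    · rfl

lemma setZero_mul (j : σ) (f g : MvPowerSeries σ R) :
    setZero j (f * g) = setZero j f * setZero j g := by
  classical
  ext d
  rw [coeff_setZero, coeff_mul, coeff_mul]
  split_ifs with hd
  · refine Finset.sum_congr rfl fun p hp => ?_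
    have : p.1 j + p.2 j = 0 := by
      rw [← Finsupp.add_apply, Finset.HasAntidiagonal.mem_antidiagonal.mp hp, hd]
    rw [coeff_setZero, coeff_setZero, if_pos (by omega), if_pos (by omega)]
  · refine (Finset.sum_eq_zero fun p hp => ?_).symm
    have : p.1 j + p.2 j ≠ 0 := by
      rw [← Finsupp.add_apply, Finset.HasAntidiagonal.mem_antidiagonal.mp hp]
      exact hd
    rw [coeff_setZero, coeff_setZero]
    by_cases h : p.1 j = 0
    · rw [if_neg (show ¬ p.2 j = 0 by omega), mul_zero]
    · rw [if_neg h, zero_mul]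

instance instIsDomainMvPowerSeries [IsDomain R] : IsDomain (MvPowerSeries σ R) :=
  NoZeroDivisors.to_isDomain _

/-- Setting X_j = 0 is multiplicative with values in a domain, and the multiples of X_j are exactly
what it kills. -/
lemma X_dvd_mul_iff [IsDomain R] (j : σ) (f g : MvPowerSeries σ R) :
    X j ∣ f * g ↔ X j ∣ f ∨ X j ∣ g := by
  rw [← setZero_eq_zero_iff, ← setZero_eq_zero_iff, ← setZero_eq_zero_iff, setZero_mul,
    mul_eq_zero]

/-- In a domain, `b` is a nonzerodivisor modulo `a` if `a` is one modulo `b`. -/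
lemma dvd_of_dvd_mul_symm {S : Type*} [CommRing S] [IsDomain S] {a b : S} (hb : b ≠ 0)
    (h : ∀ s, b ∣ a * s → b ∣ s) (s : S) (hs : a ∣ b * s) : a ∣ s := by
  obtain ⟨t, ht⟩ := hs
  obtain ⟨t', rfl⟩ := h t ⟨s, ht.symm⟩
  refine ⟨t', mul_left_cancel₀ hb ?_⟩
  rw [ht]
  ring

end PrimeVariable

/-! ### Divisibility of s - w(s), passing to the limit. -/

section Rename

variable {R σ M : Type*} [CommRing R] {y : M → MvPowerSeries σ R}

lemma dvd_aeval_rename_sub {B : Type*} [CommRing B] [Algebra R B] {y : M → B} {w : M → M} {a : B}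
    (h : ∀ μ, a ∣ y (w μ) - y μ) (p : MvPolynomial M R) :
    a ∣ MvPolynomial.aeval y (MvPolynomial.rename w p) - MvPolynomial.aeval y p := by
  induction p using MvPolynomial.induction_on with
  | C r => simp
  | add p q hp hq =>
    simp only [map_add]
    rw [add_sub_add_comm]
    exact dvd_add hp hq
  | mul_X p μ hp =>
    simp only [map_mul, MvPolynomial.rename_X, MvPolynomial.aeval_X]
    have e : ∀ s s' t t' : B, s * t - s' * t' = (s - s') * t + s' * (t - t') :=
      fun _ _ _ _ => by ring
    rw [e]
    exact dvd_add (hp.mul_right _) ((h μ).mul_left _)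

/-- The quotient by a must also be small, so that the quotients of successive approximations can be
summed. The rule w(mn) - mn = w(m)(w(n) - n) + (w(m) - m)n shows that only one order is lost. -/
lemma exists_aeval_rename_sub_eq (hy : ∀ μ, y μ ∈ orderIdeal σ R 1) {w : M → M}
    {a : MvPowerSeries σ R} (h : ∀ μ, a ∣ y (w μ) - y μ) (k : ℕ) :
    ∀ p ∈ augIdeal R M ^ (k + 1), ∃ q ∈ orderIdeal σ R k,
      MvPolynomial.aeval y (MvPolynomial.rename w p) - MvPolynomial.aeval y p = a * q := by
  induction k with
  | zero =>
    intro p _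
    obtain ⟨q, hq⟩ := dvd_aeval_rename_sub h p
    exact ⟨q, mem_orderIdeal_zero q, hq⟩
  | succ k ih =>
    intro p hp
    rw [pow_succ] at hp
    refine Submodule.mul_induction_on hp (fun m hm n hn => ?_) fun p p' hp hp' => ?_
    · obtain ⟨q, hq, hqm⟩ := ih m hm
      obtain ⟨q', hqn⟩ := dvd_aeval_rename_sub h n
      have hm' : MvPolynomial.aeval y (MvPolynomial.rename w m) ∈ orderIdeal σ R (k + 1) := by
        rw [MvPolynomial.aeval_rename]
        exact aeval_mem_orderIdeal (fun μ => hy (w μ)) _ m hm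
      have hn' := aeval_mem_orderIdeal hy 1 n (by rwa [pow_one])
      refine ⟨MvPolynomial.aeval y (MvPolynomial.rename w m) * q' + q * MvPolynomial.aeval y n,
        add_mem (Ideal.mul_mem_right _ _ hm') (mul_mem_orderIdeal hq hn'), ?_⟩
      rw [map_mul, map_mul, map_mul]
      linear_combination (MvPolynomial.aeval y n) * hqm +
        MvPolynomial.aeval y (MvPolynomial.rename w m) * hqn
    · obtain ⟨q, hq, h₁⟩ := hp
      obtain ⟨q', hq', h₂⟩ := hp'
      refine ⟨q + q', add_mem hq hq', ?_⟩
      simp only [map_add]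
      linear_combination h₁ + h₂

lemma dvd_completedEval_rename_sub (hy : ∀ μ, y μ ∈ orderIdeal σ R 1) {w : M → M}
    {a : MvPowerSeries σ R} (h : ∀ μ, a ∣ y (w μ) - y μ) (z : PowerSeriesAlgebra R M) :
    a ∣ completedEval hy (completedRename R w z) - completedEval hy z := by
  choose p hp using exists_evalₐ_eq z
  have hp' : ∀ k, AdicCompletion.evalₐ (augIdeal R M) k (completedRename R w z) =
      Ideal.Quotient.mk _ (MvPolynomial.rename w (p k)) := fun k => by
    rw [evalₐ_completedRename, hp, Ideal.quotientMap_mk]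
    rfl
  let D : MvPolynomial M R → MvPowerSeries σ R := fun p =>
    MvPolynomial.aeval y (MvPolynomial.rename w p) - MvPolynomial.aeval y p
  have hD : ∀ k, completedEval hy (completedRename R w z) - completedEval hy z - D (p k) ∈
      orderIdeal σ R k := fun k => by
    convert sub_mem (completedEval_sub_mem hy (hp' k)) (completedEval_sub_mem hy (hp k)) using 1
    simp only [D]
    ring
  -- The indices are shifted by one to compensate for the lost order.
  have hstep : ∀ k, ∃ q ∈ orderIdeal σ R k, D (p (k + 2)) - D (p (k + 1)) = a * q := by
    intro k
    obtain ⟨q, hq, hqe⟩ := exists_aeval_rename_sub_eq hy h k _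
      (sub_mem_augIdeal_pow (Nat.le_succ (k + 1)) (hp _) (hp _))
    refine ⟨q, hq, ?_⟩
    rw [← hqe]
    simp only [D, map_sub]
    ring
  choose q hq hqe using hstep
  obtain ⟨q₀, hq₀⟩ := dvd_aeval_rename_sub h (p 1)
  let Q : ℕ → MvPowerSeries σ R := fun n => q₀ + ∑ k ∈ Finset.range n, q k
  have hQ : ∀ n, D (p (n + 1)) = a * Q n := by
    intro n
    induction n with
    | zero => simpa [Q, D] using hq₀
    | succ n ih =>
      have h₁ : Q (n + 1) = Q n + q n := by simp only [Q, Finset.sum_range_succ]; ring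
      rw [h₁, mul_add, ← ih, ← hqe, add_sub_cancel]
  obtain ⟨f, hf⟩ := exists_limit Q fun n => by
    simpa only [Q, Finset.sum_range_succ, ← add_assoc, add_sub_cancel_left] using hq n
  refine ⟨f, eq_of_forall_sub_mem_orderIdeal fun k => ?_⟩
  have h₁ := orderIdeal_anti (Nat.le_succ k) (hD (k + 1))
  rw [hQ] at h₁
  convert sub_mem h₁ (Ideal.mul_mem_left _ a (hf k)) using 1
  ring

end Rename

/-! ### Divisibility along multiples of a weight. -/

section Divisibility

variable {B M : Type*} [CommRing B] [AddCommGroup M] {y : M → B} (h₀ : y 0 = 0)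
  (hadd : ∀ μ ν, ∃ g, y (μ + ν) = y μ + y ν + y μ * y ν * g)

include h₀ hadd

/-- Expand 0 = y(μ + (-μ)). -/
lemma mul_dvd_add_neg (μ : M) : y μ * y (-μ) ∣ y μ + y (-μ) := by
  obtain ⟨g, hg⟩ := hadd μ (-μ)
  rw [add_neg_cancel, h₀] at hg
  exact ⟨-g, by linear_combination -hg⟩

lemma dvd_map_zsmul (α : M) (t : ℤ) : y α ∣ y (t • α) := by
  let L : AddSubgroup M :=
    { carrier := {μ | y α ∣ y μ}
      zero_mem' := by
        change y α ∣ y 0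
        rw [h₀]
        exact dvd_zero _
      add_mem' := fun {μ ν} hμ hν => by
        change y α ∣ y (μ + ν)
        obtain ⟨g, hg⟩ := hadd μ ν
        rw [hg]
        exact dvd_add (dvd_add hμ hν) ((hμ.mul_right _).mul_right _)
      neg_mem' := fun {μ} hμ => by
        change y α ∣ y (-μ)
        obtain ⟨g, hg⟩ := hadd μ (-μ)
        rw [add_neg_cancel, h₀] at hg
        have : y (-μ) = y μ * (-1 - y (-μ) * g) := by linear_combination -hg
        rw [this]
        exact hμ.mul_right _ }
  exact L.zsmul_mem (show α ∈ L from dvd_rfl) t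

/-- Applied with t = ⟨μ, α^∨⟩, where μ - tα = s_α μ. -/
lemma dvd_map_sub_zsmul (α μ : M) (t : ℤ) : y α ∣ y (μ - t • α) - y μ := by
  obtain ⟨g, hg⟩ := hadd μ (-t • α)
  rw [sub_eq_add_neg μ, ← neg_smul, hg]
  have : y μ + y (-t • α) + y μ * y (-t • α) * g - y μ = y (-t • α) * (1 + y μ * g) := by ring
  rw [this]
  exact (dvd_map_zsmul h₀ hadd α (-t)).mul_right _

end Divisibility

lemma IsChart.exists_add_eq {R σ M : Type*} [CommRing R] [AddCommGroup M] {F : FormalGroup R}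
    {e : Module.Basis σ ℤ M} {y : M → MvPowerSeries σ R} (h : IsChart F e y) (μ ν : M) :
    ∃ g, y (μ + ν) = y μ + y ν + y μ * y ν * g := by
  obtain ⟨G, hG⟩ := exists_subst_eq_add_add F
  exact ⟨_, by rw [h.add, hG (h.mem μ) (h.mem ν)]⟩

/-! ### Regularity of the formal group algebra. -/

section FormalGroupAlgebra

universe u

variable {R : Type*} [CommRing R] {ι N : Type*} {M : Type u} [AddCommGroup M] [AddCommGroup N]
  {P : RootPairing ι ℤ M N} {F : FormalGroup R}

lemma IsChart.dvd_iff {σ : Type*} [Finite σ] {e : Module.Basis σ ℤ M}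
    {y : M → MvPowerSeries σ R} (h : IsChart F e y) (s t : FormalGroupAlgebra F M) :
    s ∣ t ↔ h.hom s ∣ h.hom t :=
  (map_dvd_iff (RingEquiv.ofBijective h.hom ⟨h.hom_injective, h.hom_surjective⟩)).symm

lemma IsChart.hom_xRoot {σ : Type*} {e : Module.Basis σ ℤ M} {y : M → MvPowerSeries σ R}
    (h : IsChart F e y) (i : ι) : h.hom (xRoot P (FormalGroupAlgebra F M) i) = y (P.root i) :=
  h.hom_var _

/-- The power series `y μ` is a nonzerodivisor modulo a variable if it has some other variable as
a linear term. -/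
lemma IsChart.X_dvd_of_dvd_mul [IsDomain R] [CharZero R] [P.IsReduced] {τ : Type*}
    {e : Module.Basis τ ℤ M} {y : M → MvPowerSeries τ R} (h : IsChart F e y) {i j : ι} {t : τ}
    (ht : e t = P.root i) (h₁ : P.root j ≠ P.root i) (h₂ : P.root j ≠ -P.root i)
    {f : MvPowerSeries τ R} (hf : MvPowerSeries.X t ∣ y (P.root j) * f) :
    MvPowerSeries.X t ∣ f := by
  rw [X_dvd_mul_iff] at hf
  refine hf.resolve_left fun hj => ?_
  obtain ⟨u, hu, hu'⟩ := exists_repr_ne_zero P e ht h₁ h₂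
  have := MvPowerSeries.X_dvd_iff.mp hj (Finsupp.single u 1) (Finsupp.single_eq_of_ne hu.symm)
  rw [h.coeff_single] at this
  exact hu' (by exact_mod_cast this)

/-- Coprimality of `x_α` and `x_β` is only in question when both roots are divisible by two. -/
lemma xRoot_coprime {S : Type*} [CommRing S] [CharacterRing P S] [IsDomain S] [Finite ι]
    (hsc : P.corootSpan ℤ = ⊤) (hne : ∀ i, xRoot P S i ≠ 0)
    (hbasis : ∀ (τ : Type u) [Finite τ] (e : Module.Basis τ ℤ M) (t : τ) (i j : ι),
      e t = P.root i → P.root j ≠ P.root i → P.root j ≠ -P.root i →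
        ∀ s : S, xRoot P S i ∣ xRoot P S j * s → xRoot P S i ∣ s)
    (hdiv : DivisibleRootsCoprime P S) (i j : ι) (h₁ : P.root j ≠ P.root i)
    (h₂ : P.root j ≠ -P.root i) (s : S) (hs : xRoot P S i ∣ xRoot P S j * s) :
    xRoot P S i ∣ s := by
  rcases exists_basis_or_exists_eq_two_nsmul P hsc i with ⟨τ, _, e, t, ht⟩ | hi
  · exact hbasis τ e t i j ht h₁ h₂ s hs
  rcases exists_basis_or_exists_eq_two_nsmul P hsc j with ⟨τ, _, e, t, ht⟩ | hj
  · refine dvd_of_dvd_mul_symm (hne j) (hbasis τ e t j i ht h₁.symm fun h => h₂ ?_) s hs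
    rw [h, neg_neg]
  · exact hdiv i j hi hj h₁ h₂ s hs

lemma isDomain_formalGroupAlgebra [IsDomain R] [Finite ι] [F.IsComm] (hsc : P.corootSpan ℤ = ⊤) :
    IsDomain (FormalGroupAlgebra F M) := by
  obtain ⟨_, _⟩ := free_and_finite_weights P hsc
  obtain ⟨y, h⟩ := exists_isChart F (Module.Free.chooseBasis ℤ M)
  exact h.hom_injective.isDomain

lemma isRegularCharacterRing_formalGroupAlgebra [IsDomain R] [CharZero R] [Finite ι]
    [P.IsReduced] [F.IsComm]
    (hsc : P.corootSpan ℤ = ⊤) (hdiv : DivisibleRootsCoprime P (FormalGroupAlgebra F M)) :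
    IsRegularCharacterRing P (FormalGroupAlgebra F M) := by
  have := isDomain_formalGroupAlgebra (P := P) (F := F) hsc
  obtain ⟨_, _⟩ := free_and_finite_weights P hsc
  obtain ⟨y, h⟩ := exists_isChart F (Module.Free.chooseBasis ℤ M)
  have hne : ∀ i, xRoot P (FormalGroupAlgebra F M) i ≠ 0 := fun i hi => by
    have := h.hom_xRoot (P := P) i
    rw [hi, map_zero] at this
    exact h.ne_zero (root_pairing_self_ne_zero i) this.symm
  refine ⟨hne, xRoot_coprime hsc hne (fun τ _ e t i j ht h₁ h₂ s hs => ?_) hdiv, ?_, ?_⟩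
  -- A chart adapted to the root α, in which x_α is a variable; it varies with α.
  · obtain ⟨y, h⟩ := exists_isChart F e
    rw [h.dvd_iff, h.hom_xRoot, ← ht, h.basis] at hs ⊢
    rw [map_mul, h.hom_xRoot] at hs
    exact h.X_dvd_of_dvd_mul ht h₁ h₂ hs
  · intro i s
    obtain ⟨z, rfl⟩ := Ideal.Quotient.mk_surjective s
    have hw : RootPairing.weylGroup.ofIdx P i • (Ideal.Quotient.mk _ z : FormalGroupAlgebra F M) =
        Ideal.Quotient.mk _
          (completedRename R (weightHom P (RootPairing.weylGroup.ofIdx P i)) z) :=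
      Ideal.quotientMap_mk (H := closureIdeal_le F (weightHom P _))
    rw [hw, h.dvd_iff, map_sub, h.hom_xRoot, h.hom_mk, h.hom_mk, ← dvd_neg, neg_sub]
    refine dvd_completedEval_rename_sub h.mem (fun μ => ?_) z
    change _ ∣ y (RootPairing.weylGroup.ofIdx P i • μ) - y μ
    rw [ofIdx_smul_eq]
    exact dvd_map_sub_zsmul h.zero h.exists_add_eq _ _ _
  · intro i
    rw [h.dvd_iff, map_mul, map_add, h.hom_xRoot, h.hom_xRoot, root_reflectionPerm_self]
    exact mul_dvd_add_neg h.zero h.exists_add_eq _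

end FormalGroupAlgebra

/-! ### The connective formal group law. -/

section ConnectiveLaw

open MvPowerSeries

variable {R : Type*} [CommRing R]

lemma subst_add_sub_mul {σ : Type*} (c : R) {a b : MvPowerSeries σ R} (h : HasSubst ![a, b]) :
    (X 0 + X 1 - C c * (X 0 * X 1) : MvPowerSeries (Fin 2) R).subst ![a, b] =
      a + b - C c * (a * b) := by
  rw [← coe_substAlgHom h, c_eq_algebraMap, c_eq_algebraMap]
  simp only [map_add, map_sub, map_mul, substAlgHom_X, AlgHom.commutes]
  rfl

/-- The connective formal group law `x + y - c x y`. -/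
def connectiveLaw (c : R) : FormalGroup R where
  toPowerSeries := X 0 + X 1 - C c * (X 0 * X 1)
  zero_constantCoeff := by simp
  lin_coeff_X := by
    simp [X, monomial_mul_monomial, coeff_monomial,
      Finsupp.single_left_inj (one_ne_zero : (1 : ℕ) ≠ 0)]
  lin_coeff_Y := by
    simp [X, monomial_mul_monomial, coeff_monomial,
      Finsupp.single_left_inj (one_ne_zero : (1 : ℕ) ≠ 0)]
  assoc := by
    rw [subst_add_sub_mul c (HasSubst.cons_subst_zero_left (0 : Fin 3) 1 2 (by simp)),
      subst_add_sub_mul c (HasSubst.cons_subst_zero_right (0 : Fin 3) 1 2 (by simp)),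
      subst_add_sub_mul c HasSubst.X_X, subst_add_sub_mul c HasSubst.X_X]
    ring

lemma connectiveLaw_subst {σ : Type*} (c : R) {a b : MvPowerSeries σ R}
    (h : HasSubst ![a, b]) :
    (connectiveLaw c).toPowerSeries.subst ![a, b] = a + b - C c * (a * b) :=
  subst_add_sub_mul c h

instance (c : R) : (connectiveLaw c).IsComm where
  comm := by
    refine Eq.trans ?_ (connectiveLaw_subst c HasSubst.X_X).symm
    change X 0 + X 1 - C c * (X 0 * X 1) = _
    ring

end ConnectiveLaw

/-! ### The connective algebra inside a power series ring. -/

section ConnectiveAlgebra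

variable {R M : Type*} [CommRing R] [AddCommGroup M] {c : R}

/-- The element `x_μ` of the connective algebra. -/
def connectiveVar (c : R) (μ : M) : ConnectiveAlgebra c M :=
  Ideal.Quotient.mk _ (MvPolynomial.X μ)

lemma connectiveVar_zero : connectiveVar c (0 : M) = 0 :=
  Ideal.Quotient.eq_zero_iff_mem.mpr (Ideal.subset_span (Or.inl rfl))

lemma connectiveVar_add (μ ν : M) : connectiveVar c (μ + ν) = connectiveVar c μ +
    connectiveVar c ν - algebraMap R _ c * connectiveVar c μ * connectiveVar c ν := by
  refine (Ideal.Quotient.eq (I := connectiveIdeal c M)).mpr ?_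
  exact Ideal.subset_span (Or.inr ⟨(μ, ν), rfl⟩)

lemma aeval_connectiveVar (p : MvPolynomial M R) :
    MvPolynomial.aeval (connectiveVar c) p = (Ideal.Quotient.mk _ p : ConnectiveAlgebra c M) := by
  change _ = Ideal.Quotient.mkₐ R (connectiveIdeal c M) p
  congr 1
  ext μ
  simp [connectiveVar]

/-- The map μ ↦ 1 - c x_μ turns sums into products, so the inverse is 1 - c x_{-μ}. -/
lemma isUnit_one_sub_connectiveVar (μ : M) :
    IsUnit (1 - algebraMap R _ c * connectiveVar c μ) := by
  refine IsUnit.of_mul_eq_one (1 - algebraMap R _ c * connectiveVar c (-μ)) ?_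
  have h := connectiveVar_add (c := c) μ (-μ)
  rw [add_neg_cancel, connectiveVar_zero] at h
  linear_combination (algebraMap R (ConnectiveAlgebra c M) c) * h

/-- Up to units, the connective algebra is generated by the elements of a basis. -/
lemma exists_mul_eq_aeval {σ : Type*} (e : Module.Basis σ ℤ M)
    (s : ConnectiveAlgebra c M) : ∃ v : ConnectiveAlgebra c M, IsUnit v ∧
      ∃ q : MvPolynomial σ R, s * v = MvPolynomial.aeval (connectiveVar c ∘ e) q := by
  let B : Subalgebra R (ConnectiveAlgebra c M) :=
    (MvPolynomial.aeval (connectiveVar c ∘ e) : MvPolynomial σ R →ₐ[R] _).range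
  let U : Submonoid (ConnectiveAlgebra c M) := IsUnit.submonoid _ ⊓ B.toSubmonoid
  -- T consists of the fractions with numerator in B and denominator a unit of the algebra lying in
  -- B. It contains x_{-e_j} = -x_{e_j}/(1 - c x_{e_j}).
  let T : Subalgebra R (ConnectiveAlgebra c M) :=
    { carrier := {s | ∃ v ∈ U, s * v ∈ B}
      add_mem' := by
        rintro s t ⟨v, hv, hs⟩ ⟨w, hw, ht⟩
        refine ⟨v * w, mul_mem hv hw, ?_⟩
        rw [show (s + t) * (v * w) = s * v * w + t * w * v by ring]
        exact add_mem (mul_mem hs hw.2) (mul_mem ht hv.2)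
      mul_mem' := by
        rintro s t ⟨v, hv, hs⟩ ⟨w, hw, ht⟩
        refine ⟨v * w, mul_mem hv hw, ?_⟩
        rw [mul_mul_mul_comm]
        exact mul_mem hs ht
      algebraMap_mem' := fun r => ⟨1, one_mem _, by rw [mul_one]; exact algebraMap_mem _ r⟩ }
  have hB : ∀ j, connectiveVar c (e j) ∈ B := fun j => ⟨MvPolynomial.X j, by simp⟩
  have hadd : ∀ μ ν, connectiveVar c μ ∈ T → connectiveVar c ν ∈ T →
      connectiveVar c (μ + ν) ∈ T := fun μ ν hμ hν => by
    rw [connectiveVar_add]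
    exact sub_mem (add_mem hμ hν) (mul_mem (mul_mem (algebraMap_mem _ _) hμ) hν)
  let L : AddSubgroup M :=
    { carrier := {μ | connectiveVar c μ ∈ T ∧ connectiveVar c (-μ) ∈ T}
      zero_mem' := by
        change connectiveVar c 0 ∈ T ∧ connectiveVar c (-0) ∈ T
        rw [neg_zero, connectiveVar_zero]
        exact ⟨zero_mem _, zero_mem _⟩
      add_mem' := fun {μ ν} hμ hν => by
        change connectiveVar c (μ + ν) ∈ T ∧ connectiveVar c (-(μ + ν)) ∈ T
        rw [neg_add]
        exact ⟨hadd _ _ hμ.1 hν.1, hadd _ _ hμ.2 hν.2⟩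
      neg_mem' := fun {μ} hμ => by
        change connectiveVar c (-μ) ∈ T ∧ connectiveVar c (- -μ) ∈ T
        rw [neg_neg]
        exact hμ.symm }
  have hL : ∀ j, e j ∈ L := by
    refine fun j => ⟨⟨1, one_mem _, by rw [mul_one]; exact hB j⟩,
      1 - algebraMap R _ c * connectiveVar c (e j), ⟨isUnit_one_sub_connectiveVar _,
        show _ ∈ B from sub_mem (one_mem B) (mul_mem (algebraMap_mem B _) (hB j))⟩, ?_⟩
    have h := connectiveVar_add (c := c) (e j) (-e j)
    rw [add_neg_cancel, connectiveVar_zero] at h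
    have h' : connectiveVar c (-e j) * (1 - algebraMap R _ c * connectiveVar c (e j)) =
        -connectiveVar c (e j) := by linear_combination -h
    rw [h']
    exact neg_mem (hB j)
  have hT : ∀ μ, connectiveVar c μ ∈ T := by
    intro μ
    have h : μ ∈ Submodule.span ℤ (Set.range e) := by rw [e.span_eq]; trivial
    rw [← Submodule.mem_toAddSubgroup, Submodule.span_int_eq_addSubgroupClosure] at h
    refine ((AddSubgroup.closure_le L).mpr ?_ h).1
    rintro _ ⟨j, rfl⟩
    exact hL j
  obtain ⟨p, rfl⟩ := Ideal.Quotient.mk_surjective s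
  have hp : (Ideal.Quotient.mk _ p : ConnectiveAlgebra c M) ∈ T := by
    rw [← aeval_connectiveVar]
    induction p using MvPolynomial.induction_on with
    | C r => rw [MvPolynomial.aeval_C]; exact algebraMap_mem _ r
    | add p q hp hq => rw [map_add]; exact add_mem hp hq
    | mul_X p μ hp => rw [map_mul, MvPolynomial.aeval_X]; exact mul_mem hp (hT μ)
  obtain ⟨v, hv, q, hq⟩ := hp
  exact ⟨v, hv.1, q, hq.symm⟩

variable {σ : Type*} {e : Module.Basis σ ℤ M} {y : M → MvPowerSeries σ R}
  (h : IsChart (connectiveLaw c) e y)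

/-- The connective algebra of a lattice with a basis embeds into a power series ring. -/
def IsChart.connectiveHom : ConnectiveAlgebra c M →ₐ[R] MvPowerSeries σ R :=
  Ideal.Quotient.liftₐ _ (MvPolynomial.aeval y) (by
    change connectiveIdeal c M ≤ RingHom.ker _
    rw [connectiveIdeal, Ideal.span_le]
    rintro z (rfl | ⟨p, rfl⟩)
    · simp [h.zero]
    · rw [SetLike.mem_coe, RingHom.mem_ker]
      simp only [map_sub, map_add, map_mul, MvPolynomial.aeval_X, h.add,
        connectiveLaw_subst c (hasSubst_pair (h.mem _) (h.mem _))]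
      simp [MvPowerSeries.c_eq_algebraMap, mul_assoc])

lemma IsChart.connectiveHom_var (μ : M) : h.connectiveHom (connectiveVar c μ) = y μ := by
  change MvPolynomial.aeval y (MvPolynomial.X μ) = y μ
  rw [MvPolynomial.aeval_X]

lemma IsChart.connectiveHom_aeval (q : MvPolynomial σ R) :
    h.connectiveHom (MvPolynomial.aeval (connectiveVar c ∘ e) q) = (q : MvPowerSeries σ R) := by
  rw [← aeval_X_eq_coe, ← AlgHom.comp_apply, MvPolynomial.comp_aeval]
  congr 2
  funext j
  rw [Function.comp_apply, h.connectiveHom_var, h.basis]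

/-- Up to a unit every element is a polynomial in the basis variables, and such a polynomial maps to
itself as a power series. -/
lemma IsChart.connectiveHom_injective : Function.Injective h.connectiveHom := by
  rw [injective_iff_map_eq_zero]
  intro s hs
  obtain ⟨v, hv, q, hq⟩ := exists_mul_eq_aeval e s
  have h₁ := congrArg h.connectiveHom hq
  rw [map_mul, hs, zero_mul, h.connectiveHom_aeval, eq_comm, ← MvPolynomial.coe_zero,
    MvPolynomial.coe_inj] at h₁
  rw [h₁, map_zero] at hq
  exact (hv.mul_left_eq_zero).mp hq

/-- The embedding need not be surjective, so divisibility has to be brought back by hand: X_j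
divides the polynomial numerator of s as a power series, hence as a polynomial. -/
lemma IsChart.connectiveVar_dvd (j : σ) (s : ConnectiveAlgebra c M)
    (hs : MvPowerSeries.X j ∣ h.connectiveHom s) : connectiveVar c (e j) ∣ s := by
  obtain ⟨v, hv, q, hq⟩ := exists_mul_eq_aeval e s
  have h₁ := hs.mul_right (h.connectiveHom v)
  rw [← map_mul, hq, h.connectiveHom_aeval, MvPowerSeries.X_dvd_iff] at h₁
  have h₂ : MvPolynomial.X j ∣ q := by
    classical
    rw [MvPolynomial.X_dvd_iff_modMonomial_eq_zero]
    ext d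
    by_cases hd : Finsupp.single j 1 ≤ d
    · rw [MvPolynomial.coeff_modMonomial_of_le _ hd, MvPolynomial.coeff_zero]
    · rw [MvPolynomial.coeff_modMonomial_of_not_le _ hd, MvPolynomial.coeff_zero,
        ← MvPolynomial.coeff_coe]
      refine h₁ d ?_
      by_contra h0
      exact hd (by simpa using Nat.one_le_iff_ne_zero.mpr h0)
  have h₃ := map_dvd (MvPolynomial.aeval (R := R) (connectiveVar c ∘ e)) h₂
  rw [← hq, MvPolynomial.aeval_X] at h₃
  exact hv.dvd_mul_right.mp h₃

end ConnectiveAlgebra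

/-! ### Regularity of the connective algebra. -/

section ConnectiveRegular

universe u

variable {R : Type*} [CommRing R] [IsDomain R] {ι N : Type*} [Finite ι] {M : Type u}
  [AddCommGroup M] [AddCommGroup N] {P : RootPairing ι ℤ M N} {c : R}

lemma isDomain_connectiveAlgebra (hsc : P.corootSpan ℤ = ⊤) :
    IsDomain (ConnectiveAlgebra c M) := by
  obtain ⟨_, _⟩ := free_and_finite_weights P hsc
  obtain ⟨y, h⟩ := exists_isChart (connectiveLaw c) (Module.Free.chooseBasis ℤ M)
  exact h.connectiveHom_injective.isDomain h.connectiveHom.toRingHom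

lemma isRegularCharacterRing_connectiveAlgebra [CharZero R] [P.IsReduced]
    (hsc : P.corootSpan ℤ = ⊤) (hdiv : DivisibleRootsCoprime P (ConnectiveAlgebra c M)) :
    IsRegularCharacterRing P (ConnectiveAlgebra c M) := by
  have := isDomain_connectiveAlgebra (P := P) (c := c) hsc
  obtain ⟨_, _⟩ := free_and_finite_weights P hsc
  have hx : ∀ i, xRoot P (ConnectiveAlgebra c M) i = connectiveVar c (P.root i) := fun _ => rfl
  have hadd : ∀ μ ν : M, ∃ g, connectiveVar c (μ + ν) =
      connectiveVar c μ + connectiveVar c ν + connectiveVar c μ * connectiveVar c ν * g :=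
    fun μ ν => ⟨-algebraMap R _ c, by rw [connectiveVar_add]; ring⟩
  have hne : ∀ i, xRoot P (ConnectiveAlgebra c M) i ≠ 0 := fun i hi => by
    obtain ⟨y, h⟩ := exists_isChart (connectiveLaw c) (Module.Free.chooseBasis ℤ M)
    have := h.connectiveHom_var (P.root i)
    rw [← hx, hi, map_zero] at this
    exact h.ne_zero (root_pairing_self_ne_zero i) this.symm
  refine ⟨hne, xRoot_coprime hsc hne (fun τ _ e t i j ht h₁ h₂ s hs => ?_) hdiv, ?_, ?_⟩
  · obtain ⟨y, h⟩ := exists_isChart (connectiveLaw c) e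
    have hd := map_dvd h.connectiveHom hs
    rw [hx, ← ht, h.connectiveHom_var, h.basis, map_mul, hx, h.connectiveHom_var] at hd
    rw [hx, ← ht]
    exact h.connectiveVar_dvd t s (h.X_dvd_of_dvd_mul ht h₁ h₂ hd)
  · intro i s
    obtain ⟨p, rfl⟩ := Ideal.Quotient.mk_surjective s
    have hw : RootPairing.weylGroup.ofIdx P i • (Ideal.Quotient.mk _ p : ConnectiveAlgebra c M) =
        Ideal.Quotient.mk _
          (MvPolynomial.rename (weightHom P (RootPairing.weylGroup.ofIdx P i)) p) :=
      Ideal.quotientMap_mk (H := connectiveIdeal_le c (weightHom P _))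
    rw [hw, ← aeval_connectiveVar, ← aeval_connectiveVar, ← dvd_neg, neg_sub]
    refine dvd_aeval_rename_sub (fun μ => ?_) p
    change _ ∣ connectiveVar c (RootPairing.weylGroup.ofIdx P i • μ) - _
    rw [ofIdx_smul_eq]
    exact dvd_map_sub_zsmul connectiveVar_zero hadd _ _ _
  · intro i
    rw [hx, hx, root_reflectionPerm_self]
    exact mul_dvd_add_neg connectiveVar_zero hadd _

end ConnectiveRegular

end SmallTorus
end

theorem mainTheorem4 {R : Type*} [CommRing R] [IsDomain R] [CharZero R]
    {ι M N : Type*} [Finite ι] [Nonempty ι] [AddCommGroup M] [AddCommGroup N]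
    -- the root datum of a simple, simply connected group with a choice of simple roots
    (P : RootPairing ι ℤ M N) [P.IsReduced]
    (hirr : ∀ s : Set ι, s.Nonempty → (∀ i ∈ s, ∀ j ∉ s, P.pairing i j = 0) → s = Set.univ)
    (hsc : P.corootSpan ℤ = ⊤) (b : P.Base)
    -- the highest root
    (θ : ι) (hθ : ∀ i, P.root θ - P.root i ∈ AddSubmonoid.closure (P.root '' b.support)) :
    (∀ (F : FormalGroup R) [F.IsComm],
      SmallTorus.DivisibleRootsCoprime P (SmallTorus.FormalGroupAlgebra F M) →
      ∀ f : Module.Dual (SmallTorus.LocalizedRing P (SmallTorus.FormalGroupAlgebra F M))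
          (SmallTorus.LatticeAlgebra P (SmallTorus.FormalGroupAlgebra F M)),
        f ∈ SmallTorus.relativeDual P (SmallTorus.FormalGroupAlgebra F M) b θ ↔
          SmallTorus.IsGrassmannianGKM f) ∧
    (∀ c : R,
      SmallTorus.DivisibleRootsCoprime P (SmallTorus.ConnectiveAlgebra c M) →
      ∀ f : Module.Dual (SmallTorus.LocalizedRing P (SmallTorus.ConnectiveAlgebra c M))
          (SmallTorus.LatticeAlgebra P (SmallTorus.ConnectiveAlgebra c M)),
        f ∈ SmallTorus.relativeDual P (SmallTorus.ConnectiveAlgebra c M) b θ ↔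
          SmallTorus.IsGrassmannianGKM f) := by
  refine ⟨fun F _ hdiv f => ?_, fun c hdiv f => ?_⟩
  · have := SmallTorus.isDomain_formalGroupAlgebra (P := P) (F := F) hsc
    exact (SmallTorus.isRegularCharacterRing_formalGroupAlgebra hsc hdiv).mem_relativeDual_iff
      hirr hθ hsc f
  · have := SmallTorus.isDomain_connectiveAlgebra (P := P) (c := c) hsc
    exact (SmallTorus.isRegularCharacterRing_connectiveAlgebra hsc hdiv).mem_relativeDual_iff
      hirr hθ hsc f
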